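/- Let $p\ge 2$, let $\omega_{m-1}=2\pi^{m/2}/\Gamma(m/2)$ be the area of the unit sphere of $\mathbb R^m$, and let $\omega_{p-1}(\mathrm dv)$ be the area measure on $\mathbb S^{p-1}$. Let $Y_1,Y_2,\dots$ be i.i.d. copies of a random vector $Y$ in $\mathbb R^p$ with Lebesgue density $q$, put $U_i=\|Y_i\|$, $V_i=Y_i/\|Y_i\|$, let $f(u,v)=u^{p-1}q(uv)$ be the density of $(U,V)=(\|Y\|,Y/\|Y\|)$ with respect to $\mathrm du\,\omega_{p-1}(\mathrm dv)$ on $\mathbb R^+\times\mathbb S^{p-1}$, where $\mathbb R^+=(0,\infty)$, and $f_U(u)=\int f(u,v)\,\omega_{p-1}(\mathrm dv)$. The law of $Y$ is called spherical if it has a Lebesgue density of the form $y\mapsto g(\|y\|)$. Define $$\mathcal M^2=\inf_g\int_{\mathbb R^+}\int_{\mathbb S^{p-1}}\bigl(f(u,v)-g(u)\,\omega_{p-1}^{-1}\bigr)^2\,\omega_{p-1}(\mathrm dv)\,\mathrm du ,$$ the infimum being over probability densities $g$ on $\mathbb R^+$. Let $D^2_f(u,x)$ be the Hessian at $x\in\mathbb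 S^{p-1}$ of $z\mapsto f(u,z/\|z\|)$. For $n\ge2$, $h>0$, $\kappa>0$ let $$\hat{\mathcal M}^2_n=\frac{1}{n(n-1)h}\sum_{i\ne j}K\Bigl(\frac{U_i-U_j}{h}\Bigr)\Bigl\{\frac{L(\kappa V_i^\top V_j)}{c_1(\kappa)}-\frac1{\omega_{p-1}}\Bigr\},$$ where the sum is over $1\le i\neq j\le n$, $L(\kappa t)=\kappa^{p/2-1}\{(2\pi)^{p/2}\mathcal I_{p/2-1}(\kappa)\}^{-1}e^{\kappa t}$ is the Langevin kernel ($\mathcal I_\nu$ the modified Bessel function of the first kind) and $c_1(\kappa)=\omega_{p-2}\int_0^\pi L(\kappa\cos\theta)(\sin\theta)^{p-2}\mathrm d\theta$. Assume: (K) $K$ is a symmetric probability density supported in $(-1,1)$ with $\int K^4<\infty$; (S) $f$ is twice differentiable on $\mathbb R^+\times\mathbb S^{p-1}$; for each $u$, $D^2_f(u,\cdot)$ is uniformly continuous on $\mathbb S^{p-1}$; for each $v$, $\partial^2f(\cdot,v)/\partial u^2$ is uniformly continuous on $\mathbb R^+$ and $f(u,v)\to0$ as $u\downarrow0$; and $f$,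 $\partial^2f/\partial u^2$ and the entries of $D^2_f$ are square integrable with respect to $\mathrm du\,\omega_{p-1}(\mathrm dv)$. Then $\hat{\mathcal M}^2_n$ is integrable for all $n\ge 2$, $h>0$, $\kappa>0$, the law of $Y$ is spherical if and only if $\mathcal M^2=0$, and: (i) If the law of $Y$ is spherical, then $\mathbb E\hat{\mathcal M}^2_n=0$ for all $n\ge2$, $h>0$, $\kappa>0$. (ii) If the law of $Y$ is not spherical, then $\mathcal M^2>0$, the second derivative $f_U''(u)$ exists for almost every $u>0$, $f_Uf_U''$ is integrable on $\mathbb R^+$, and, as $\kappa\to\infty$ and $h\downarrow0$, uniformly in $n\ge2$, $$\mathbb E\hat{\mathcal M}^2_n=\mathcal M^2+\frac{h^2\phi_2(K)}2\Bigl\{\int_{\mathbb S^{p-1}}\int_{\mathbb R^+}f\,\frac{\partial^2f}{\partial u^2}\,\mathrm du\,\omega_{p-1}(\mathrm dv)-\omega_{p-1}^{-1}\int_{\mathbb R^+}f_Uf_U''\,\mathrm du\Bigr\}+\frac1{2\kappa}\int_{\mathbb S^{p-1}}\int_{\mathbb R^+}f\,\mathrm{tr}\{D^2_f\}\,\mathrm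 du\,\omega_{p-1}(\mathrm dv)+O\bigl(\kappa^{-3/2}+h^3+h^2\kappa^{-1}\bigr),$$ with $\phi_2(K)=\int_{-1}^1x^2K(x)\,\mathrm dx$. In particular there are $\kappa_0,h_0>0$ such that $\mathbb E\hat{\mathcal M}^2_n>0$ for all $n\ge2$, $\kappa\ge\kappa_0$ and $0<h\le h_0$. -/

import Mathlib

open MeasureTheory ProbabilityTheory

noncomputable section

/-- Surface area `2 π^{m/2} / Γ(m/2)` of the unit sphere of `ℝ^m`
(so `ω_{p-1} = sphereArea p` and `ω_{p-2} = sphereArea (p - 1)`). -/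
def sphereArea (m : ℕ) : ℝ :=
  2 * Real.pi ^ ((m : ℝ) / 2) / Real.Gamma ((m : ℝ) / 2)

/-- The area measure on the unit sphere of `ℝ^p`. -/
def sphereMeasure (p : ℕ) : Measure (Metric.sphere (0 : EuclideanSpace ℝ (Fin p)) 1) :=
  (volume : Measure (EuclideanSpace ℝ (Fin p))).toSphere

/-- The measure `du ω(dv)` on `ℝ⁺ × S^{p-1}`. -/
def polarMeasure (p : ℕ) : Measure (ℝ × Metric.sphere (0 : EuclideanSpace ℝ (Fin p)) 1) :=
  (volume.restrict (Set.Ioi (0 : ℝ))).prod (sphereMeasure p)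

/-- The density `f(u,v)` of `(‖Y‖, Y/‖Y‖)` with respect to `du ω(dv)`, where `q` is the Lebesgue
density of `Y`; only `u > 0` and unit vectors `v` matter. -/
def polarDensity {p : ℕ} (q : EuclideanSpace ℝ (Fin p) → ℝ) (u : ℝ)
    (v : EuclideanSpace ℝ (Fin p)) : ℝ :=
  u ^ (p - 1) * q (u • v)

/-- The marginal density `f_U(u) = ∫ f(u,v) ω(dv)` of `‖Y‖`. -/
def radialMarginal {p : ℕ} (f : ℝ → EuclideanSpace ℝ (Fin p) → ℝ) (u : ℝ) : ℝ :=
  ∫ v : Metric.sphere (0 : EuclideanSpace ℝ (Fin p)) 1, f u v ∂(sphereMeasure p)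

/-- The second partial derivative `∂²f(u,v)/∂u²`. -/
def radialSecondDeriv {p : ℕ} (f : ℝ → EuclideanSpace ℝ (Fin p) → ℝ) (u : ℝ)
    (v : EuclideanSpace ℝ (Fin p)) : ℝ :=
  iteratedDeriv 2 (fun s => f s v) u

/-- The matrix `D²_f(u,x)` of second derivatives of `f(u,·)` on the sphere at the unit vector `x`:
the Hessian at `x` of `z ↦ f(u, z/‖z‖)`. For a unit vector `ξ ⊥ x`, the second derivative of
`θ ↦ f(u, x cos θ + ξ sin θ)` at `0` is `ξᵀ D²_f(u,x) ξ`, and `xᵀ D²_f(u,x) x = 0`. -/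
def sphericalHessian {p : ℕ} (f : ℝ → EuclideanSpace ℝ (Fin p) → ℝ) (u : ℝ)
    (x : EuclideanSpace ℝ (Fin p)) : Matrix (Fin p) (Fin p) ℝ :=
  Matrix.of fun i j =>
    iteratedFDeriv ℝ 2 (fun z : EuclideanSpace ℝ (Fin p) => f u (‖z‖⁻¹ • z)) x
      ![EuclideanSpace.single i 1, EuclideanSpace.single j 1]

/-- A law on `ℝ^p` is spherical if it has a Lebesgue density of the form `y ↦ g(‖y‖)`. -/
def IsSpherical {p : ℕ} (μ : Measure (EuclideanSpace ℝ (Fin p))) : Prop :=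
  ∃ g : ℝ → ENNReal, Measurable g ∧ μ = volume.withDensity (fun y => g ‖y‖)

/-- Probability densities on `ℝ⁺`. -/
def IsRadialDensity (g : ℝ → ℝ) : Prop :=
  Measurable g ∧ (∀ u, 0 ≤ g u) ∧ ∫⁻ u in Set.Ioi (0 : ℝ), ENNReal.ofReal (g u) = 1

/-- The measure of deviation from sphericity: the least value of `∫∫ (f(u,v) - g(u) f₀(v))² du ω(dv)`
over the probability densities `g` on `ℝ⁺`, with `f₀ = 1/ω_{p-1}` the uniform density. -/
def deviation {p : ℕ} (f : ℝ → EuclideanSpace ℝ (Fin p) → ℝ) : ℝ :=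
  (⨅ (g : ℝ → ℝ) (_ : IsRadialDensity g),
    ∫⁻ z, ENNReal.ofReal ((f z.1 z.2 - g z.1 * (sphereArea p)⁻¹) ^ 2) ∂(polarMeasure p)).toReal

/-- The modified Bessel function of the first kind of order `ν > -1/2`. -/
def besselI (ν κ : ℝ) : ℝ :=
  (κ / 2) ^ ν / (Real.Gamma (ν + 1 / 2) * Real.Gamma (1 / 2)) *
    ∫ t in (-1 : ℝ)..1, Real.exp (κ * t) * (1 - t ^ 2) ^ (ν - 1 / 2)

/-- The Langevin (Fisher-von-Mises) kernel; `langevin p κ t` is `L(κ t)`. -/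
def langevin (p : ℕ) (κ t : ℝ) : ℝ :=
  κ ^ ((p : ℝ) / 2 - 1) * ((2 * Real.pi) ^ ((p : ℝ) / 2) * besselI ((p : ℝ) / 2 - 1) κ)⁻¹ *
    Real.exp (κ * t)

/-- `c₁(κ) = ω_{p-2} ∫_0^π L(κ cos θ) (sin θ)^{p-2} dθ`. -/
def langevinMass (p : ℕ) (κ : ℝ) : ℝ :=
  sphereArea (p - 1) *
    ∫ θ in (0 : ℝ)..Real.pi, langevin p κ (Real.cos θ) * Real.sin θ ^ (p - 2)

/-- The estimator of `∫ f_U²`, from a sample `y` of size `n`. -/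
def radialEstimator {p n : ℕ} (K : ℝ → ℝ) (h : ℝ) (y : Fin n → EuclideanSpace ℝ (Fin p)) : ℝ :=
  1 / ((n : ℝ) * ((n : ℝ) - 1) * h) *
    ∑ ij ∈ (Finset.univ : Finset (Fin n)).offDiag, K ((‖y ij.1‖ - ‖y ij.2‖) / h)

/-- The estimator of `∫∫ f²`, from a sample `y` of size `n`. -/
def polarEstimator {p n : ℕ} (K : ℝ → ℝ) (h κ : ℝ) (y : Fin n → EuclideanSpace ℝ (Fin p)) : ℝ :=
  1 / ((n : ℝ) * ((n : ℝ) - 1) * langevinMass p κ * h) *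
    ∑ ij ∈ (Finset.univ : Finset (Fin n)).offDiag,
      K ((‖y ij.1‖ - ‖y ij.2‖) / h) *
        langevin p κ (inner ℝ (‖y ij.1‖⁻¹ • y ij.1) (‖y ij.2‖⁻¹ • y ij.2))

/-- The estimator of the deviation from sphericity. -/
def deviationEstimator {p n : ℕ} (K : ℝ → ℝ) (h κ : ℝ)
    (y : Fin n → EuclideanSpace ℝ (Fin p)) : ℝ :=
  polarEstimator K h κ y - (sphereArea p)⁻¹ * radialEstimator K h y

/-- Symmetric probability densities supported in `(-1,1)` with finite fourth moment `∫ K⁴`. -/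
structure IsKernel (K : ℝ → ℝ) : Prop where
  measurable : Measurable K
  nonneg : ∀ x, 0 ≤ K x
  integral_eq_one : ∫ x, K x = 1
  symm : ∀ x, K (-x) = K x
  support_subset : Function.support K ⊆ Set.Ioo (-1) 1
  integrable_pow_four : IntegrableOn (fun x => K x ^ 4) (Set.Ioo (-1) 1)

/-- `φ_j(K) = ∫_{-1}^1 x^j K(x) dx`. -/
def kernelMoment (j : ℕ) (K : ℝ → ℝ) : ℝ := ∫ x in (-1 : ℝ)..1, x ^ j * K x

/-- The smoothness assumption on the Lebesgue density `q` of `Y`, stated through the polar density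
`f = polarDensity q`. Twice differentiability on `ℝ⁺ × S^{p-1}` is expressed through `q` away from
the origin, which is equivalent since `(u,v) ↦ u v` is a diffeomorphism. -/
structure IsSmoothDensity {p : ℕ} (q : EuclideanSpace ℝ (Fin p) → ℝ) : Prop where
  differentiable : DifferentiableOn ℝ q {0}ᶜ
  twice_differentiable : DifferentiableOn ℝ (fderiv ℝ q) {0}ᶜ
  uniformContinuous_hessian : ∀ u : ℝ, 0 < u →
    UniformContinuous (fun v : Metric.sphere (0 : EuclideanSpace ℝ (Fin p)) 1 =>
      sphericalHessian (polarDensity q) u v)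
  uniformContinuousOn_radial : ∀ v : Metric.sphere (0 : EuclideanSpace ℝ (Fin p)) 1,
    UniformContinuousOn (fun u => radialSecondDeriv (polarDensity q) u v) (Set.Ioi 0)
  tendsto_zero : ∀ v : Metric.sphere (0 : EuclideanSpace ℝ (Fin p)) 1,
    Filter.Tendsto (fun u => polarDensity q u v) (nhdsWithin 0 (Set.Ioi 0)) (nhds 0)
  memLp : MemLp (fun z => polarDensity q z.1 z.2) 2 (polarMeasure p)
  memLp_radial : MemLp (fun z => radialSecondDeriv (polarDensity q) z.1 z.2) 2 (polarMeasure p)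
  memLp_hessian : ∀ i j : Fin p,
    MemLp (fun z => sphericalHessian (polarDensity q) z.1 z.2 i j) 2 (polarMeasure p)

end

/-! Write p = m + 2 and ω for the area of the sphere. For i ≠ j the pair (Y_i, Y_j) has law μ ⊗ μ,
so the expectation of the statistic is that of one pair kernel and does not involve n. In polar
coordinates it equals ω ∫∫ c(hs, θ) K(s) ds λ_κ(dθ) - ω⁻¹ ∫ c_U(hs) K(s) ds, which is
`estimatorMean`. Here c_U(x) = ∫ f_U(u) f_U(u+x) du, the angle law λ_κ has density proportional to
exp(κ cos θ) sin^m θ on (0, π), and c(x, θ) correlates f with its copy translated by x in u and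
turned by θ in v, in a uniformly random tangent direction.

The random direction is handled by frames. The sphere is replaced by the orthogonal group with an
invariant probability, the point v being the first column. Turning v inside the plane of the first
two columns is right multiplication by a one-parameter group, hence a measure preserving flow on ℝ ×
O(p) which commutes with translations of u (`lintegral_sphere_pair`, `isFlow_spin`, `isFlow_shift`).

Let Φ be the lift of f, extended by zero to u ≤ 0, and let Δ_t be the second difference along a
flow. If Δ_tΦ is the average of H along the flow against the tent (t - |r|)₊, then ‖Δ_tΦ‖ ≤ t²‖H‖,
and shifting the flow from H to Φ gives ⟨Φ, Δ_tΦ⟩ = t²⟨Φ, H⟩ + O(t⁴), with H merely square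
integrable (`IsFlow.expansion`). For rotations, H is the second derivative along great circles, and
averaging over directions turns it into the trace divided by p - 1 (`integral_frameHessian`). For
translations, the extension by zero has a corner at u = 0, which adds f'(0+) times a tent. Its
contribution is O(t³), because f vanishes at the boundary and f'(0+) is square integrable in v
(`halfLine_expansion`).

Since c is even in each variable, it splits into a pure x term, a pure θ term and ⟨Δ_xΦ, Δ_θΦ⟩/4
(`IsSmoothDensity.correlation_decomposition`). By Cauchy-Schwarz the last one is O(|x|³ + θ⁴), so no
mixed derivative of f is needed. Under λ_κ the mean of θ² is (p-1)/κ + O(κ⁻²) and that of θ⁴ is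
O(κ⁻²) (`exists_angleInt_moments`), which produces the 1/(2κ) term. The remainder obtained is O(h³ +
κ⁻²), stronger than the one claimed.

The constant term is ∫∫f² - ω⁻¹∫f_U². This is the squared deviation, because the best approximation
of f(u,·) by a constant is its mean f_U(u)/ω, and f_U is itself an admissible radial density
(`IsSmoothDensity.deviation_eq`). In the spherical case f = f_U/ω almost everywhere, so c(x, θ) =
ω⁻² c_U(x) and the two terms of the expectation cancel exactly. -/

noncomputable section

/-! ### Polar coordinates, rotation invariance and zonal integrals -/

/-- The Euclidean space `ℝ^p`. -/
abbrev Euc (p : ℕ) := EuclideanSpace ℝ (Fin p)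

/-- The unit sphere of `ℝ^p`. -/
abbrev Sph (p : ℕ) := Metric.sphere (0 : EuclideanSpace ℝ (Fin p)) 1

instance (p : ℕ) : IsFiniteMeasure (sphereMeasure p) := by
  unfold sphereMeasure; infer_instance

instance (p : ℕ) : SFinite (polarMeasure p) := by
  unfold polarMeasure; infer_instance

theorem lintegral_volumeIoiPow (n : ℕ) (φ : ℝ → ENNReal) (hφ : Measurable φ) :
    ∫⁻ u : Set.Ioi (0 : ℝ), φ u ∂(Measure.volumeIoiPow n) =
      ∫⁻ u in Set.Ioi (0 : ℝ), ENNReal.ofReal (u ^ n) * φ u := by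
  unfold Measure.volumeIoiPow
  rw [lintegral_withDensity_eq_lintegral_mul _ (by fun_prop) (by fun_prop)]
  exact lintegral_subtype_comap measurableSet_Ioi
    (fun u : ℝ => ENNReal.ofReal (u ^ n) * φ u)

/-- Integration in polar coordinates. -/
theorem lintegral_polar {p : ℕ} (φ : Euc p → ENNReal) (hφ : Measurable φ) (hp : 1 ≤ p) :
    ∫⁻ y, φ y = ∫⁻ z, ENNReal.ofReal (z.1 ^ (p - 1)) * φ (z.1 • (z.2 : Euc p))
      ∂(polarMeasure p) := by
  have : Nonempty (Fin p) := ⟨⟨0, hp⟩⟩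
  have h1 : ∫⁻ y, φ y = ∫⁻ x : ({(0)}ᶜ : Set (Euc p)), φ x ∂(volume.comap Subtype.val) := by
    rw [lintegral_subtype_comap (measurableSet_singleton _).compl φ, restrict_compl_singleton]
  have h2 := (volume : Measure (Euc p)).measurePreserving_homeomorphUnitSphereProd
  have h3 : ∫⁻ x : ({(0)}ᶜ : Set (Euc p)), φ x ∂(volume.comap Subtype.val) =
      ∫⁻ x, φ (x.2.1 • (x.1 : Euc p)) ∂((sphereMeasure p).prod (Measure.volumeIoiPow (p - 1))) := by
    rw [finrank_euclideanSpace_fin] at h2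
    unfold sphereMeasure
    rw [← h2.lintegral_comp (f := fun x => φ (x.2.1 • (x.1 : Euc p))) (by fun_prop)]
    refine lintegral_congr fun x => ?_
    congr 1
    have hx : ‖(x : Euc p)‖ ≠ 0 := norm_ne_zero_iff.2 x.2
    simp [smul_smul, hx]
  rw [h1, h3, lintegral_prod _ (by fun_prop), polarMeasure, lintegral_prod_symm _ (by fun_prop)]
  refine lintegral_congr fun v => ?_
  exact lintegral_volumeIoiPow (p - 1) (fun u => φ (u • (v : Euc p))) (by fun_prop)

/-- The normalizing constant in the passage from the sphere to the whole space. -/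
def radialMass (p : ℕ) : ENNReal :=
  ∫⁻ u in Set.Ioi (0 : ℝ), ENNReal.ofReal (u ^ (p - 1)) * ENNReal.ofReal (Real.exp (-u))

theorem radialMass_ne_zero (p : ℕ) : radialMass p ≠ 0 := by
  unfold radialMass
  intro h
  rw [lintegral_eq_zero_iff (by fun_prop)] at h
  have h0 : ∀ᵐ u ∂(volume.restrict (Set.Ioi (0 : ℝ))), False := by
    filter_upwards [h, ae_restrict_mem measurableSet_Ioi] with u hu hu0
    have hu0' : 0 < u := hu0
    have : 0 < ENNReal.ofReal (u ^ (p - 1)) * ENNReal.ofReal (Real.exp (-u)) :=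
      ENNReal.mul_pos (ENNReal.ofReal_pos.2 (pow_pos hu0' _)).ne'
        (ENNReal.ofReal_pos.2 (Real.exp_pos _)).ne'
    exact this.ne' hu
  rw [Filter.eventually_false_iff_eq_bot, ae_eq_bot, Measure.restrict_eq_zero] at h0
  simp at h0

theorem radialMass_ne_top (p : ℕ) : radialMass p ≠ ⊤ := by
  unfold radialMass
  have h := Real.GammaIntegral_convergent (s := ((p - 1 : ℕ) : ℝ) + 1) (by positivity)
  have h2 := h.lintegral_lt_top
  refine (lt_of_eq_of_lt ?_ h2).ne
  refine setLIntegral_congr_fun measurableSet_Ioi fun u hu => ?_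
  have hu0 : 0 < u := hu
  simp only [add_sub_cancel_right, Real.rpow_natCast]
  rw [← ENNReal.ofReal_mul (by positivity), mul_comm]

/-- The weight exp(-‖y‖) makes the radial factor finite and nonzero, so it can be cancelled. This is
how facts about Lebesgue measure (isometries, slicing) pass to the sphere. -/
theorem lintegral_exp_mul_direction {p : ℕ} (hp : 1 ≤ p) (ψ : Euc p → ENNReal)
    (hψ : Measurable ψ) :
    ∫⁻ y, ENNReal.ofReal (Real.exp (-‖y‖)) * ψ (‖y‖⁻¹ • y) =
      radialMass p * ∫⁻ v : Sph p, ψ v ∂(sphereMeasure p) := by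
  rw [lintegral_polar _ (by fun_prop) hp, polarMeasure, lintegral_prod _ (by fun_prop),
    radialMass, ← lintegral_mul_const _ (by fun_prop)]
  refine setLIntegral_congr_fun measurableSet_Ioi fun u hu => ?_
  have hu0 : 0 < u := hu
  simp only []
  rw [← lintegral_const_mul _ (by fun_prop)]
  refine lintegral_congr fun v => ?_
  have hv : ‖(v : Euc p)‖ = 1 := by simp
  rw [norm_smul, hv, Real.norm_of_nonneg hu0.le, mul_one, smul_smul, inv_mul_cancel₀ hu0.ne',
    one_smul, mul_assoc]

theorem sphereArea_pos {m : ℕ} (hm : 1 ≤ m) : 0 < sphereArea m := by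
  unfold sphereArea
  have hm' : (0 : ℝ) < m := by exact_mod_cast hm
  have := Real.Gamma_pos_of_pos (half_pos hm')
  positivity

/-- The sphere has p times the volume of the unit ball, and Γ(p/2 + 1) = (p/2) Γ(p/2) turns this
into the closed form. -/
theorem sphereMeasure_univ {p : ℕ} (hp : 1 ≤ p) :
    sphereMeasure p Set.univ = ENNReal.ofReal (sphereArea p) := by
  have : Nonempty (Fin p) := ⟨⟨0, hp⟩⟩
  unfold sphereMeasure
  rw [Measure.toSphere_apply_univ, EuclideanSpace.volume_ball, finrank_euclideanSpace_fin]
  have hm' : (0 : ℝ) < p := by exact_mod_cast hp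
  simp only [ENNReal.ofReal_one, one_pow, one_mul, Fintype.card_fin]
  rw [← ENNReal.ofReal_natCast, ← ENNReal.ofReal_mul (by positivity)]
  congr 1
  unfold sphereArea
  rw [Real.Gamma_add_one (by positivity), Real.sqrt_eq_rpow, ← Real.rpow_natCast,
    ← Real.rpow_mul Real.pi_pos.le]
  have := Real.Gamma_pos_of_pos (half_pos hm')
  have h2 : (1 / 2 * (p : ℝ)) = p / 2 := by ring
  rw [h2]
  field_simp

/-- The weight exp(-‖y‖) is invariant under isometries, as is Lebesgue measure. Both sides times
`radialMass` are the same integral over the whole space. -/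
theorem lintegral_sphere_isometry {p : ℕ} (hp : 1 ≤ p) (L : Euc p ≃ₗᵢ[ℝ] Euc p)
    (ψ : Euc p → ENNReal) (hψ : Measurable ψ) :
    ∫⁻ v : Sph p, ψ (L v) ∂(sphereMeasure p) = ∫⁻ v : Sph p, ψ v ∂(sphereMeasure p) := by
  have h1 := lintegral_exp_mul_direction hp ψ hψ
  have h2 := lintegral_exp_mul_direction hp (fun x => ψ (L x))
    (hψ.comp L.continuous.measurable)
  have h3 : ∫⁻ y, ENNReal.ofReal (Real.exp (-‖y‖)) * ψ (L (‖y‖⁻¹ • y)) =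
      ∫⁻ y : Euc p, ENNReal.ofReal (Real.exp (-‖y‖)) * ψ (‖y‖⁻¹ • y) := by
    rw [← L.measurePreserving.lintegral_comp
      (f := fun y : Euc p => ENNReal.ofReal (Real.exp (-‖y‖)) * ψ (‖y‖⁻¹ • y)) (by fun_prop)]
    simp
  rw [h3, h1] at h2
  exact ((ENNReal.mul_right_inj (radialMass_ne_zero p) (radialMass_ne_top p)).1 h2).symm

theorem lintegral_norm {m : ℕ} (hm : 1 ≤ m) (χ : ℝ → ENNReal) (hχ : Measurable χ) :
    ∫⁻ y : Euc m, χ ‖y‖ = ENNReal.ofReal (sphereArea m) *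
      ∫⁻ r in Set.Ioi (0 : ℝ), ENNReal.ofReal (r ^ (m - 1)) * χ r := by
  rw [lintegral_polar _ (by fun_prop) hm, polarMeasure, lintegral_prod _ (by fun_prop),
    ← lintegral_const_mul _ (by fun_prop)]
  refine setLIntegral_congr_fun measurableSet_Ioi fun u hu => ?_
  have hu0 : 0 < u := hu
  have : ∀ v : Sph m, ENNReal.ofReal (u ^ (m - 1)) * χ ‖u • (v : Euc m)‖ =
      ENNReal.ofReal (u ^ (m - 1)) * χ u := by
    intro v
    have hv : ‖(v : Euc m)‖ = 1 := by simp
    rw [norm_smul, hv, Real.norm_of_nonneg hu0.le, mul_one]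
  simp only [this]
  rw [lintegral_const, sphereMeasure_univ hm, mul_comm]

/-- Slicing along the axis e₀, so that the orthogonal part can be integrated in its own polar
coordinates. -/
theorem lintegral_fin_succ {m : ℕ} (χ : ℝ → ℝ → ENNReal) (hχ : Measurable χ.uncurry) :
    ∫⁻ y : Euc (m + 1), χ (y 0) ‖y‖ =
      ∫⁻ s : ℝ, ∫⁻ y : Euc m, χ s (Real.sqrt (s ^ 2 + ‖y‖ ^ 2)) := by
  have h1 := PiLp.volume_preserving_toLp (Fin (m + 1))
  have h2 := (volume_preserving_piFinSuccAbove (fun _ : Fin (m + 1) => ℝ) 0).symm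
  have h3 := (MeasurePreserving.id (volume : Measure ℝ)).prod (PiLp.volume_preserving_ofLp (Fin m))
  have h4 := h1.comp (h2.comp h3)
  have hf : Measurable fun y : Euc (m + 1) => χ (y 0) ‖y‖ :=
    hχ.comp (f := fun y : Euc (m + 1) => (y 0, ‖y‖)) (by fun_prop)
  have hg : Measurable fun x : ℝ × Euc m => χ x.1 (Real.sqrt (x.1 ^ 2 + ‖x.2‖ ^ 2)) :=
    hχ.comp (f := fun x : ℝ × Euc m => (x.1, Real.sqrt (x.1 ^ 2 + ‖x.2‖ ^ 2))) (by fun_prop)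
  rw [← h4.lintegral_comp hf]
  rw [← Measure.volume_eq_prod, Measure.volume_eq_prod, lintegral_prod _ ?_]
  · refine lintegral_congr fun s => lintegral_congr fun y => ?_
    have e0 : ((WithLp.toLp 2 ∘ ⇑(MeasurableEquiv.piFinSuccAbove (fun _ : Fin (m + 1) => ℝ) 0).symm ∘
        Prod.map id WithLp.ofLp) (s, y) : Euc (m + 1)) = WithLp.toLp 2 (Fin.cons s y.ofLp) := by
      simp [MeasurableEquiv.piFinSuccAbove]
      rfl
    rw [e0]
    congr 1
    rw [EuclideanSpace.norm_eq, Fin.sum_univ_succ]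
    simp [EuclideanSpace.norm_sq_eq]
  · exact (hf.comp h4.measurable).aemeasurable

/-- Integrals of zonal functions over the sphere of `ℝ^{m+1}`, with respect to the pole `e₀`. -/
theorem lintegral_sphere_zonal {m : ℕ} (hm : 1 ≤ m) (ψ : ℝ → ENNReal) (hψ : Measurable ψ) :
    ∫⁻ v : Sph (m + 1), ψ ((v : Euc (m + 1)) 0) ∂(sphereMeasure (m + 1)) =
      ENNReal.ofReal (sphereArea m) *
        ∫⁻ θ in Set.Ioo 0 Real.pi, ψ (Real.cos θ) * ENNReal.ofReal (Real.sin θ ^ (m - 1)) := by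
  have h1 := lintegral_exp_mul_direction (p := m + 1) (by omega) (fun y => ψ (y 0)) (by fun_prop)
  have h2 := lintegral_fin_succ (m := m)
    (fun a b => ENNReal.ofReal (Real.exp (-b)) * ψ (b⁻¹ * a)) (by
      unfold Function.uncurry; fun_prop)
  have h3 : ∫⁻ y : Euc (m + 1), ENNReal.ofReal (Real.exp (-‖y‖)) * ψ ((‖y‖⁻¹ • y) 0) =
      ∫⁻ y : Euc (m + 1), ENNReal.ofReal (Real.exp (-‖y‖)) * ψ (‖y‖⁻¹ * y 0) := by
    simp
  rw [h3, h2] at h1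
  have h4 : ∀ s : ℝ, ∫⁻ y : Euc m, ENNReal.ofReal (Real.exp (-Real.sqrt (s ^ 2 + ‖y‖ ^ 2))) *
      ψ ((Real.sqrt (s ^ 2 + ‖y‖ ^ 2))⁻¹ * s) = ENNReal.ofReal (sphereArea m) *
      ∫⁻ r, (Set.Ioi (0 : ℝ)).indicator (fun r => ENNReal.ofReal (r ^ (m - 1)) *
        (ENNReal.ofReal (Real.exp (-Real.sqrt (s ^ 2 + r ^ 2))) *
          ψ ((Real.sqrt (s ^ 2 + r ^ 2))⁻¹ * s))) r := by
    intro s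
    rw [lintegral_indicator measurableSet_Ioi]
    exact lintegral_norm hm (fun r => ENNReal.ofReal (Real.exp (-Real.sqrt (s ^ 2 + r ^ 2))) *
      ψ ((Real.sqrt (s ^ 2 + r ^ 2))⁻¹ * s)) (by fun_prop)
  -- After integrating out the direction orthogonal to the axis, an integral over a half plane
  -- remains, in the axial coordinate and the distance to the axis. Planar polar coordinates there
  -- introduce the angle θ ∈ (0, π).
  set χ : ℝ × ℝ → ENNReal := (Set.univ ×ˢ Set.Ioi (0 : ℝ)).indicator fun x =>
    ENNReal.ofReal (x.2 ^ (m - 1)) *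
        (ENNReal.ofReal (Real.exp (-Real.sqrt (x.1 ^ 2 + x.2 ^ 2))) *
          ψ ((Real.sqrt (x.1 ^ 2 + x.2 ^ 2))⁻¹ * x.1)) with hχ
  have hχm : Measurable χ := by
    refine Measurable.indicator (by fun_prop) (MeasurableSet.univ.prod measurableSet_Ioi)
  have h5 : ∫⁻ s : ℝ, ∫⁻ y : Euc m,
      ENNReal.ofReal (Real.exp (-Real.sqrt (s ^ 2 + ‖y‖ ^ 2))) *
      ψ ((Real.sqrt (s ^ 2 + ‖y‖ ^ 2))⁻¹ * s) = ENNReal.ofReal (sphereArea m) * ∫⁻ x, χ x := by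
    have h5' : ∫⁻ x, χ x = ∫⁻ s : ℝ, ∫⁻ r : ℝ, χ (s, r) := by
      rw [Measure.volume_eq_prod, lintegral_prod _ hχm.aemeasurable]
    rw [h5', ← lintegral_const_mul _ hχm.lintegral_prod_right']
    refine lintegral_congr fun s => ?_
    rw [h4]
    congr 1
    refine lintegral_congr fun r => ?_
    simp [hχ, Set.indicator_apply]
  have h6 : ∫⁻ x, χ x = radialMass (m + 1) *
      ∫⁻ θ in Set.Ioo 0 Real.pi, ψ (Real.cos θ) * ENNReal.ofReal (Real.sin θ ^ (m - 1)) := by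
    rw [← lintegral_comp_polarCoord_symm, polarCoord_target, Measure.volume_eq_prod,
      ← Measure.prod_restrict, lintegral_prod _ ?_]
    swap
    · exact (Measurable.smul (f := fun x : ℝ × ℝ => ENNReal.ofReal x.1) (by fun_prop)
        (hχm.comp continuous_polarCoord_symm.measurable)).aemeasurable
    rw [radialMass, ← lintegral_mul_const _ (by fun_prop)]
    refine setLIntegral_congr_fun measurableSet_Ioi fun r hr => ?_
    have hr0 : 0 < r := hr
    simp only []
    rw [← lintegral_const_mul _ (by fun_prop)]
    have hsub : Set.Ioo 0 Real.pi ⊆ Set.Ioo (-Real.pi) Real.pi :=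
      Set.Ioo_subset_Ioo_left (by linarith [Real.pi_pos])
    rw [← lintegral_indicator measurableSet_Ioo, ← lintegral_indicator measurableSet_Ioo]
    refine lintegral_congr fun θ => ?_
    by_cases h0 : θ ∈ Set.Ioo 0 Real.pi
    · rw [Set.indicator_of_mem h0, Set.indicator_of_mem (hsub h0)]
      have hs : 0 < Real.sin θ := Real.sin_pos_of_mem_Ioo h0
      have hsq : Real.sqrt ((r * Real.cos θ) ^ 2 + (r * Real.sin θ) ^ 2) = r := by
        rw [show (r * Real.cos θ) ^ 2 + (r * Real.sin θ) ^ 2 = r ^ 2 by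
          have := Real.sin_sq_add_cos_sq θ
          linear_combination r ^ 2 * this, Real.sqrt_sq hr0.le]
      have hmem : (r * Real.cos θ, r * Real.sin θ) ∈ (Set.univ : Set ℝ) ×ˢ Set.Ioi (0 : ℝ) := by
        simp only [Set.mem_prod, Set.mem_univ, true_and, Set.mem_Ioi]; positivity
      simp only [polarCoord_symm_apply, hχ, Set.indicator_of_mem hmem, hsq, smul_eq_mul]
      rw [show r⁻¹ * (r * Real.cos θ) = Real.cos θ by field_simp, mul_pow,
        ENNReal.ofReal_mul (by positivity), Nat.add_sub_cancel]
      -- The Jacobian r times (r sin θ)^(m-1) is r^m sin^(m-1) θ; r^m is the exponent of `radialMass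
      -- (m + 1)`, which then cancels.
      obtain ⟨k, rfl⟩ : ∃ k, m = k + 1 := ⟨m - 1, by omega⟩
      rw [Nat.add_sub_cancel, pow_succ', ENNReal.ofReal_mul hr0.le]
      ring
    · rw [Set.indicator_of_notMem h0]
      by_cases h1 : θ ∈ Set.Ioo (-Real.pi) Real.pi
      · rw [Set.indicator_of_mem h1]
        have hs : Real.sin θ ≤ 0 := by
          refine Real.sin_nonpos_of_nonpos_of_neg_pi_le ?_ h1.1.le
          by_contra hc
          exact h0 ⟨not_le.1 hc, h1.2⟩
        have hmem : (r * Real.cos θ, r * Real.sin θ) ∉ (Set.univ : Set ℝ) ×ˢ Set.Ioi (0 : ℝ) := by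
          simp only [Set.mem_prod, Set.mem_univ, true_and, Set.mem_Ioi, not_lt]
          exact mul_nonpos_of_nonneg_of_nonpos hr0.le hs
        simp [polarCoord_symm_apply, hχ, Set.indicator_of_notMem hmem]
      · rw [Set.indicator_of_notMem h1]
  rw [h5, h6] at h1
  refine (ENNReal.mul_right_inj (radialMass_ne_zero (m + 1)) (radialMass_ne_top (m + 1))).1 ?_
  rw [← h1]
  ring

end

/-! ### The orthogonal group, frames and integration over pairs of points -/

noncomputable section

/-- The orthogonal group of `ℝ^p`. -/
abbrev OG (p : ℕ) := ↥(Matrix.orthogonalGroup (Fin p) ℝ)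

instance (p : ℕ) : MeasurableSpace (OG p) := borel _

instance (p : ℕ) : BorelSpace (OG p) := ⟨rfl⟩

instance (p : ℕ) : SecondCountableTopology (OG p) :=
  have : SecondCountableTopology (Matrix (Fin p) (Fin p) ℝ) :=
    inferInstanceAs (SecondCountableTopology (Fin p → Fin p → ℝ))
  TopologicalSpace.Subtype.secondCountableTopology
    (Matrix.orthogonalGroup (Fin p) ℝ : Set (Matrix (Fin p) (Fin p) ℝ))

/-- A closed set of matrices with entries in [-1, 1]. Compactness lets Haar measure be normalized to
total mass one. -/
instance (p : ℕ) : CompactSpace (OG p) := by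
  have hc : IsClosed (Matrix.orthogonalGroup (Fin p) ℝ : Set (Matrix (Fin p) (Fin p) ℝ)) :=
    isClosed_unitary
  refine isCompact_iff_compactSpace.1 (IsCompact.of_isClosed_subset
    (isCompact_univ_pi fun _ => isCompact_univ_pi fun _ => isCompact_Icc (a := (-1 : ℝ)) (b := 1))
    hc fun A hA => ?_)
  intro i _ j _
  have := entry_norm_bound_of_unitary hA i j
  exact Set.mem_Icc.2 (abs_le.1 this)

/-- The right invariant probability measure on the orthogonal group. -/
def orthMeasure (p : ℕ) : Measure (OG p) := (Measure.haarMeasure ⊤).inv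

instance (p : ℕ) : (orthMeasure p).IsMulRightInvariant := by
  unfold orthMeasure; infer_instance

instance (p : ℕ) : IsProbabilityMeasure (orthMeasure p) := by
  constructor
  have h := Measure.haarMeasure_self (K₀ := (⊤ : TopologicalSpace.PositiveCompacts (OG p)))
  unfold orthMeasure
  rw [Measure.inv_apply, Set.inv_univ]
  simpa using h

theorem lintegral_orth_mul_right {p : ℕ} (φ : OG p → ENNReal) (g : OG p) :
    ∫⁻ x, φ (x * g) ∂(orthMeasure p) = ∫⁻ x, φ x ∂(orthMeasure p) :=
  lintegral_mul_right_eq_self φ g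

/-- The columns of an orthogonal matrix. -/
def col {p : ℕ} (g : OG p) (j : Fin p) : Euc p := WithLp.toLp 2 fun i => g.1 i j

@[simp] theorem col_apply {p : ℕ} (g : OG p) (j i : Fin p) : col g j i = g.1 i j := rfl

theorem inner_col {p : ℕ} (g : OG p) (i j : Fin p) :
    inner ℝ (col g i) (col g j) = if i = j then 1 else 0 := by
  have h := (Matrix.mem_orthogonalGroup_iff' _ _).1 g.2
  have h2 := congrFun (congrFun h i) j
  rw [Matrix.mul_apply, Matrix.one_apply] at h2
  rw [← h2]
  simp [PiLp.inner_apply, mul_comm]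

theorem orthonormal_col {p : ℕ} (g : OG p) : Orthonormal ℝ (col g) :=
  orthonormal_iff_ite.2 (inner_col g)

@[simp] theorem norm_col {p : ℕ} (g : OG p) (j : Fin p) : ‖col g j‖ = 1 :=
  (orthonormal_col g).1 j

/-- The columns as points of the unit sphere. -/
def colS {p : ℕ} (g : OG p) (j : Fin p) : Sph p := ⟨col g j, by simp⟩

@[simp] theorem coe_colS {p : ℕ} (g : OG p) (j : Fin p) : (colS g j : Euc p) = col g j := rfl

theorem continuous_col {p : ℕ} (j : Fin p) : Continuous fun g : OG p => col g j := by
  refine (PiLp.continuous_toLp 2 _).comp (continuous_pi fun i => ?_)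
  exact (continuous_apply_apply i j).comp continuous_subtype_val

@[fun_prop] theorem measurable_col {p : ℕ} (j : Fin p) : Measurable fun g : OG p => col g j :=
  (continuous_col j).measurable

@[fun_prop] theorem measurable_colS {p : ℕ} (j : Fin p) : Measurable fun g : OG p => colS g j :=
  (measurable_col j).subtype_mk

theorem col_mul {p : ℕ} (g A : OG p) (j : Fin p) : col (g * A) j = ∑ k, A.1 k j • col g k := by
  ext i
  simp [Matrix.mul_apply, mul_comm]

/-- The linear isometry sending the standard basis to the columns of `g`. -/
def orthIsom {p : ℕ} (g : OG p) : Euc p ≃ₗᵢ[ℝ] Euc p :=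
  (OrthonormalBasis.mk (orthonormal_col g)
    ((orthonormal_col g).linearIndependent.span_eq_top_of_card_eq_finrank' (by simp)).ge).repr.symm

theorem orthIsom_single {p : ℕ} (g : OG p) (j : Fin p) :
    orthIsom g (EuclideanSpace.single j 1) = col g j := by
  unfold orthIsom
  rw [OrthonormalBasis.repr_symm_single]
  simp

theorem orthIsom_apply {p : ℕ} (g : OG p) (x : Euc p) : orthIsom g x = ∑ j, x j • col g j := by
  conv_lhs => rw [← (EuclideanSpace.basisFun (Fin p) ℝ).sum_repr x]
  rw [map_sum]
  refine Finset.sum_congr rfl fun j _ => ?_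
  rw [map_smul, EuclideanSpace.basisFun_apply, orthIsom_single]
  simp

theorem orthIsom_col {p : ℕ} (g A : OG p) (j : Fin p) : orthIsom g (col A j) = col (g * A) j := by
  rw [orthIsom_apply, col_mul]; rfl

/-- The orthogonal matrix whose columns form a given orthonormal basis. -/
def orthOfBasis {p : ℕ} (b : OrthonormalBasis (Fin p) ℝ (Euc p)) : OG p :=
  ⟨Matrix.of fun i j => b j i, by
    rw [Matrix.mem_orthogonalGroup_iff']
    ext i j
    rw [Matrix.mul_apply, Matrix.one_apply]
    have := orthonormal_iff_ite.1 b.orthonormal i j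
    rw [← this]
    simp [PiLp.inner_apply, mul_comm]⟩

theorem col_orthOfBasis {p : ℕ} (b : OrthonormalBasis (Fin p) ℝ (Euc p)) (j : Fin p) :
    col (orthOfBasis b) j = b j := rfl

theorem exists_col_zero {m : ℕ} (x : Euc (m + 2)) (hx : ‖x‖ = 1) : ∃ g : OG (m + 2), col g 0 = x := by
  have hv : Orthonormal ℝ (({0} : Set (Fin (m + 2))).domRestrict fun _ => x) := by
    rw [orthonormal_iff_ite]
    rintro ⟨i, hi⟩ ⟨j, hj⟩
    have hi' : i = 0 := hi
    have hj' : j = 0 := hj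
    subst hi' hj'
    simp [Set.domRestrict, hx]
  obtain ⟨b, hb⟩ := hv.exists_orthonormalBasis_extension_of_card_eq (by simp)
  exact ⟨orthOfBasis b, by rw [col_orthOfBasis, hb 0 rfl]⟩

theorem exists_col_zero_one {m : ℕ} (x ξ : Euc (m + 2)) (hx : ‖x‖ = 1) (hξ : ‖ξ‖ = 1)
    (hxξ : inner ℝ x ξ = 0) : ∃ g : OG (m + 2), col g 0 = x ∧ col g 1 = ξ := by
  have hξx : inner ℝ ξ x = 0 := by rw [real_inner_comm]; exact hxξ
  have hv : Orthonormal ℝ (({0, 1} : Set (Fin (m + 2))).domRestrict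
      fun i => if i = 0 then x else ξ) := by
    rw [orthonormal_iff_ite]
    rintro ⟨i, hi⟩ ⟨j, hj⟩
    rcases hi with rfl | hi
    · rcases hj with rfl | hj
      · simp [Set.domRestrict, hx]
      · have hj' : j = 1 := hj
        subst hj'
        simp [Set.domRestrict, hxξ, Subtype.ext_iff]
    · have hi' : i = 1 := hi
      subst hi'
      rcases hj with rfl | hj
      · simp [Set.domRestrict, hξx, Subtype.ext_iff]
      · have hj' : j = 1 := hj
        subst hj'
        simp [Set.domRestrict, hξ]
  obtain ⟨b, hb⟩ := hv.exists_orthonormalBasis_extension_of_card_eq (by simp)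
  refine ⟨orthOfBasis b, ?_, ?_⟩
  · rw [col_orthOfBasis, hb 0 (by simp)]; simp
  · rw [col_orthOfBasis, hb 1 (by simp)]; simp

/-- The rotation by `θ` in the plane of the first two basis vectors. -/
def rotMat (m : ℕ) (θ : ℝ) : Matrix (Fin (m + 2)) (Fin (m + 2)) ℝ :=
  1 + (Real.cos θ - 1) • (Matrix.single 0 0 1 + Matrix.single 1 1 1) +
    Real.sin θ • (Matrix.single 1 0 1 - Matrix.single 0 1 1)

/-- With P the projection on the plane and J the quarter turn in it, PP = P, PJ = JP = J and JJ =
-P. The claim becomes the addition formulas for cosine and sine. -/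
theorem rotMat_mul (m : ℕ) (s t : ℝ) : rotMat m s * rotMat m t = rotMat m (s + t) := by
  set P : Matrix (Fin (m + 2)) (Fin (m + 2)) ℝ := Matrix.single 0 0 1 + Matrix.single 1 1 1 with hP
  set J : Matrix (Fin (m + 2)) (Fin (m + 2)) ℝ := Matrix.single 1 0 1 - Matrix.single 0 1 1 with hJ
  have hPP : P * P = P := by
    simp [hP, mul_add, add_mul, Matrix.single_mul_single_of_ne]
  have hPJ : P * J = J := by
    simp [hP, hJ, mul_sub, add_mul, Matrix.single_mul_single_of_ne]
  have hJP : J * P = J := by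
    simp [hP, hJ, mul_add, sub_mul, Matrix.single_mul_single_of_ne]
    abel
  have hJJ : J * J = -P := by
    simp [hP, hJ, mul_sub, sub_mul, Matrix.single_mul_single_of_ne]
    abel
  have hr : ∀ θ, rotMat m θ = 1 + (Real.cos θ - 1) • P + Real.sin θ • J := fun θ => rfl
  rw [hr, hr, hr, Real.cos_add, Real.sin_add]
  simp only [mul_add, add_mul, one_mul, mul_one, smul_mul_assoc, mul_smul_comm, hPP, hPJ, hJP, hJJ,
    smul_neg]
  module

theorem rotMat_transpose (m : ℕ) (s : ℝ) : (rotMat m s).transpose = rotMat m (-s) := by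
  simp only [rotMat, Matrix.transpose_add, Matrix.transpose_smul, Matrix.transpose_sub,
    Matrix.transpose_single, Matrix.transpose_one, Real.cos_neg, Real.sin_neg]
  module

theorem rotMat_zero (m : ℕ) : rotMat m 0 = 1 := by simp [rotMat]

/-- The rotation by `θ` in the plane of the first two basis vectors, as a group element. -/
def rot (m : ℕ) (θ : ℝ) : OG (m + 2) :=
  ⟨rotMat m θ, by
    rw [Matrix.mem_orthogonalGroup_iff, rotMat_transpose, rotMat_mul]
    simp [rotMat_zero]⟩

theorem rot_mul (m : ℕ) (s t : ℝ) : rot m s * rot m t = rot m (s + t) :=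
  Subtype.ext (rotMat_mul m s t)

theorem rot_zero (m : ℕ) : rot m 0 = 1 := Subtype.ext (rotMat_zero m)

theorem continuous_rot (m : ℕ) : Continuous (rot m) := by
  refine Continuous.subtype_mk ?_ _
  unfold rotMat
  fun_prop

@[fun_prop] theorem measurable_rot (m : ℕ) : Measurable (rot m) := (continuous_rot m).measurable

theorem col_mul_rot_zero {m : ℕ} (g : OG (m + 2)) (θ : ℝ) :
    col (g * rot m θ) 0 = Real.cos θ • col g 0 + Real.sin θ • col g 1 := by
  rw [col_mul]
  rw [Finset.sum_eq_add_of_mem 0 1 (by simp) (by simp) (by simp)]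
  · simp [rot, rotMat]
  · intro k _ hk
    have h0 : (0 : Fin (m + 2)) ≠ k := fun h => hk.1 h.symm
    have h1 : (1 : Fin (m + 2)) ≠ k := fun h => hk.2 h.symm
    simp [rot, rotMat, h0, h1, hk.1]

theorem col_mul_rot_one {m : ℕ} (g : OG (m + 2)) (θ : ℝ) :
    col (g * rot m θ) 1 = -Real.sin θ • col g 0 + Real.cos θ • col g 1 := by
  rw [col_mul]
  rw [Finset.sum_eq_add_of_mem 0 1 (by simp) (by simp) (by simp)]
  · simp [rot, rotMat]
  · intro k _ hk
    have h0 : (0 : Fin (m + 2)) ≠ k := fun h => hk.1 h.symm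
    have h1 : (1 : Fin (m + 2)) ≠ k := fun h => hk.2 h.symm
    simp [rot, rotMat, h0, h1, hk.2]

/-- The permutation matrix of the transposition of `i` and `j`. -/
def swapMat {p : ℕ} (i j : Fin p) : OG p :=
  ⟨(1 : Matrix (Fin p) (Fin p) ℝ).submatrix id (Equiv.swap i j), by
    rw [Matrix.mem_orthogonalGroup_iff']
    ext a b
    simp [Matrix.mul_apply, Matrix.one_apply]⟩

theorem col_mul_swapMat {p : ℕ} (g : OG p) (i j k : Fin p) :
    col (g * swapMat i j) k = col g (Equiv.swap i j k) := by
  rw [col_mul]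
  simp [swapMat, Matrix.one_apply]

/-- The reflection of the second basis vector. -/
def reflMat (m : ℕ) : OG (m + 2) :=
  ⟨Matrix.diagonal fun i => if i = 1 then -1 else 1, by
    rw [Matrix.mem_orthogonalGroup_iff', Matrix.diagonal_transpose,
      Matrix.diagonal_mul_diagonal, ← Matrix.diagonal_one]
    congr 1
    ext i
    split_ifs <;> simp⟩

theorem col_mul_reflMat {m : ℕ} (g : OG (m + 2)) (k : Fin (m + 2)) :
    col (g * reflMat m) k = if k = 1 then -col g k else col g k := by
  rw [col_mul]
  rw [Finset.sum_eq_single k]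
  · by_cases hk : k = 1 <;> simp [reflMat, hk]
  · intro b _ hb
    simp [reflMat, Matrix.diagonal_apply_ne _ hb]
  · simp

theorem measurable_orthIsom {p : ℕ} {α : Type*} [MeasurableSpace α] {a : α → OG p} {b : α → Euc p}
    (ha : Measurable a) (hb : Measurable b) : Measurable fun x => orthIsom (a x) (b x) := by
  simp only [orthIsom_apply]
  refine Finset.measurable_sum _ fun j _ => ?_
  have h1 : Measurable fun x => col (a x) j := (measurable_col j).comp ha
  have h2 : Measurable fun x => (b x) j := by fun_prop
  exact h2.smul h1

/-- Gram-Schmidt: the second column is the normalized component of w orthogonal to v, whose length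
is the sine of the angle. -/
theorem exists_orth_pair {m : ℕ} (v w : Sph (m + 2)) : ∃ g : OG (m + 2), col g 0 = v ∧
    col (g * rot m (Real.arccos (inner ℝ (v : Euc (m + 2)) w))) 0 = w := by
  have hv : ‖(v : Euc (m + 2))‖ = 1 := by simp
  have hw : ‖(w : Euc (m + 2))‖ = 1 := by simp
  set t := inner ℝ (v : Euc (m + 2)) w with ht
  have hvv : inner ℝ (v : Euc (m + 2)) (v : Euc (m + 2)) = 1 := by
    rw [real_inner_self_eq_norm_sq, hv]; norm_num
  have hvt : inner ℝ (v : Euc (m + 2)) ((w : Euc (m + 2)) - t • (v : Euc (m + 2))) = 0 := by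
    rw [inner_sub_right, inner_smul_right, hvv, ← ht]; ring
  have ht1 : |t| ≤ 1 := by
    have := abs_real_inner_le_norm (v : Euc (m + 2)) w
    rwa [hv, hw, mul_one] at this
  have hn : ‖(w : Euc (m + 2)) - t • (v : Euc (m + 2))‖ ^ 2 = 1 - t ^ 2 := by
    rw [← real_inner_self_eq_norm_sq, inner_sub_left, inner_smul_left, hvt,
      inner_sub_right, inner_smul_right, real_inner_self_eq_norm_sq, hw,
      real_inner_comm (v : Euc (m + 2)), ← ht]
    simp
    ring
  have hsin : Real.sin (Real.arccos t) = ‖(w : Euc (m + 2)) - t • (v : Euc (m + 2))‖ := by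
    rw [Real.sin_arccos, ← hn, Real.sqrt_sq (norm_nonneg _)]
  have hcos : Real.cos (Real.arccos t) = t := Real.cos_arccos (abs_le.1 ht1).1 (abs_le.1 ht1).2
  -- If w = ±v the sine vanishes and any frame starting with v will do.
  by_cases h0 : ‖(w : Euc (m + 2)) - t • (v : Euc (m + 2))‖ = 0
  · obtain ⟨g, hg⟩ := exists_col_zero (v : Euc (m + 2)) hv
    refine ⟨g, hg, ?_⟩
    rw [col_mul_rot_zero, hcos, hsin, h0, hg, zero_smul, add_zero]
    exact (sub_eq_zero.1 (norm_eq_zero.1 h0)).symm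
  · set r := ‖(w : Euc (m + 2)) - t • (v : Euc (m + 2))‖ with hr
    obtain ⟨g, hg, hg1⟩ := exists_col_zero_one (v : Euc (m + 2))
      (r⁻¹ • ((w : Euc (m + 2)) - t • (v : Euc (m + 2)))) hv
      (by rw [norm_smul, ← hr, norm_inv, hr, norm_norm, inv_mul_cancel₀ h0])
      (by rw [inner_smul_right, hvt, mul_zero])
    refine ⟨g, hg, ?_⟩
    rw [col_mul_rot_zero, hcos, hsin, hg, hg1, smul_smul, mul_inv_cancel₀ h0, one_smul]
    abel

theorem lintegral_sphere_pair_isometry {p : ℕ} (hp : 1 ≤ p) (F : Euc p → Euc p → ENNReal)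
    (hF : Measurable F.uncurry) (L : Euc p ≃ₗᵢ[ℝ] Euc p) :
    ∫⁻ v : Sph p, ∫⁻ w : Sph p, F v w ∂(sphereMeasure p) ∂(sphereMeasure p) =
      ∫⁻ v : Sph p, ∫⁻ w : Sph p, F (L v) (L w) ∂(sphereMeasure p) ∂(sphereMeasure p) := by
  have hm : Measurable fun v : Euc p => ∫⁻ w : Sph p, F v w ∂(sphereMeasure p) :=
    Measurable.lintegral_prod_right' (f := fun x : Euc p × Sph p => F x.1 x.2)
      (hF.comp (measurable_fst.prodMk (measurable_subtype_coe.comp measurable_snd)))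
  rw [← lintegral_sphere_isometry hp L _ hm]
  refine lintegral_congr fun v => ?_
  exact (lintegral_sphere_isometry hp L (fun w => F (L v) w)
    (hF.comp (measurable_const.prodMk measurable_id))).symm

/-- Every isometry leaves the double integral unchanged, so it equals its average over the group.
Exchanging the integrals puts the average inside. -/
theorem lintegral_sphere_pair_average {p : ℕ} (hp : 1 ≤ p) (F : Euc p → Euc p → ENNReal)
    (hF : Measurable F.uncurry) :
    ∫⁻ v : Sph p, ∫⁻ w : Sph p, F v w ∂(sphereMeasure p) ∂(sphereMeasure p) =
      ∫⁻ v : Sph p, ∫⁻ w : Sph p, ∫⁻ g, F (orthIsom g v) (orthIsom g w) ∂(orthMeasure p)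
        ∂(sphereMeasure p) ∂(sphereMeasure p) := by
  have hc : ∀ {α : Type} [MeasurableSpace α] (a : α → OG p) (b : α → Sph p),
      Measurable a → Measurable b → Measurable fun x => orthIsom (a x) (b x) := fun a b ha hb =>
    measurable_orthIsom ha (measurable_subtype_coe.comp hb)
  calc _ = ∫⁻ _ : OG p, ∫⁻ v : Sph p, ∫⁻ w : Sph p, F v w ∂(sphereMeasure p)
          ∂(sphereMeasure p) ∂(orthMeasure p) := by rw [lintegral_const, measure_univ, mul_one]
    _ = ∫⁻ g : OG p, ∫⁻ v : Sph p, ∫⁻ w : Sph p,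
          F (orthIsom g v) (orthIsom g w) ∂(sphereMeasure p) ∂(sphereMeasure p) ∂(orthMeasure p) :=
        lintegral_congr fun g => lintegral_sphere_pair_isometry hp F hF (orthIsom g)
    _ = ∫⁻ v : Sph p, ∫⁻ g : OG p, ∫⁻ w : Sph p,
          F (orthIsom g v) (orthIsom g w) ∂(sphereMeasure p) ∂(orthMeasure p) ∂(sphereMeasure p) := by
        rw [lintegral_lintegral_swap]
        have hm : Measurable fun x : (OG p × Sph p) × Sph p =>
            F (orthIsom x.1.1 x.1.2) (orthIsom x.1.1 x.2) :=
          hF.comp ((hc _ _ (measurable_fst.comp measurable_fst)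
            (measurable_snd.comp measurable_fst)).prodMk
            (hc _ _ (measurable_fst.comp measurable_fst) measurable_snd))
        exact hm.lintegral_prod_right'.aemeasurable
    _ = _ := by
        refine lintegral_congr fun v => ?_
        rw [lintegral_lintegral_swap]
        exact (hF.comp ((hc _ (fun _ => v) measurable_fst measurable_const).prodMk
            (hc _ _ measurable_fst measurable_snd))).aemeasurable

/-- A pair (v, w) is the image under some g₀ of the standard pair at the same angle. Right
invariance absorbs g₀, so the group average depends on the angle only. -/
theorem lintegral_orth_pair {m : ℕ} (F : Euc (m + 2) → Euc (m + 2) → ENNReal)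
    (v w : Sph (m + 2)) :
    ∫⁻ g, F (orthIsom g v) (orthIsom g w) ∂(orthMeasure (m + 2)) =
      ∫⁻ g, F (col g 0) (col (g * rot m (Real.arccos (inner ℝ (v : Euc (m + 2)) w))) 0)
        ∂(orthMeasure (m + 2)) := by
  obtain ⟨g₀, hv, hw⟩ := exists_orth_pair v w
  rw [← lintegral_orth_mul_right (fun g => F (col g 0) _) g₀]
  refine lintegral_congr fun g => ?_
  rw [mul_assoc, ← orthIsom_col, ← orthIsom_col, hv, hw]

theorem measurable_col_mul_rot {m : ℕ} {α : Type*} [MeasurableSpace α] {a : α → OG (m + 2)}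
    {b : α → ℝ} (ha : Measurable a) (hb : Measurable b) (j : Fin (m + 2)) :
    Measurable fun x => col (a x * rot m (b x)) j :=
  (measurable_col j).comp (ha.mul ((measurable_rot m).comp hb))

/-- Integration over pairs of points of the sphere, through geodesics of random frames. -/
theorem lintegral_sphere_pair {m : ℕ} (F : Euc (m + 2) → Euc (m + 2) → ENNReal)
    (hF : Measurable F.uncurry) :
    ∫⁻ v : Sph (m + 2), ∫⁻ w : Sph (m + 2), F v w ∂(sphereMeasure (m + 2)) ∂(sphereMeasure (m + 2)) =
      ENNReal.ofReal (sphereArea (m + 2)) * (ENNReal.ofReal (sphereArea (m + 1)) *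
        ∫⁻ θ in Set.Ioo 0 Real.pi, (∫⁻ g, F (col g 0) (col (g * rot m θ) 0) ∂(orthMeasure (m + 2))) *
          ENNReal.ofReal (Real.sin θ ^ m)) := by
  rw [lintegral_sphere_pair_average (by omega) F hF]
  simp only [lintegral_orth_pair]
  set ψ : ℝ → ENNReal := fun t =>
    ∫⁻ g, F (col g 0) (col (g * rot m (Real.arccos t)) 0) ∂(orthMeasure (m + 2)) with hψ
  have hψm : Measurable ψ := by
    refine Measurable.lintegral_prod_right' (f := fun x : ℝ × OG (m + 2) =>
      F (col x.2 0) (col (x.2 * rot m (Real.arccos x.1)) 0))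
        (hF.comp (((measurable_col 0).comp measurable_snd).prodMk ?_))
    exact measurable_col_mul_rot measurable_snd
      (Real.continuous_arccos.measurable.comp measurable_fst) 0
  have h4 : ∀ v : Sph (m + 2), ∫⁻ w : Sph (m + 2), ψ (inner ℝ (v : Euc (m + 2)) w)
      ∂(sphereMeasure (m + 2)) = ENNReal.ofReal (sphereArea (m + 1)) *
        ∫⁻ θ in Set.Ioo 0 Real.pi, (∫⁻ g, F (col g 0) (col (g * rot m θ) 0) ∂(orthMeasure (m + 2))) *
          ENNReal.ofReal (Real.sin θ ^ m) := by
    intro v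
    -- The integrand is zonal about v; a rotation moves v to the pole e₀, where the zonal formula
    -- applies.
    obtain ⟨g₀, hv⟩ := exists_col_zero (v : Euc (m + 2)) (by simp)
    have h5 := lintegral_sphere_zonal (m := m + 1) (by omega) ψ hψm
    have h6 := lintegral_sphere_isometry (p := m + 2) (by omega) (orthIsom g₀)
      (fun w => ψ (inner ℝ (v : Euc (m + 2)) w)) (by fun_prop)
    have h7 : ∀ w : Sph (m + 2), inner ℝ (v : Euc (m + 2)) (orthIsom g₀ w) = (w : Euc (m + 2)) 0 := by
      intro w
      rw [← hv, ← orthIsom_single, LinearIsometryEquiv.inner_map_map]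
      simp [EuclideanSpace.inner_single_left]
    simp only [h7] at h6
    rw [← h6, h5]
    congr 1
    refine setLIntegral_congr_fun measurableSet_Ioo fun θ hθ => ?_
    simp only [hψ, Nat.add_sub_cancel]
    rw [Real.arccos_cos hθ.1.le hθ.2.le]
  have h5 : ∫⁻ v : Sph (m + 2), ∫⁻ w : Sph (m + 2), ψ (inner ℝ (v : Euc (m + 2)) w)
      ∂(sphereMeasure (m + 2)) ∂(sphereMeasure (m + 2)) = _ := lintegral_congr h4
  rw [lintegral_const, sphereMeasure_univ (by omega), mul_comm] at h5
  exact h5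

end

/-! ### Law of a frame column; tent averages and second differences along flows -/

noncomputable section

/-- The law of the first column of a random orthogonal matrix is uniform on the sphere. -/
theorem lintegral_sphere_eq_orth {m : ℕ} (ψ : Euc (m + 2) → ENNReal) (hψ : Measurable ψ) :
    ∫⁻ v : Sph (m + 2), ψ v ∂(sphereMeasure (m + 2)) =
      ENNReal.ofReal (sphereArea (m + 2)) * ∫⁻ g, ψ (col g 0) ∂(orthMeasure (m + 2)) := by
  have h := lintegral_sphere_pair_average (p := m + 2) (by omega) (fun v _ => ψ v)
    (hψ.comp measurable_fst)
  have h2 : ∀ v : Sph (m + 2), ∫⁻ g, ψ (orthIsom g v) ∂(orthMeasure (m + 2)) =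
      ∫⁻ g, ψ (col g 0) ∂(orthMeasure (m + 2)) := fun v => lintegral_orth_pair (fun v _ => ψ v) v v
  simp only [h2, lintegral_const, sphereMeasure_univ (p := m + 2) (by omega)] at h
  rw [lintegral_mul_const _ (by fun_prop)] at h
  refine (ENNReal.mul_left_inj (ENNReal.ofReal_pos.2 (sphereArea_pos (by omega))).ne'
    ENNReal.ofReal_ne_top).1 (h.trans ?_)
  ring

theorem map_colS {m : ℕ} : (orthMeasure (m + 2)).map (fun g => colS g 0) =
    (ENNReal.ofReal (sphereArea (m + 2)))⁻¹ • sphereMeasure (m + 2) := by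
  have h0 : ENNReal.ofReal (sphereArea (m + 2)) ≠ 0 :=
    (ENNReal.ofReal_pos.2 (sphereArea_pos (by omega))).ne'
  ext s hs
  have hs' : MeasurableSet (Subtype.val '' s : Set (Euc (m + 2))) :=
    (MeasurableEmbedding.subtype_coe Metric.isClosed_sphere.measurableSet).measurableSet_image.2 hs
  have h := lintegral_sphere_eq_orth (Set.indicator (Subtype.val '' s : Set (Euc (m + 2))) 1)
    (measurable_one.indicator hs')
  have h1 : ∀ v : Sph (m + 2), Set.indicator (Subtype.val '' s : Set (Euc (m + 2))) 1 (v : Euc (m + 2)) =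
      (s.indicator 1 v : ENNReal) := by
    intro v
    by_cases hv : v ∈ s
    · rw [Set.indicator_of_mem hv, Set.indicator_of_mem (Set.mem_image_of_mem _ hv)]; rfl
    · rw [Set.indicator_of_notMem hv, Set.indicator_of_notMem]
      rintro ⟨w, hw, hwv⟩
      exact hv (Subtype.ext hwv ▸ hw)
  have h2 : ∀ g : OG (m + 2), Set.indicator (Subtype.val '' s : Set (Euc (m + 2))) 1 (col g 0) =
      (((fun g => colS g 0) ⁻¹' s).indicator 1 g : ENNReal) := fun g => h1 (colS g 0)
  simp only [h1, h2] at h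
  rw [lintegral_indicator_one hs, lintegral_indicator_one (measurable_colS 0 hs)] at h
  rw [Measure.map_apply (measurable_colS 0) hs, Measure.smul_apply, h, smul_eq_mul, ← mul_assoc,
    ENNReal.inv_mul_cancel h0 ENNReal.ofReal_ne_top, one_mul]

/-- Weighted Cauchy-Schwarz: the quadratic l ↦ ∫ w (h - l)² is nonnegative, so its discriminant is
not positive. -/
theorem sq_integral_mul_le {α : Type*} [MeasurableSpace α] {μ : Measure α} {w h : α → ℝ}
    (hw : Integrable w μ) (hw0 : ∀ x, 0 ≤ w x) (hwh : Integrable (fun x => w x * h x) μ)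
    (hwh2 : Integrable (fun x => w x * h x ^ 2) μ) :
    (∫ x, w x * h x ∂μ) ^ 2 ≤ (∫ x, w x ∂μ) * ∫ x, w x * h x ^ 2 ∂μ := by
  have h1 : ∀ l : ℝ, 0 ≤ (∫ x, w x ∂μ) * (l * l) + (-2 * ∫ x, w x * h x ∂μ) * l +
      ∫ x, w x * h x ^ 2 ∂μ := by
    intro l
    have h2 : 0 ≤ ∫ x, w x * (h x - l) ^ 2 ∂μ :=
      integral_nonneg fun x => mul_nonneg (hw0 x) (sq_nonneg _)
    have h3 : ∫ x, w x * (h x - l) ^ 2 ∂μ =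
        ∫ x, (w x * (l * l) + (-2 * (w x * h x)) * l) + w x * h x ^ 2 ∂μ :=
      integral_congr_ae (Filter.Eventually.of_forall fun x => by ring)
    have i1 : Integrable (fun x => w x * (l * l) + (-2 * (w x * h x)) * l) μ :=
      (hw.mul_const _).add ((hwh.const_mul _).mul_const _)
    rw [h3, integral_add i1 hwh2,
      integral_add (hw.mul_const _) ((hwh.const_mul _).mul_const _), integral_mul_const,
      integral_mul_const, integral_const_mul] at h2
    exact h2
  have := discrim_le_zero h1
  unfold discrim at this
  nlinarith

theorem integrable_mul_of_mul_sq {α : Type*} [MeasurableSpace α] {μ : Measure α} {w h : α → ℝ}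
    (hw : Integrable w μ) (hw0 : ∀ x, 0 ≤ w x) (hm : AEStronglyMeasurable (fun x => w x * h x) μ)
    (hwh2 : Integrable (fun x => w x * h x ^ 2) μ) : Integrable (fun x => w x * h x) μ := by
  refine (hw.add hwh2).mono hm (Filter.Eventually.of_forall fun x => ?_)
  have h0 := hw0 x
  have h1 : 0 ≤ w x + w x * h x ^ 2 := add_nonneg h0 (mul_nonneg h0 (sq_nonneg _))
  simp only [Pi.add_apply, Real.norm_eq_abs]
  rw [abs_mul, abs_of_nonneg h0, abs_of_nonneg h1]
  have h2 : |h x| ≤ 1 + h x ^ 2 := by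
    nlinarith [sq_abs (h x), sq_nonneg (|h x| - 1), abs_nonneg (h x)]
  nlinarith [mul_le_mul_of_nonneg_left h2 h0]

/-- The tent function of half-width `t`. -/
def tent (t r : ℝ) : ℝ := max (t - |r|) 0

theorem tent_nonneg (t r : ℝ) : 0 ≤ tent t r := le_max_right _ _

theorem tent_neg (t r : ℝ) : tent t (-r) = tent t r := by simp [tent]

theorem tent_eq_zero {t r : ℝ} (h : t ≤ |r|) : tent t r = 0 := max_eq_right (by linarith)

theorem tent_eq {t r : ℝ} (h : |r| ≤ t) : tent t r = t - |r| := max_eq_left (by linarith)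

theorem tent_le {t r : ℝ} (ht : 0 ≤ t) : tent t r ≤ t := max_le (by linarith [abs_nonneg r]) ht

theorem continuous_tent (t : ℝ) : Continuous (tent t) := by unfold tent; fun_prop

@[fun_prop] theorem measurable_tent (t : ℝ) : Measurable (tent t) := (continuous_tent t).measurable

theorem hasCompactSupport_tent (t : ℝ) : HasCompactSupport (tent t) := by
  refine HasCompactSupport.intro (K := Set.Icc (-t) t) isCompact_Icc fun r hr => tent_eq_zero ?_
  by_contra hc
  exact hr (Set.mem_Icc.2 (abs_le.1 (not_le.1 hc).le))

theorem integrable_tent (t : ℝ) : Integrable (tent t) :=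
  (continuous_tent t).integrable_of_hasCompactSupport (hasCompactSupport_tent t)

/-- Folding onto [0, t] makes the weight linear, which suits integration by parts. -/
theorem integral_tent_mul_even {t : ℝ} (ht : 0 ≤ t) (h : ℝ → ℝ)
    (hh : Continuous h) : ∫ r, tent t r * h r = ∫ r in (0 : ℝ)..t, (t - r) * (h r + h (-r)) := by
  have hc : Continuous fun r => tent t r * h r := (continuous_tent t).mul hh
  have h1 : ∫ r, tent t r * h r = ∫ r in (-t)..t, tent t r * h r := by
    rw [intervalIntegral.integral_eq_integral_of_support_subset]
    intro r hr
    have hr0 : tent t r ≠ 0 := left_ne_zero_of_mul hr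
    have : |r| < t := by
      by_contra hcon
      exact hr0 (tent_eq_zero (not_lt.1 hcon))
    exact ⟨(abs_lt.1 this).1, (abs_lt.1 this).2.le⟩
  rw [h1, ← intervalIntegral.integral_add_adjacent_intervals (b := 0)
    (hc.intervalIntegrable _ _) (hc.intervalIntegrable _ _)]
  have h2 : ∫ r in (-t)..0, tent t r * h r = ∫ r in (0 : ℝ)..t, tent t r * h (-r) := by
    have := intervalIntegral.integral_comp_neg (a := 0) (b := t) (fun r => tent t r * h r)
    simp only [tent_neg, neg_zero] at this
    exact this.symm
  have hc2 : Continuous fun r => tent t r * h (-r) :=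
    (continuous_tent t).mul (hh.comp continuous_neg)
  rw [h2, ← intervalIntegral.integral_add (hc2.intervalIntegrable _ _)
    (hc.intervalIntegrable _ _)]
  refine intervalIntegral.integral_congr fun r hr => ?_
  rw [Set.uIcc_of_le ht] at hr
  have : tent t r = t - r := by
    rw [tent_eq (by rw [abs_of_nonneg hr.1]; exact hr.2), abs_of_nonneg hr.1]
  simp only [this]
  ring

theorem integral_tent {t : ℝ} (ht : 0 ≤ t) : ∫ r, tent t r = t ^ 2 := by
  have h := integral_tent_mul_even ht (fun _ => 1) continuous_const
  simp only [mul_one] at h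
  rw [h, intervalIntegral.integral_mul_const, intervalIntegral.integral_sub (by simp) (by simp)]
  simp
  ring

/-- A measurable family of measure preserving maps with `T (-s)` inverse to `T s`. -/
structure IsFlow {X : Type*} [MeasurableSpace X] (μ : Measure X) (T : ℝ → X → X) : Prop where
  measurable : Measurable T.uncurry
  measurePreserving : ∀ s, MeasurePreserving (T s) μ μ
  neg_apply : ∀ s x, T (-s) (T s x) = x

section Flow

variable {X : Type*} [MeasurableSpace X] {μ : Measure X} [SFinite μ] {T : ℝ → X → X}

/-- The second difference of a function along a flow. -/
def secondDiff (T : ℝ → X → X) (t : ℝ) (Φ : X → ℝ) (x : X) : ℝ :=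
  Φ (T t x) + Φ (T (-t) x) - 2 * Φ x

/-- The average of a function along a flow, weighted by the tent function. -/
def tentAverage (T : ℝ → X → X) (t : ℝ) (H : X → ℝ) (x : X) : ℝ := ∫ r, tent t r * H (T r x)

omit [SFinite μ] in
theorem IsFlow.memLp_comp (hT : IsFlow μ T) {Φ : X → ℝ} (hΦ : MemLp Φ 2 μ) (t : ℝ) :
    MemLp (fun x => Φ (T t x)) 2 μ := hΦ.comp_measurePreserving (hT.measurePreserving t)

omit [SFinite μ] in
theorem IsFlow.memLp_secondDiff (hT : IsFlow μ T) {Φ : X → ℝ} (hΦ : MemLp Φ 2 μ) (t : ℝ) :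
    MemLp (secondDiff T t Φ) 2 μ :=
  ((hT.memLp_comp hΦ t).add (hT.memLp_comp hΦ (-t))).sub (hΦ.const_mul 2)

theorem IsFlow.quasiMeasurePreserving (hT : IsFlow μ T) :
    Measure.QuasiMeasurePreserving T.uncurry ((volume : Measure ℝ).prod μ) μ :=
  QuasiMeasurePreserving.prod_of_right hT.measurable
    (Filter.Eventually.of_forall fun s => (hT.measurePreserving s).quasiMeasurePreserving)

theorem IsFlow.aestronglyMeasurable (hT : IsFlow μ T) {H : X → ℝ} (hH : AEStronglyMeasurable H μ) :
    AEStronglyMeasurable (fun z : ℝ × X => H (T z.1 z.2)) ((volume : Measure ℝ).prod μ) :=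
  hH.comp_quasiMeasurePreserving hT.quasiMeasurePreserving

omit [SFinite μ] in
theorem IsFlow.integral_comp (hT : IsFlow μ T) {H : X → ℝ} (hH : AEStronglyMeasurable H μ) (s : ℝ) :
    ∫ x, H (T s x) ∂μ = ∫ x, H x ∂μ := by
  have h := (hT.measurePreserving s).map_eq
  conv_rhs => rw [← h]
  rw [integral_map (hT.measurePreserving s).aemeasurable (by rwa [h])]

theorem IsFlow.integrable_tent_mul_sq (hT : IsFlow μ T) {H : X → ℝ} (hH : MemLp H 2 μ) (t : ℝ) :
    Integrable (fun z : ℝ × X => tent t z.1 * H (T z.1 z.2) ^ 2) ((volume : Measure ℝ).prod μ) := by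
  have hm := hT.aestronglyMeasurable hH.1
  have hm2 : AEStronglyMeasurable (fun z : ℝ × X => tent t z.1 * H (T z.1 z.2) ^ 2)
      ((volume : Measure ℝ).prod μ) :=
    ((measurable_tent t).comp measurable_fst).aestronglyMeasurable.mul (hm.pow 2)
  rw [integrable_prod_iff hm2]
  refine ⟨Filter.Eventually.of_forall fun r =>
    ((hT.memLp_comp hH r).integrable_sq).const_mul (tent t r), ?_⟩
  have : ∀ r, ∫ x, ‖tent t r * H (T r x) ^ 2‖ ∂μ = tent t r * ∫ x, H x ^ 2 ∂μ := by
    intro r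
    have h := hT.integral_comp (hH.1.pow 2) r
    simp only [Pi.pow_apply] at h
    rw [← h, ← integral_const_mul]
    refine integral_congr_ae (Filter.Eventually.of_forall fun x => ?_)
    exact Real.norm_of_nonneg (mul_nonneg (tent_nonneg _ _) (sq_nonneg _))
  simp only [this]
  exact (integrable_tent t).mul_const _

theorem IsFlow.aestronglyMeasurable_tentAverage (hT : IsFlow μ T) {H : X → ℝ} (hH : MemLp H 2 μ)
    (t : ℝ) : AEStronglyMeasurable (tentAverage T t H) μ := by
  have hm := hT.aestronglyMeasurable hH.1
  have hm2 : AEStronglyMeasurable (fun z : ℝ × X => tent t z.1 * H (T z.1 z.2))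
      ((volume : Measure ℝ).prod μ) :=
    ((measurable_tent t).comp measurable_fst).aestronglyMeasurable.mul hm
  exact (hm2.prod_swap).integral_prod_right'

/-- Cauchy-Schwarz against the tent, whose mass is t². The bound is only almost sure because H is
square integrable against the tent along almost every orbit. -/
theorem IsFlow.sq_tentAverage_le (hT : IsFlow μ T) {H : X → ℝ} (hH : MemLp H 2 μ)
    {t : ℝ} (ht : 0 ≤ t) : ∀ᵐ x ∂μ,
      tentAverage T t H x ^ 2 ≤ t ^ 2 * ∫ r, tent t r * H (T r x) ^ 2 := by
  have h1 := (hT.integrable_tent_mul_sq hH t).swap.prod_right_ae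
  have h2 := (hT.aestronglyMeasurable hH.1).prod_swap.prodMk_left
  filter_upwards [h1, h2] with x hx1 hx2
  rw [← integral_tent ht]
  refine sq_integral_mul_le (integrable_tent t) (tent_nonneg t) ?_ hx1
  exact integrable_mul_of_mul_sq (integrable_tent t) (tent_nonneg t)
    ((measurable_tent t).aestronglyMeasurable.mul hx2) hx1

theorem IsFlow.integrable_sq_tentAverage (hT : IsFlow μ T) {H : X → ℝ} (hH : MemLp H 2 μ)
    {t : ℝ} (ht : 0 ≤ t) : Integrable (fun x => tentAverage T t H x ^ 2) μ := by
  have h1 := (hT.integrable_tent_mul_sq hH t).swap.integral_prod_left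
  refine (h1.const_mul (t ^ 2)).mono ((hT.aestronglyMeasurable_tentAverage hH t).pow 2) ?_
  filter_upwards [hT.sq_tentAverage_le hH ht] with x hx
  rw [Real.norm_of_nonneg (sq_nonneg _)]
  exact hx.trans (le_abs_self _)

theorem IsFlow.memLp_tentAverage (hT : IsFlow μ T) {H : X → ℝ} (hH : MemLp H 2 μ)
    {t : ℝ} (ht : 0 ≤ t) : MemLp (tentAverage T t H) 2 μ :=
  (memLp_two_iff_integrable_sq (hT.aestronglyMeasurable_tentAverage hH t)).2
    (hT.integrable_sq_tentAverage hH ht)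

/-- Integrating the pointwise bound and using invariance of the measure shows that tent averaging
has L² norm at most t². -/
theorem IsFlow.integral_sq_tentAverage_le (hT : IsFlow μ T) {H : X → ℝ} (hH : MemLp H 2 μ)
    {t : ℝ} (ht : 0 ≤ t) : ∫ x, tentAverage T t H x ^ 2 ∂μ ≤ t ^ 4 * ∫ x, H x ^ 2 ∂μ := by
  have h0 := hT.integrable_tent_mul_sq hH t
  have h1 := h0.swap.integral_prod_left
  calc _ ≤ ∫ x, t ^ 2 * (∫ r, tent t r * H (T r x) ^ 2) ∂μ :=
        integral_mono_ae (hT.integrable_sq_tentAverage hH ht) (h1.const_mul _)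
          (hT.sq_tentAverage_le hH ht)
    _ = t ^ 2 * ∫ r, ∫ x, tent t r * H (T r x) ^ 2 ∂μ := by
        rw [integral_const_mul, integral_integral_swap (f := fun x r => tent t r * H (T r x) ^ 2)]
        exact h0.swap
    _ = t ^ 2 * ∫ r, tent t r * (∫ x, H x ^ 2 ∂μ) := by
        congr 2
        ext r
        rw [integral_const_mul]
        congr 1
        exact hT.integral_comp (hH.1.pow 2) r
    _ = _ := by rw [integral_mul_const, integral_tent ht]; ring

omit [SFinite μ] in
-- The adjoint of composition with T r is composition with its inverse T (-r).
theorem IsFlow.integral_mul_comp (hT : IsFlow μ T) {Φ H : X → ℝ} (hΦ : MemLp Φ 2 μ)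
    (hH : MemLp H 2 μ) (r : ℝ) :
    ∫ x, Φ x * H (T r x) ∂μ = ∫ x, Φ (T (-r) x) * H x ∂μ := by
  rw [← hT.integral_comp (H := fun x => Φ (T (-r) x) * H x)
    ((hT.memLp_comp hΦ (-r)).1.mul hH.1) r]
  simp only [hT.neg_apply]

theorem IsFlow.integral_mul_tentAverage (hT : IsFlow μ T) {Φ H : X → ℝ} (hΦ : MemLp Φ 2 μ)
    (hH : MemLp H 2 μ) (t : ℝ) :
    Integrable (fun r => tent t r * ∫ x, Φ (T (-r) x) * H x ∂μ) ∧
    ∫ x, Φ x * tentAverage T t H x ∂μ = ∫ r, tent t r * ∫ x, Φ (T (-r) x) * H x ∂μ := by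
  have hm : AEStronglyMeasurable (fun z : ℝ × X => tent t z.1 * (Φ z.2 * H (T z.1 z.2)))
      ((volume : Measure ℝ).prod μ) :=
    ((measurable_tent t).comp measurable_fst).aestronglyMeasurable.mul
      (hΦ.1.comp_snd.mul (hT.aestronglyMeasurable hH.1))
  have hi : Integrable (fun z : ℝ × X => tent t z.1 * (Φ z.2 * H (T z.1 z.2)))
      ((volume : Measure ℝ).prod μ) := by
    refine (((integrable_tent t).mul_prod hΦ.integrable_sq).add
      (hT.integrable_tent_mul_sq hH t)).mono hm (Filter.Eventually.of_forall fun z => ?_)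
    have h0 := tent_nonneg t z.1
    simp only [Pi.add_apply, Real.norm_eq_abs]
    rw [abs_of_nonneg (a := tent t z.1 * Φ z.2 ^ 2 + _) (by positivity), abs_mul, abs_of_nonneg h0,
      ← mul_add]
    refine mul_le_mul_of_nonneg_left ?_ h0
    rw [abs_mul]
    nlinarith [sq_abs (Φ z.2), sq_abs (H (T z.1 z.2)), sq_nonneg (|Φ z.2| - |H (T z.1 z.2)|),
      sq_nonneg (|Φ z.2|), sq_nonneg (|H (T z.1 z.2)|)]
  have h1 : ∀ r, ∫ x, tent t r * (Φ x * H (T r x)) ∂μ = tent t r * ∫ x, Φ (T (-r) x) * H x ∂μ := by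
    intro r
    rw [integral_const_mul, hT.integral_mul_comp hΦ hH]
  constructor
  · simpa only [h1] using hi.integral_prod_left
  · simp only [← h1]
    rw [integral_integral_swap hi]
    refine integral_congr_ae (Filter.Eventually.of_forall fun x => ?_)
    simp only [tentAverage]
    rw [← integral_const_mul]
    congr 1
    ext r
    ring

/-- Moving the flow from H to Φ and symmetrizing in r, which the even tent permits, gives 2(⟨Φ, A_t
H⟩ - t²⟨Φ, H⟩) = ∫ tent(r) ⟨Δ_r Φ, H⟩ dr. Thus smallness of the second differences of Φ replaces any
continuity of H. -/
theorem IsFlow.integral_mul_tentAverage_sub_le (hT : IsFlow μ T) {Φ H : X → ℝ} (hΦ : MemLp Φ 2 μ)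
    (hH : MemLp H 2 μ) {t B : ℝ} (ht : 0 ≤ t)
    (hB : ∀ r, |r| ≤ t → |∫ x, secondDiff T r Φ x * H x ∂μ| ≤ B) :
    |∫ x, Φ x * tentAverage T t H x ∂μ - t ^ 2 * ∫ x, Φ x * H x ∂μ| ≤ t ^ 2 * B / 2 := by
  obtain ⟨hi, he⟩ := hT.integral_mul_tentAverage hΦ hH t
  have hi' : Integrable (fun r => tent t r * ∫ x, Φ (T r x) * H x ∂μ) := by
    have := hi.comp_neg
    simpa only [tent_neg, neg_neg] using this
  have he' : ∫ r, tent t r * ∫ x, Φ (T (-r) x) * H x ∂μ = ∫ r, tent t r * ∫ x, Φ (T r x) * H x ∂μ := by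
    rw [← integral_neg_eq_self]
    simp only [tent_neg, neg_neg]
  have hD : ∀ r, ∫ x, secondDiff T r Φ x * H x ∂μ = ∫ x, Φ (T r x) * H x ∂μ +
      ∫ x, Φ (T (-r) x) * H x ∂μ - 2 * ∫ x, Φ x * H x ∂μ := by
    intro r
    have i1 : Integrable (fun x => Φ (T r x) * H x) μ := (hT.memLp_comp hΦ r).integrable_mul hH
    have i2 : Integrable (fun x => Φ (T (-r) x) * H x) μ :=
      (hT.memLp_comp hΦ (-r)).integrable_mul hH
    have i3 : Integrable (fun x => Φ x * H x) μ := hΦ.integrable_mul hH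
    have i4 : Integrable (fun x => Φ (T r x) * H x + Φ (T (-r) x) * H x) μ := i1.add i2
    rw [← integral_const_mul, ← integral_add i1 i2, ← integral_sub i4 (i3.const_mul 2)]
    refine integral_congr_ae (Filter.Eventually.of_forall fun x => ?_)
    simp only [secondDiff]
    ring
  have key : 2 * (∫ x, Φ x * tentAverage T t H x ∂μ - t ^ 2 * ∫ x, Φ x * H x ∂μ) =
      ∫ r, tent t r * ∫ x, secondDiff T r Φ x * H x ∂μ := by
    have e1 : ∫ r, tent t r * ∫ x, secondDiff T r Φ x * H x ∂μ =
        ∫ r, (tent t r * ∫ x, Φ (T r x) * H x ∂μ + tent t r * ∫ x, Φ (T (-r) x) * H x ∂μ) -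
          tent t r * (2 * ∫ x, Φ x * H x ∂μ) := by
      congr 1; ext r; rw [hD]; ring
    have i4 : Integrable (fun r => tent t r * (∫ x, Φ (T r x) * H x ∂μ) +
        tent t r * ∫ x, Φ (T (-r) x) * H x ∂μ) := hi'.add hi
    rw [e1, integral_sub i4 ((integrable_tent t).mul_const _), integral_add hi' hi,
      integral_mul_const, integral_tent ht, ← he', ← he]
    ring
  have hb : |∫ r, tent t r * ∫ x, secondDiff T r Φ x * H x ∂μ| ≤ ∫ r, tent t r * B := by
    rw [← Real.norm_eq_abs]
    refine norm_integral_le_of_norm_le ((integrable_tent t).mul_const _)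
      (Filter.Eventually.of_forall fun r => ?_)
    rw [norm_mul, Real.norm_of_nonneg (tent_nonneg t r)]
    by_cases hr : |r| ≤ t
    · exact mul_le_mul_of_nonneg_left (hB r hr) (tent_nonneg t r)
    · rw [tent_eq_zero (not_le.1 hr).le]; simp
  rw [integral_mul_const, integral_tent ht, ← key, abs_mul, abs_two] at hb
  linarith

omit [SFinite μ] in
-- Young's inequality. The parameter c is left free, to be matched with the order of the two norms.
theorem abs_integral_mul_le {Φ H : X → ℝ} (hΦ : MemLp Φ 2 μ) (hH : MemLp H 2 μ) {c : ℝ} (hc : 0 < c) :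
    |∫ x, Φ x * H x ∂μ| ≤ ((∫ x, Φ x ^ 2 ∂μ) / c + c * ∫ x, H x ^ 2 ∂μ) / 2 := by
  rw [← Real.norm_eq_abs, ← integral_div, ← integral_const_mul,
    ← integral_add (hΦ.integrable_sq.div_const _) (hH.integrable_sq.const_mul _), ← integral_div]
  refine norm_integral_le_of_norm_le (((hΦ.integrable_sq.div_const _).add
    (hH.integrable_sq.const_mul _)).div_const 2) (Filter.Eventually.of_forall fun x => ?_)
  rw [Real.norm_eq_abs, abs_mul]
  have : (Φ x ^ 2 / c + c * H x ^ 2) / 2 - |Φ x| * |H x| = c / 2 * (|Φ x| / c - |H x|) ^ 2 := by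
    rw [← sq_abs (Φ x), ← sq_abs (H x)]
    field_simp
    ring
  have h2 : 0 ≤ c / 2 * (|Φ x| / c - |H x|) ^ 2 := by positivity
  linarith

omit [MeasurableSpace X] in
theorem secondDiff_neg (t : ℝ) (Φ : X → ℝ) : secondDiff T (-t) Φ = secondDiff T t Φ := by
  ext x
  simp only [secondDiff, neg_neg]
  ring

/-- Expansion of second differences along a flow, when they are tent averages of `H`. -/
theorem IsFlow.expansion (hT : IsFlow μ T) {Φ H : X → ℝ} (hΦ : MemLp Φ 2 μ)
    (hH : MemLp H 2 μ) (hD : ∀ t, 0 ≤ t → secondDiff T t Φ =ᵐ[μ] tentAverage T t H)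
    {t : ℝ} (ht : 0 ≤ t) :
    ∫ x, secondDiff T t Φ x ^ 2 ∂μ ≤ t ^ 4 * ∫ x, H x ^ 2 ∂μ ∧
    |∫ x, Φ x * secondDiff T t Φ x ∂μ - t ^ 2 * ∫ x, Φ x * H x ∂μ| ≤
      t ^ 4 * ∫ x, H x ^ 2 ∂μ := by
  have hN : 0 ≤ ∫ x, H x ^ 2 ∂μ := integral_nonneg fun x => sq_nonneg _
  have h1 : ∀ r, 0 ≤ r → ∫ x, secondDiff T r Φ x ^ 2 ∂μ ≤ r ^ 4 * ∫ x, H x ^ 2 ∂μ := by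
    intro r hr
    rw [integral_congr_ae (g := fun x => tentAverage T r H x ^ 2)]
    · exact hT.integral_sq_tentAverage_le hH hr
    · filter_upwards [hD r hr] with x hx
      rw [hx]
  refine ⟨h1 t ht, ?_⟩
  have h2 : ∫ x, Φ x * secondDiff T t Φ x ∂μ = ∫ x, Φ x * tentAverage T t H x ∂μ := by
    refine integral_congr_ae ?_
    filter_upwards [hD t ht] with x hx
    rw [hx]
  rw [h2]
  rcases ht.eq_or_lt with rfl | ht0
  · have : tentAverage T 0 H = 0 := by
      ext x
      simp [tentAverage, tent]
    simp [this]
  refine (hT.integral_mul_tentAverage_sub_le hΦ hH ht (B := t ^ 2 * ∫ x, H x ^ 2 ∂μ) ?_).trans ?_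
  · intro r hr
    wlog hr0 : 0 ≤ r generalizing r
    · have := this (-r) (by rwa [abs_neg]) (by linarith)
      rwa [secondDiff_neg] at this
    rw [abs_of_nonneg hr0] at hr
    -- The choice c = t² balances the two terms, as ‖Δ_r Φ‖² ≤ t⁴‖H‖².
    refine (abs_integral_mul_le (hT.memLp_secondDiff hΦ r) hH (pow_pos ht0 2)).trans ?_
    have h3 : (∫ x, secondDiff T r Φ x ^ 2 ∂μ) / t ^ 2 ≤ t ^ 2 * ∫ x, H x ^ 2 ∂μ := by
      rw [div_le_iff₀ (pow_pos ht0 2)]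
      refine (h1 r hr0).trans ?_
      have : r ^ 4 ≤ t ^ 4 := pow_le_pow_left₀ hr0 hr 4
      calc _ ≤ t ^ 4 * ∫ x, H x ^ 2 ∂μ := mul_le_mul_of_nonneg_right this hN
        _ = _ := by ring
    linarith
  · have : 0 ≤ t ^ 4 * ∫ x, H x ^ 2 ∂μ := by positivity
    nlinarith

/-- Expansion of second differences along a flow, when they are tent averages of `H` up to a
remainder. -/
theorem IsFlow.expansion_remainder (hT : IsFlow μ T) {Φ H : X → ℝ} {E : ℝ → X → ℝ} {M : ℝ}
    (hΦ : MemLp Φ 2 μ) (hH : MemLp H 2 μ) (hE : ∀ t, MemLp (E t) 2 μ)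
    (hD : ∀ t, 0 ≤ t → secondDiff T t Φ =ᵐ[μ] fun x => tentAverage T t H x + E t x)
    (hE1 : ∀ t, 0 ≤ t → t ≤ 1 → ∫ x, E t x ^ 2 ∂μ ≤ M * t ^ 3)
    (hE2 : ∀ t, 0 ≤ t → t ≤ 1 → |∫ x, Φ x * E t x ∂μ| ≤ M * t ^ 3)
    {t : ℝ} (ht : 0 ≤ t) (ht1 : t ≤ 1) :
    ∫ x, secondDiff T t Φ x ^ 2 ∂μ ≤ (2 * (∫ x, H x ^ 2 ∂μ) + 2 * M) * t ^ 3 ∧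
    |∫ x, Φ x * secondDiff T t Φ x ∂μ - t ^ 2 * ∫ x, Φ x * H x ∂μ| ≤
      (2 * (∫ x, H x ^ 2 ∂μ) + 2 * M) * t ^ 3 := by
  have hN : 0 ≤ ∫ x, H x ^ 2 ∂μ := integral_nonneg fun x => sq_nonneg _
  have hM : 0 ≤ M := by
    have := hE1 1 zero_le_one le_rfl
    have h0 : 0 ≤ ∫ x, E 1 x ^ 2 ∂μ := integral_nonneg fun x => sq_nonneg _
    linarith
  have h1 : ∀ r, 0 ≤ r → r ≤ 1 →
      ∫ x, secondDiff T r Φ x ^ 2 ∂μ ≤ (2 * (∫ x, H x ^ 2 ∂μ) + 2 * M) * r ^ 3 := by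
    intro r hr hr1
    have ha := (hT.memLp_tentAverage hH hr).integrable_sq
    have hb := (hE r).integrable_sq
    calc _ ≤ ∫ x, 2 * tentAverage T r H x ^ 2 + 2 * E r x ^ 2 ∂μ := by
          refine integral_mono_ae (hT.memLp_secondDiff hΦ r).integrable_sq
            ((ha.const_mul 2).add (hb.const_mul 2)) ?_
          filter_upwards [hD r hr] with x hx
          simp only [hx]
          nlinarith [sq_nonneg (tentAverage T r H x - E r x)]
      _ = 2 * ∫ x, tentAverage T r H x ^ 2 ∂μ + 2 * ∫ x, E r x ^ 2 ∂μ := by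
          rw [integral_add (ha.const_mul 2) (hb.const_mul 2), integral_const_mul,
            integral_const_mul]
      _ ≤ 2 * (r ^ 4 * ∫ x, H x ^ 2 ∂μ) + 2 * (M * r ^ 3) := by
          gcongr
          · exact hT.integral_sq_tentAverage_le hH hr
          · exact hE1 r hr hr1
      _ ≤ _ := by
          have : r ^ 4 ≤ r ^ 3 := pow_le_pow_of_le_one hr hr1 (by norm_num)
          nlinarith [mul_le_mul_of_nonneg_right this hN]
  refine ⟨h1 t ht ht1, ?_⟩
  rcases ht.eq_or_lt with rfl | ht0
  -- Young's inequality with c = t is not available at t = 0. `IsFlow` makes T 0 only an involution,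
  -- so the vanishing of Δ_0 Φ is read off from the norm bound at r = 0.
  · have h3 : ∫ x, secondDiff T 0 Φ x ^ 2 ∂μ ≤ 0 := by simpa using h1 0 le_rfl zero_le_one
    have h5 : (fun x => secondDiff T 0 Φ x ^ 2) =ᵐ[μ] 0 :=
      (integral_eq_zero_iff_of_nonneg (fun x => sq_nonneg _)
        (hT.memLp_secondDiff hΦ 0).integrable_sq).1
        (le_antisymm h3 (integral_nonneg fun x => sq_nonneg _))
    have h6 : ∫ x, Φ x * secondDiff T 0 Φ x ∂μ = 0 := by
      refine integral_eq_zero_of_ae ?_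
      filter_upwards [h5] with x hx
      have : secondDiff T 0 Φ x = 0 := pow_eq_zero_iff (two_ne_zero) |>.1 hx
      simp [this]
    simp [h6]
  have h2 : ∫ x, Φ x * secondDiff T t Φ x ∂μ =
      ∫ x, Φ x * tentAverage T t H x ∂μ + ∫ x, Φ x * E t x ∂μ := by
    have ia : Integrable (fun x => Φ x * tentAverage T t H x) μ :=
      hΦ.integrable_mul (hT.memLp_tentAverage hH ht)
    have ib : Integrable (fun x => Φ x * E t x) μ := hΦ.integrable_mul (hE t)
    rw [← integral_add ia ib]
    refine integral_congr_ae ?_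
    filter_upwards [hD t ht] with x hx
    rw [hx]
    ring
  set N := ∫ x, H x ^ 2 ∂μ
  -- Here ‖Δ_r Φ‖² is only of order t³, so c = t is used. The resulting B is O(t), which makes the
  -- error O(t³).
  have h3 := hT.integral_mul_tentAverage_sub_le hΦ hH ht
    (B := ((2 * N + 2 * M) * t ^ 2 + t * N) / 2) (by
    intro r hr
    wlog hr0 : 0 ≤ r generalizing r
    · have := this (-r) (by rwa [abs_neg]) (by linarith)
      rwa [secondDiff_neg] at this
    rw [abs_of_nonneg hr0] at hr
    refine (abs_integral_mul_le (hT.memLp_secondDiff hΦ r) hH ht0).trans ?_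
    have h3 : (∫ x, secondDiff T r Φ x ^ 2 ∂μ) / t ≤ (2 * N + 2 * M) * t ^ 2 := by
      rw [div_le_iff₀ ht0]
      refine (h1 r hr0 (hr.trans ht1)).trans ?_
      have : r ^ 3 ≤ t ^ 3 := pow_le_pow_left₀ hr0 hr 3
      calc _ ≤ (2 * N + 2 * M) * t ^ 3 := mul_le_mul_of_nonneg_left this (by positivity)
        _ = _ := by ring
    gcongr)
  have h4 := hE2 t ht ht1
  rw [h2]
  have h5 : t ^ 4 ≤ t ^ 3 := pow_le_pow_of_le_one ht ht1 (by norm_num)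
  rw [abs_le] at h3 h4 ⊢
  have h6 : t ^ 2 * (((2 * N + 2 * M) * t ^ 2 + t * N) / 2) / 2 ≤ (3 / 4 * N + M) * t ^ 3 := by
    have := mul_le_mul_of_nonneg_left h5 (show 0 ≤ 2 * N + 2 * M by positivity)
    have h7 : 0 ≤ M * t ^ 3 := by positivity
    nlinarith
  have h7 : 0 ≤ N * t ^ 3 := by positivity
  have h8 : 0 ≤ M * t ^ 3 := by positivity
  constructor <;> nlinarith

end Flow

end

/-! ### Functions on the half line and the corner at the origin -/

noncomputable section

/-- `F` vanishes on `(-∞,0]` and is, on `(0,∞)`, a function with `F(0+) = 0`, `F'(0+) = c` and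
weak second derivative `G`, where `F` and `G` are square integrable. -/
structure IsHalfLine (F G : ℝ → ℝ) (c : ℝ) : Prop where
  nonpos : ∀ u ≤ 0, F u = 0
  nonpos' : ∀ u ≤ 0, G u = 0
  memLp : MemLp F 2 volume
  memLp' : MemLp G 2 volume
  eq_integral : ∀ u, 0 < u → F u = c * u + ∫ s in (0 : ℝ)..u, (u - s) * G s

/-- The positive part is the fundamental solution of the second derivative, so its second difference
is the tent. All second differences below come from this one. -/
theorem max_secondDiff {t : ℝ} (ht : 0 ≤ t) (a : ℝ) :
    max (a + t) 0 + max (a - t) 0 - 2 * max a 0 = tent t a := by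
  unfold tent
  rcases le_total 0 a with h | h
  · rw [abs_of_nonneg h, max_eq_left h, max_eq_left (by linarith : 0 ≤ a + t)]
    rcases le_total t a with h2 | h2
    · rw [max_eq_left (by linarith), max_eq_right (by linarith)]; ring
    · rw [max_eq_right (by linarith), max_eq_left (by linarith)]; ring
  · rw [abs_of_nonpos h, max_eq_right h, max_eq_right (by linarith : a - t ≤ 0)]
    ring_nf

theorem MeasureTheory.MemLp.integrableOn_Icc {G : ℝ → ℝ} (hG : MemLp G 2 volume) (a b : ℝ) :
    IntegrableOn G (Set.Icc a b) :=
  (hG.locallyIntegrable (by norm_num)).integrableOn_isCompact isCompact_Icc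

theorem integrable_max_mul {G : ℝ → ℝ} (hG : MemLp G 2 volume) (h0 : ∀ u ≤ 0, G u = 0) (u : ℝ) :
    Integrable (fun s => max (u - s) 0 * G s) := by
  have h1 : IntegrableOn (fun s => max (u - s) 0 * G s) (Set.Icc 0 u) :=
    (hG.integrableOn_Icc 0 u).continuousOn_mul (by fun_prop) isCompact_Icc
  refine h1.integrable_of_forall_notMem_eq_zero fun s hs => ?_
  rcases le_or_gt s 0 with h | h
  · rw [h0 s h, mul_zero]
  · have : u < s := by
      by_contra hc
      exact hs ⟨h.le, not_lt.1 hc⟩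
    rw [max_eq_right (by linarith), zero_mul]

/-- Translation of the first coordinate. -/
def shift {Y : Type*} (s : ℝ) (z : ℝ × Y) : ℝ × Y := (z.1 + s, z.2)

theorem isFlow_shift {Y : Type*} [MeasurableSpace Y] (ν : Measure Y) [SFinite ν] :
    IsFlow ((volume : Measure ℝ).prod ν) (shift (Y := Y)) where
  measurable := by
    unfold Function.uncurry shift
    fun_prop
  measurePreserving s :=
    (measurePreserving_add_right volume s).prod (MeasurePreserving.id ν)
  neg_apply s x := by simp [shift]

namespace IsHalfLine

variable {F G : ℝ → ℝ} {c : ℝ}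

/-- On the whole line F is c u₊ plus the convolution of u₊ with G; the positive part takes care of
both signs of u. -/
theorem eq_integral' (h : IsHalfLine F G c) (u : ℝ) :
    F u = c * max u 0 + ∫ s, max (u - s) 0 * G s := by
  rcases le_or_gt u 0 with hu | hu
  · rw [h.nonpos u hu, max_eq_right hu, integral_eq_zero_of_ae]
    · simp
    · refine Filter.Eventually.of_forall fun s => ?_
      rcases le_or_gt s 0 with hs | hs
      · simp [h.nonpos' s hs]
      · simp [max_eq_right (show u - s ≤ 0 by linarith)]
  · rw [h.eq_integral u hu, max_eq_left hu.le]
    congr 1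
    rw [← intervalIntegral.integral_eq_integral_of_support_subset (a := 0) (b := u)]
    · refine intervalIntegral.integral_congr fun s hs => ?_
      rw [Set.uIcc_of_le hu.le] at hs
      simp only [max_eq_left (show 0 ≤ u - s by linarith [hs.2])]
    · intro s hs
      rw [Function.mem_support] at hs
      constructor
      · by_contra hc
        exact hs (by rw [h.nonpos' s (not_lt.1 hc), mul_zero])
      · by_contra hc
        exact hs (by rw [max_eq_right (by linarith), zero_mul])

/-- Taking second differences of the kernels u₊ in this representation. The extra term c · tent is
the corner of the extended function, whose derivative jumps by c at the origin. -/
theorem secondDiff_eq (h : IsHalfLine F G c) {t : ℝ} (ht : 0 ≤ t) (u : ℝ) :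
    F (u + t) + F (u - t) - 2 * F u = (∫ r, tent t r * G (u + r)) + c * tent t u := by
  have i1 := integrable_max_mul h.memLp' h.nonpos' (u + t)
  have i2 := integrable_max_mul h.memLp' h.nonpos' (u - t)
  have i3 := integrable_max_mul h.memLp' h.nonpos' u
  have i4 : Integrable (fun s => max (u + t - s) 0 * G s + max (u - t - s) 0 * G s) := i1.add i2
  have e1 : ∫ r, tent t r * G (u + r) = ∫ s, tent t (u - s) * G s := by
    rw [← integral_add_left_eq_self (fun s => tent t (u - s) * G s) u]
    refine integral_congr_ae (Filter.Eventually.of_forall fun r => ?_)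
    simp only [show u - (u + r) = -r by ring, tent_neg]
  have e2 : ∫ s, tent t (u - s) * G s =
      (∫ s, max (u + t - s) 0 * G s) + (∫ s, max (u - t - s) 0 * G s) -
        2 * ∫ s, max (u - s) 0 * G s := by
    rw [← integral_const_mul, ← integral_add i1 i2, ← integral_sub i4 (i3.const_mul 2)]
    refine integral_congr_ae (Filter.Eventually.of_forall fun s => ?_)
    simp only []
    rw [← max_secondDiff ht]
    rw [show u - s + t = u + t - s by ring, show u - s - t = u - t - s by ring]
    ring
  rw [h.eq_integral' (u + t), h.eq_integral' (u - t), h.eq_integral' u, e1, e2, ← max_secondDiff ht]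
  ring

theorem sq_integral_abs_le (h : IsHalfLine F G c) :
    (∫ s in Set.Icc (0 : ℝ) 1, |G s|) ^ 2 ≤ ∫ s, G s ^ 2 := by
  have i1 := (h.memLp'.integrableOn_Icc 0 1).abs
  have i2 : IntegrableOn (fun s => G s ^ 2) (Set.Icc 0 1) := h.memLp'.integrable_sq.integrableOn
  have := sq_integral_mul_le (μ := volume.restrict (Set.Icc (0 : ℝ) 1)) (w := fun _ => 1)
    (h := fun s => |G s|) (integrable_const _) (fun _ => zero_le_one) (by simpa using i1)
    (by simpa [IntegrableOn] using i2)
  simp only [one_mul, sq_abs] at this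
  refine this.trans ?_
  simp only [integral_const, MeasurableSet.univ, measureReal_restrict_apply, Set.univ_inter,
    Real.volume_real_Icc, sub_zero, smul_eq_mul, mul_one]
  rw [max_eq_left zero_le_one, one_mul]
  exact setIntegral_le_integral h.memLp'.integrable_sq
    (Filter.Eventually.of_forall fun x => sq_nonneg _)

theorem abs_integral_le (h : IsHalfLine F G c) {u : ℝ} (hu : 0 < u) (hu1 : u ≤ 1) :
    |∫ s in (0 : ℝ)..u, (u - s) * G s| ≤ u * ∫ s in Set.Icc (0 : ℝ) 1, |G s| := by
  rw [intervalIntegral.integral_of_le hu.le, ← Real.norm_eq_abs, ← integral_const_mul]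
  have i1 : IntegrableOn (fun s => |G s|) (Set.Icc 0 1) := (h.memLp'.integrableOn_Icc 0 1).abs
  have hsub : Set.Ioc 0 u ⊆ Set.Icc (0 : ℝ) 1 := fun s hs => ⟨hs.1.le, hs.2.trans hu1⟩
  refine (norm_integral_le_of_norm_le ((i1.mono_set hsub).const_mul u) ?_).trans ?_
  · filter_upwards [ae_restrict_mem measurableSet_Ioc] with s hs
    rw [norm_mul, Real.norm_eq_abs, Real.norm_eq_abs, abs_of_nonneg (by linarith [hs.2])]
    exact mul_le_mul_of_nonneg_right (by linarith [hs.1]) (abs_nonneg _)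
  · exact setIntegral_mono_set (i1.const_mul u)
      (Filter.Eventually.of_forall fun s => by positivity) hsub.eventuallyLE

/-- On [0, 1] the linear part cu is F minus an integral bounded by the L² norm of G. Squaring and
integrating u² over [0, 1] (the value 1/3 makes the constant 6) controls c by F and G. In a family
of such functions this makes the slopes square integrable. -/
theorem sq_le (h : IsHalfLine F G c) : c ^ 2 ≤ 6 * (∫ u, F u ^ 2) + 6 * ∫ u, G u ^ 2 := by
  have hi := h.memLp.integrable_sq
  set N := ∫ u, G u ^ 2 with hN
  have h1 : ∀ u ∈ Set.Icc (0 : ℝ) 1, c ^ 2 * u ^ 2 ≤ 2 * F u ^ 2 + 2 * N := by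
    intro u hu
    have hN0 : 0 ≤ N := integral_nonneg fun u => sq_nonneg _
    rcases hu.1.eq_or_lt with rfl | hu0
    · have := sq_nonneg (F 0)
      simp only [ne_eq, OfNat.ofNat_ne_zero, not_false_eq_true, zero_pow, mul_zero]
      positivity
    have h2 := h.eq_integral u hu0
    have h3 := h.abs_integral_le hu0 hu.2
    have h4 := h.sq_integral_abs_le
    set I := ∫ s in (0 : ℝ)..u, (u - s) * G s
    set A := ∫ s in Set.Icc (0 : ℝ) 1, |G s|
    have hA : 0 ≤ A := integral_nonneg fun s => abs_nonneg _
    have h5 : I ^ 2 ≤ N := by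
      refine le_trans ?_ h4
      rw [← sq_abs]
      exact pow_le_pow_left₀ (abs_nonneg _) (h3.trans (mul_le_of_le_one_left hA hu.2)) 2
    have h6 : c * u = F u - I := by rw [h2]; ring
    rw [← mul_pow, h6]
    nlinarith [sq_nonneg (F u + I)]
  have h2 : ∫ u in Set.Icc (0 : ℝ) 1, c ^ 2 * u ^ 2 ≤ ∫ u in Set.Icc (0 : ℝ) 1, (2 * F u ^ 2 + 2 * N) := by
    have i0 : IntegrableOn (fun u : ℝ => c ^ 2 * u ^ 2) (Set.Icc 0 1) :=
      Continuous.integrableOn_Icc (by fun_prop)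
    exact setIntegral_mono_on i0 ((hi.integrableOn.const_mul 2).add (integrable_const _))
      measurableSet_Icc h1
  rw [integral_const_mul, integral_add (hi.integrableOn.const_mul 2) (integrable_const _),
    integral_const_mul, integral_Icc_eq_integral_Ioc,
    ← intervalIntegral.integral_of_le zero_le_one, integral_pow] at h2
  simp only [integral_const, MeasurableSet.univ, measureReal_restrict_apply, Set.univ_inter,
    Real.volume_real_Icc, sub_zero, smul_eq_mul] at h2
  rw [max_eq_left zero_le_one, one_mul] at h2
  have h3 : ∫ u in Set.Icc (0 : ℝ) 1, F u ^ 2 ≤ ∫ u, F u ^ 2 :=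
    setIntegral_le_integral hi (Filter.Eventually.of_forall fun x => sq_nonneg _)
  norm_num at h2
  linarith

theorem integral_tent_sq_le {t : ℝ} (ht : 0 ≤ t) :
    Integrable (fun u => tent t u ^ 2) ∧ ∫ u, tent t u ^ 2 ≤ t ^ 3 := by
  have hb : ∀ u, tent t u ^ 2 ≤ t * tent t u := fun u => by
    nlinarith [tent_nonneg t u, tent_le (r := u) ht]
  have hi : Integrable (fun u => tent t u ^ 2) := by
    refine ((integrable_tent t).const_mul t).mono (by fun_prop)
      (Filter.Eventually.of_forall fun u => ?_)
    rw [Real.norm_of_nonneg (sq_nonneg _)]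
    exact (hb u).trans (le_abs_self _)
  refine ⟨hi, (integral_mono hi ((integrable_tent t).const_mul t) hb).trans ?_⟩
  rw [integral_const_mul, integral_tent ht]
  exact le_of_eq (by ring)

theorem abs_le_of_le_one (h : IsHalfLine F G c) {u : ℝ} (hu1 : u ≤ 1) :
    |F u| ≤ |u| * (|c| + ∫ s in Set.Icc (0 : ℝ) 1, |G s|) := by
  have hA : 0 ≤ ∫ s in Set.Icc (0 : ℝ) 1, |G s| := integral_nonneg fun s => abs_nonneg _
  rcases le_or_gt u 0 with hu | hu
  · rw [h.nonpos u hu, abs_zero]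
    positivity
  rw [h.eq_integral u hu, abs_of_pos hu]
  refine (abs_add_le _ _).trans ?_
  rw [abs_mul, abs_of_pos hu]
  have := h.abs_integral_le hu hu1
  linarith

/-- The corner term has mass of order t², and F is O(t) on the support of the tent because F(0+) =
0. This extra factor gives t³. -/
theorem abs_integral_mul_tent_le (h : IsHalfLine F G c) {t : ℝ} (ht : 0 ≤ t) (ht1 : t ≤ 1) :
    |∫ u, F u * (c * tent t u)| ≤ t ^ 3 * (2 * c ^ 2 + ∫ u, G u ^ 2) := by
  set A := ∫ s in Set.Icc (0 : ℝ) 1, |G s| with hAdef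
  have hA : 0 ≤ A := integral_nonneg fun s => abs_nonneg _
  have h4 := h.sq_integral_abs_le
  have hb : |∫ u, F u * (c * tent t u)| ≤ ∫ u, (t * (|c| + A) * |c|) * tent t u := by
    rw [← Real.norm_eq_abs]
    refine norm_integral_le_of_norm_le ((integrable_tent t).const_mul _)
      (Filter.Eventually.of_forall fun u => ?_)
    rw [norm_mul, norm_mul, Real.norm_of_nonneg (tent_nonneg t u), Real.norm_eq_abs,
      Real.norm_eq_abs, ← mul_assoc]
    refine (em (|u| ≤ t)).elim (fun hu => ?_) fun hu => ?_
    · refine mul_le_mul_of_nonneg_right (mul_le_mul_of_nonneg_right ?_ (abs_nonneg c))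
        (tent_nonneg t u)
      exact (h.abs_le_of_le_one ((le_abs_self u).trans (hu.trans ht1))).trans
        (mul_le_mul_of_nonneg_right hu (by positivity))
    · rw [tent_eq_zero (not_le.1 hu).le]; simp
  rw [integral_const_mul, integral_tent ht] at hb
  refine hb.trans ?_
  have h5 : (|c| + A) * |c| ≤ 2 * c ^ 2 + ∫ u, G u ^ 2 := by
    nlinarith [sq_abs c, sq_nonneg (|c| - A), abs_nonneg c]
  calc _ = t ^ 3 * ((|c| + A) * |c|) := by ring
    _ ≤ _ := mul_le_mul_of_nonneg_left h5 (by positivity)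

end IsHalfLine

/-- Expansion of second differences for translations of a family of functions on the half line. -/
theorem halfLine_expansion {Y : Type*} [MeasurableSpace Y] {ν : Measure Y} [SFinite ν]
    {F G : ℝ × Y → ℝ} {c : Y → ℝ} (hF : MemLp F 2 (volume.prod ν)) (hG : MemLp G 2 (volume.prod ν))
    (hc : AEStronglyMeasurable c ν)
    (hFG : ∀ᵐ y ∂ν, IsHalfLine (fun u => F (u, y)) (fun u => G (u, y)) (c y)) :
    ∃ C : ℝ, 0 ≤ C ∧ ∀ t, 0 ≤ t → t ≤ 1 →
      ∫ z, secondDiff shift t F z ^ 2 ∂(volume.prod ν) ≤ C * t ^ 3 ∧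
      |∫ z, F z * secondDiff shift t F z ∂(volume.prod ν) - t ^ 2 * ∫ z, F z * G z ∂(volume.prod ν)| ≤
        C * t ^ 3 := by
  have hF2 := hF.integrable_sq
  have hG2 := hG.integrable_sq
  have hF3 : Integrable (fun y => ∫ u, F (u, y) ^ 2) ν := hF2.integral_prod_right
  have hG3 : Integrable (fun y => ∫ u, G (u, y) ^ 2) ν := hG2.integral_prod_right
  have hc2 : Integrable (fun y => c y ^ 2) ν := by
    refine ((hF3.const_mul 6).add (hG3.const_mul 6)).mono (hc.pow 2) ?_
    filter_upwards [hFG] with y hy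
    rw [Real.norm_of_nonneg (sq_nonneg _)]
    exact hy.sq_le.trans (le_abs_self _)
  -- The corner term is the remainder for `IsFlow.expansion_remainder`: both its squared norm and
  -- its product with F are O(t³).
  set E : ℝ → ℝ × Y → ℝ := fun t z => c z.2 * tent t z.1 with hE
  have hEi : ∀ t, 0 ≤ t → Integrable (fun z => E t z ^ 2) (volume.prod ν) := by
    intro t ht
    have := (IsHalfLine.integral_tent_sq_le ht).1.mul_prod hc2
    refine this.congr (Filter.Eventually.of_forall fun z => ?_)
    simp only [hE]
    ring
  have hEm : ∀ t, AEStronglyMeasurable (E t) (volume.prod ν) := fun t =>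
    hc.comp_snd.mul ((measurable_tent t).comp measurable_fst).aestronglyMeasurable
  have hE' : ∀ t, MemLp (E t) 2 (volume.prod ν) := by
    intro t
    rcases le_or_gt 0 t with ht | ht
    · exact (memLp_two_iff_integrable_sq (hEm t)).2 (hEi t ht)
    -- A tent of negative half-width vanishes identically.
    · have : E t = 0 := by
        ext z
        simp only [hE, Pi.zero_apply, mul_eq_zero]
        exact Or.inr (tent_eq_zero (ht.le.trans (abs_nonneg _)))
      rw [this]
      exact MemLp.zero
  set M := ∫ y, (2 * c y ^ 2 + ∫ u, G (u, y) ^ 2) ∂ν with hM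
  have hMi : Integrable (fun y => 2 * c y ^ 2 + ∫ u, G (u, y) ^ 2) ν := (hc2.const_mul 2).add hG3
  have hnn : ∀ y, 0 ≤ ∫ u, G (u, y) ^ 2 := fun y => integral_nonneg fun u => sq_nonneg _
  have hD : ∀ t, 0 ≤ t → secondDiff shift t F =ᵐ[volume.prod ν]
      fun z => tentAverage shift t G z + E t z := by
    intro t ht
    filter_upwards [Measure.quasiMeasurePreserving_snd.ae hFG] with z hz
    have := hz.secondDiff_eq ht z.1
    simp only [secondDiff, shift, tentAverage, hE]
    rw [← sub_eq_add_neg]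
    exact this
  have hE1 : ∀ t, 0 ≤ t → t ≤ 1 → ∫ z, E t z ^ 2 ∂(volume.prod ν) ≤ M * t ^ 3 := by
    intro t ht ht1
    rw [integral_prod_symm _ (hEi t ht), hM, ← integral_mul_const]
    refine integral_mono (hEi t ht).integral_prod_right (hMi.mul_const _) fun y => ?_
    simp only [hE, mul_pow]
    rw [integral_const_mul]
    have h1 := (IsHalfLine.integral_tent_sq_le ht).2
    have h2 := hnn y
    have h3 : 0 ≤ t ^ 3 := by positivity
    have h4 := mul_le_mul_of_nonneg_left h1 (sq_nonneg (c y))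
    nlinarith [mul_nonneg h2 h3, mul_nonneg (sq_nonneg (c y)) h3]
  have hE2 : ∀ t, 0 ≤ t → t ≤ 1 → |∫ z, F z * E t z ∂(volume.prod ν)| ≤ M * t ^ 3 := by
    intro t ht ht1
    have hi : Integrable (fun z => F z * E t z) (volume.prod ν) := hF.integrable_mul (hE' t)
    rw [integral_prod_symm _ hi, hM, ← integral_mul_const, ← Real.norm_eq_abs]
    refine norm_integral_le_of_norm_le (hMi.mul_const _) ?_
    filter_upwards [hFG] with y hy
    have := hy.abs_integral_mul_tent_le ht ht1
    rw [mul_comm]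
    exact this
  refine ⟨2 * (∫ z, G z ^ 2 ∂(volume.prod ν)) + 2 * M, ?_, fun t ht ht1 =>
    (isFlow_shift ν).expansion_remainder hF hG hE' hD hE1 hE2 ht ht1⟩
  have h1 : 0 ≤ ∫ z, G z ^ 2 ∂(volume.prod ν) := integral_nonneg fun z => sq_nonneg _
  have h2 : 0 ≤ M := integral_nonneg fun y => add_nonneg (by positivity) (hnn y)
  positivity

theorem taylor_two {f : ℝ → ℝ} (hf : DifferentiableOn ℝ f (Set.Ioi 0))
    (hf' : DifferentiableOn ℝ (deriv f) (Set.Ioi 0))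
    (hc : ContinuousOn (iteratedDeriv 2 f) (Set.Ioi 0)) {a u : ℝ} (ha : 0 < a) (hau : a ≤ u) :
    f u = f a + (u - a) * deriv f a + ∫ s in a..u, (u - s) * iteratedDeriv 2 f s := by
  have hsub : Set.uIcc a u ⊆ Set.Ioi 0 := by
    rw [Set.uIcc_of_le hau]; exact fun s hs => lt_of_lt_of_le ha hs.1
  have d1 : ∀ s ∈ Set.uIcc a u, HasDerivAt f (deriv f s) s := fun s hs =>
    ((hf s (hsub hs)).differentiableAt (Ioi_mem_nhds (hsub hs))).hasDerivAt
  have d2 : ∀ s ∈ Set.uIcc a u, HasDerivAt (deriv f) (iteratedDeriv 2 f s) s := fun s hs => by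
    rw [iteratedDeriv_succ, iteratedDeriv_one]
    exact ((hf' s (hsub hs)).differentiableAt (Ioi_mem_nhds (hsub hs))).hasDerivAt
  have i2 : IntervalIntegrable (iteratedDeriv 2 f) volume a u := (hc.mono hsub).intervalIntegrable
  have i1 : IntervalIntegrable (deriv f) volume a u :=
    ((hf'.continuousOn).mono hsub).intervalIntegrable
  have h := intervalIntegral.integral_mul_deriv_eq_deriv_mul (u := fun s => u - s) (v := deriv f)
    (u' := fun _ => -1) (fun s _ => by simpa using (hasDerivAt_id s).const_sub u) d2 (by simp) i2
  have h2 := intervalIntegral.integral_eq_sub_of_hasDerivAt d1 i1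
  rw [h]
  simp only [neg_mul, one_mul, intervalIntegral.integral_neg, h2]
  ring

/-- No limit of f' at 0 is assumed. Taylor's formula between a and u, solved for f'(a), shows that
f'(a) converges as a ↓ 0, with a limit expressed through u. Uniqueness of the limit, compared with u
= 1, gives the representation with slope f'(0+). -/
theorem isHalfLine_of_differentiable {f : ℝ → ℝ} (hf : DifferentiableOn ℝ f (Set.Ioi 0))
    (hf' : DifferentiableOn ℝ (deriv f) (Set.Ioi 0))
    (hc : ContinuousOn (iteratedDeriv 2 f) (Set.Ioi 0))
    (h0 : Filter.Tendsto f (nhdsWithin 0 (Set.Ioi 0)) (nhds 0))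
    (hL : MemLp f 2 (volume.restrict (Set.Ioi 0)))
    (hL' : MemLp (iteratedDeriv 2 f) 2 (volume.restrict (Set.Ioi 0))) :
    IsHalfLine ((Set.Ioi 0).indicator f) ((Set.Ioi 0).indicator (iteratedDeriv 2 f))
      (f 1 - ∫ s in (0 : ℝ)..1, (1 - s) * iteratedDeriv 2 f s) := by
  have hG : MemLp ((Set.Ioi 0).indicator (iteratedDeriv 2 f)) 2 volume :=
    (memLp_indicator_iff_restrict measurableSet_Ioi).2 hL'
  have hI : ∀ u, 0 < u → IntegrableOn (iteratedDeriv 2 f) (Set.Ioc 0 u) := by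
    intro u hu
    have h1 := (hG.integrableOn_Icc 0 u).mono_set Set.Ioc_subset_Icc_self
    refine h1.congr_fun (fun s hs => ?_) measurableSet_Ioc
    exact Set.indicator_of_mem (show s ∈ Set.Ioi (0 : ℝ) from hs.1) _
  have key : ∀ u, 0 < u → Filter.Tendsto (deriv f) (nhdsWithin 0 (Set.Ioi 0))
      (nhds ((f u - ∫ s in (0 : ℝ)..u, (u - s) * iteratedDeriv 2 f s) / u)) := by
    intro u hu
    have hint : IntegrableOn (fun s => (u - s) * iteratedDeriv 2 f s) (Set.Icc 0 u) := by
      rw [integrableOn_Icc_iff_integrableOn_Ioc]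
      refine ((hI u hu).congr_set_ae Ioc_ae_eq_Icc.symm).continuousOn_mul
        (by fun_prop) isCompact_Icc |>.mono_set Set.Ioc_subset_Icc_self
    have hcont : ContinuousOn (fun a => ∫ s in u..a, (u - s) * iteratedDeriv 2 f s) (Set.uIcc 0 u) :=
      intervalIntegral.continuousOn_primitive_interval' (by
        rw [intervalIntegrable_iff_integrableOn_Icc_of_le hu.le]; exact hint) (by simp)
    have ht : Filter.Tendsto (fun a => ∫ s in a..u, (u - s) * iteratedDeriv 2 f s)
        (nhdsWithin 0 (Set.Ioi 0)) (nhds (∫ s in (0 : ℝ)..u, (u - s) * iteratedDeriv 2 f s)) := by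
      have h2 : ContinuousWithinAt (fun a => ∫ s in a..u, (u - s) * iteratedDeriv 2 f s)
          (Set.uIcc 0 u) 0 :=
        ((hcont 0 (by simp)).neg).congr (fun a _ => intervalIntegral.integral_symm _ _)
          (intervalIntegral.integral_symm _ _)
      have h3 : nhdsWithin (0 : ℝ) (Set.Ioi 0) ≤ nhdsWithin 0 (Set.uIcc 0 u) := by
        rw [Set.uIcc_of_le hu.le]
        exact nhdsWithin_le_of_mem (Icc_mem_nhdsGT hu)
      exact h2.tendsto.mono_left h3
    have hid : Filter.Tendsto (fun a : ℝ => u - a) (nhdsWithin 0 (Set.Ioi 0)) (nhds u) := by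
      have : Filter.Tendsto (fun a : ℝ => u - a) (nhds 0) (nhds (u - 0)) :=
        (continuous_const.sub continuous_id).tendsto 0
      rw [sub_zero] at this
      exact this.mono_left nhdsWithin_le_nhds
    have h4 := ((tendsto_const_nhds (x := f u)).sub h0 |>.sub ht).div hid hu.ne'
    rw [sub_zero] at h4
    refine h4.congr' ?_
    filter_upwards [Ioo_mem_nhdsGT hu] with a ha
    have := taylor_two hf hf' hc ha.1 ha.2.le
    have hne : u - a ≠ 0 := by linarith [ha.2]
    rw [Pi.div_apply, div_eq_iff hne]
    linarith
  refine ⟨fun u hu => Set.indicator_of_notMem (by simpa using hu) _,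
    fun u hu => Set.indicator_of_notMem (by simpa using hu) _,
    (memLp_indicator_iff_restrict measurableSet_Ioi).2 hL, hG, fun u hu => ?_⟩
  have h1 := tendsto_nhds_unique (key u hu) (key 1 one_pos)
  rw [div_one, div_eq_iff hu.ne'] at h1
  rw [Set.indicator_of_mem (show u ∈ Set.Ioi (0 : ℝ) from hu), ← h1]
  have h2 : ∫ s in (0 : ℝ)..u, (u - s) * (Set.Ioi 0).indicator (iteratedDeriv 2 f) s =
      ∫ s in (0 : ℝ)..u, (u - s) * iteratedDeriv 2 f s := by
    rw [intervalIntegral.integral_of_le hu.le, intervalIntegral.integral_of_le hu.le]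
    refine setIntegral_congr_fun measurableSet_Ioc fun s hs => ?_
    simp only [Set.indicator_of_mem (show s ∈ Set.Ioi (0 : ℝ) from hs.1)]
  rw [h2]
  ring

end

/-! ### The spherical Hessian, great circles and the rotation flow -/

noncomputable section

/-- Second order Taylor formula with integral remainder, symmetrized; the first order terms cancel.
-/
theorem tent_taylor {φ φ' φ'' : ℝ → ℝ} (h1 : ∀ s, HasDerivAt φ (φ' s) s)
    (h2 : ∀ s, HasDerivAt φ' (φ'' s) s) (hc : Continuous φ'') {t : ℝ} (ht : 0 ≤ t) :
    φ t + φ (-t) - 2 * φ 0 = ∫ r, tent t r * φ'' r := by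
  rw [integral_tent_mul_even ht _ hc]
  have h1' : ∀ s, HasDerivAt (fun s => φ (-s)) (-φ' (-s)) s := fun s => by
    simpa [Function.comp_def] using (h1 (-s)).comp s (hasDerivAt_neg s)
  have h2' : ∀ s, HasDerivAt (fun s => φ' (-s)) (-φ'' (-s)) s := fun s => by
    simpa [Function.comp_def] using (h2 (-s)).comp s (hasDerivAt_neg s)
  have hc' : Continuous φ' := continuous_iff_continuousAt.2 fun s => (h2 s).continuousAt
  have h3 := intervalIntegral.integral_mul_deriv_eq_deriv_mul (a := 0) (b := t) (u := fun s => t - s)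
    (v := fun s => φ' s - φ' (-s)) (u' := fun _ => -1) (v' := fun s => φ'' s - -φ'' (-s))
    (fun s _ => by simpa using (hasDerivAt_id s).const_sub t)
    (fun s _ => (h2 s).sub (h2' s)) (by simp) (Continuous.intervalIntegrable (by fun_prop) _ _)
  have h4 := intervalIntegral.integral_eq_sub_of_hasDerivAt (a := 0) (b := t)
    (f := fun s => φ s + φ (-s)) (f' := fun s => φ' s + -φ' (-s)) (fun s _ => (h1 s).add (h1' s))
    (Continuous.intervalIntegrable (by fun_prop) _ _)
  simp only [sub_neg_eq_add, neg_mul, one_mul, intervalIntegral.integral_neg] at h3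
  simp only [← sub_eq_add_neg] at h4
  rw [h3, h4]
  simp
  ring

section Hessian

variable {p : ℕ} {q : Euc p → ℝ}

/-- The map `z ↦ f(u, z/‖z‖)`. -/
def sphereExtension (q : Euc p → ℝ) (u : ℝ) (z : Euc p) : ℝ := polarDensity q u (‖z‖⁻¹ • z)

/-- Chain rule through z ↦ u z/‖z‖, which is smooth off the origin and avoids it. -/
theorem differentiable_sphereExtension (h1 : DifferentiableOn ℝ q {0}ᶜ)
    (h2 : DifferentiableOn ℝ (fderiv ℝ q) {0}ᶜ) {u : ℝ} (hu : 0 < u) {z : Euc p} (hz : z ≠ 0) :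
    DifferentiableAt ℝ (sphereExtension q u) z ∧
    DifferentiableAt ℝ (fderiv ℝ (sphereExtension q u)) z := by
  set π : Euc p → Euc p := fun z => u • (‖z‖⁻¹ • z) with hπ
  have hπc : ∀ y : Euc p, y ≠ 0 → ContDiffAt ℝ 2 π y := fun y hy =>
    ((((contDiffAt_norm ℝ hy).inv (norm_ne_zero_iff.2 hy)).smul contDiffAt_id).const_smul u)
  have hπ0 : ∀ y : Euc p, y ≠ 0 → π y ≠ 0 := fun y hy =>
    smul_ne_zero hu.ne' (smul_ne_zero (inv_ne_zero (norm_ne_zero_iff.2 hy)) hy)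
  have hπd : ∀ y : Euc p, y ≠ 0 → DifferentiableAt ℝ π y := fun y hy =>
    (hπc y hy).differentiableAt (by norm_num)
  have hqd : ∀ y : Euc p, y ≠ 0 → DifferentiableAt ℝ q y := fun y hy =>
    (h1 y hy).differentiableAt (isOpen_compl_singleton.mem_nhds hy)
  have hqd2 : ∀ y : Euc p, y ≠ 0 → DifferentiableAt ℝ (fderiv ℝ q) y := fun y hy =>
    (h2 y hy).differentiableAt (isOpen_compl_singleton.mem_nhds hy)
  have hN : sphereExtension q u = fun z => u ^ (p - 1) * q (π z) := rfl
  have hd : ∀ y : Euc p, y ≠ 0 → HasFDerivAt (sphereExtension q u)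
      (u ^ (p - 1) • (fderiv ℝ q (π y)).comp (fderiv ℝ π y)) y := fun y hy => by
    rw [hN]
    exact ((hqd _ (hπ0 y hy)).hasFDerivAt.comp y (hπd y hy).hasFDerivAt).const_mul _
  refine ⟨(hd z hz).differentiableAt, ?_⟩
  have heq : fderiv ℝ (sphereExtension q u) =ᶠ[nhds z]
      fun y => u ^ (p - 1) • (fderiv ℝ q (π y)).comp (fderiv ℝ π y) := by
    filter_upwards [isOpen_compl_singleton.mem_nhds hz] with y hy
    exact (hd y hy).fderiv
  refine DifferentiableAt.congr_of_eventuallyEq ?_ heq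
  have h3 : DifferentiableAt ℝ (fun y => fderiv ℝ q (π y)) z :=
    (hqd2 _ (hπ0 z hz)).comp z (hπd z hz)
  have h4 : DifferentiableAt ℝ (fderiv ℝ π) z :=
    ((hπc z hz).fderiv_right (m := 1) (by norm_num)).differentiableAt (by norm_num)
  exact (h3.clm_comp h4).const_smul (u ^ (p - 1))

/-- The quadratic form of the spherical Hessian. -/
def hessForm (q : Euc p → ℝ) (u : ℝ) (x ξ : Euc p) : ℝ :=
  ∑ i, ∑ j, ξ i * ξ j * sphericalHessian (polarDensity q) u x i j

theorem hessForm_eq (u : ℝ) (x ξ : Euc p) :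
    hessForm q u x ξ = fderiv ℝ (fderiv ℝ (sphereExtension q u)) x ξ ξ := by
  have hξ : ξ = ∑ i, ξ i • EuclideanSpace.single i (1 : ℝ) := by
    conv_lhs => rw [← (EuclideanSpace.basisFun (Fin p) ℝ).sum_repr ξ]
    simp
  set B := fderiv ℝ (fderiv ℝ (sphereExtension q u)) x with hB
  have h1 : ∀ i j, sphericalHessian (polarDensity q) u x i j =
      B (EuclideanSpace.single i 1) (EuclideanSpace.single j 1) := by
    intro i j
    simp only [sphericalHessian, Matrix.of_apply, iteratedFDeriv_two_apply]
    rfl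
  have h2 : B ξ ξ = B (∑ i, ξ i • EuclideanSpace.single i (1 : ℝ))
      (∑ i, ξ i • EuclideanSpace.single i (1 : ℝ)) := by rw [← hξ]
  rw [h2, hessForm]
  simp only [map_sum, map_smul, sum_apply, smul_apply, h1,
    smul_eq_mul, Finset.mul_sum]
  rw [Finset.sum_comm]
  refine Finset.sum_congr rfl fun i _ => Finset.sum_congr rfl fun j _ => by ring

/-- Euler's relation: the extension is homogeneous of degree zero, hence constant along rays. -/
theorem fderiv_sphereExtension_self (h1 : DifferentiableOn ℝ q {0}ᶜ)
    (h2 : DifferentiableOn ℝ (fderiv ℝ q) {0}ᶜ) {u : ℝ} (hu : 0 < u) {z : Euc p} (hz : z ≠ 0) :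
    fderiv ℝ (sphereExtension q u) z z = 0 := by
  have hd := (differentiable_sphereExtension h1 h2 hu hz).1.hasFDerivAt
  have hc : HasDerivAt (fun s : ℝ => s • z) z 1 := by
    simpa using (hasDerivAt_id (1 : ℝ)).smul_const z
  have hd' : HasFDerivAt (sphereExtension q u) (fderiv ℝ (sphereExtension q u) z) ((1 : ℝ) • z) := by
    rwa [one_smul]
  have h3 := hd'.comp_hasDerivAt (1 : ℝ) hc
  have h4 : (sphereExtension q u ∘ fun s : ℝ => s • z) =ᶠ[nhds 1] fun _ => sphereExtension q u z := by
    filter_upwards [Ioi_mem_nhds (zero_lt_one (α := ℝ))] with s hs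
    have hs0 : 0 < s := hs
    simp only [Function.comp, sphereExtension]
    congr 1
    rw [norm_smul, Real.norm_of_nonneg hs0.le, smul_smul, mul_inv]
    congr 1
    field_simp
  exact h3.unique ((hasDerivAt_const (1 : ℝ) _).congr_of_eventuallyEq h4)

/-- Differentiating Euler's relation in the direction z gives D²(z, z) + D(z) = 0, and D(z) = 0 once
more by Euler. -/
theorem hessForm_self (h1 : DifferentiableOn ℝ q {0}ᶜ)
    (h2 : DifferentiableOn ℝ (fderiv ℝ q) {0}ᶜ) {u : ℝ} (hu : 0 < u) {z : Euc p} (hz : z ≠ 0) :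
    hessForm q u z z = 0 := by
  rw [hessForm_eq]
  have hd := (differentiable_sphereExtension h1 h2 hu hz).2.hasFDerivAt
  have h3 := hd.clm_apply (hasFDerivAt_id z)
  have h4 : (fun y : Euc p => fderiv ℝ (sphereExtension q u) y (id y)) =ᶠ[nhds z] fun _ => 0 := by
    filter_upwards [isOpen_compl_singleton.mem_nhds hz] with y hy
    exact fderiv_sphereExtension_self h1 h2 hu hy
  have h5 := h3.unique ((hasFDerivAt_const (0 : ℝ) z).congr_of_eventuallyEq h4)
  have h6 := congrArg (fun L => L z) h5
  simpa [fderiv_sphereExtension_self h1 h2 hu hz] using h6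

end Hessian

section Rotation

variable {m : ℕ} {q : Euc (m + 2) → ℝ}

theorem hasDerivAt_col_mul_rot_zero (g : OG (m + 2)) (θ : ℝ) :
    HasDerivAt (fun s => col (g * rot m s) 0) (col (g * rot m θ) 1) θ := by
  simp only [col_mul_rot_zero, col_mul_rot_one]
  exact ((Real.hasDerivAt_cos θ).smul_const _).add ((Real.hasDerivAt_sin θ).smul_const _)

theorem hasDerivAt_col_mul_rot_one (g : OG (m + 2)) (θ : ℝ) :
    HasDerivAt (fun s => col (g * rot m s) 1) (-col (g * rot m θ) 0) θ := by
  simp only [col_mul_rot_zero, col_mul_rot_one]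
  have := ((Real.hasDerivAt_sin θ).neg.smul_const (col g 0)).add
    ((Real.hasDerivAt_cos θ).smul_const (col g 1))
  refine this.congr_deriv ?_
  module

theorem col_ne_zero {p : ℕ} (g : OG p) (j : Fin p) : col g j ≠ 0 := by
  rw [← norm_ne_zero_iff, norm_col]; exact one_ne_zero

theorem sphereExtension_col {p : ℕ} {q : Euc p → ℝ} (u : ℝ) (g : OG p) (j : Fin p) :
    sphereExtension q u (col g j) = polarDensity q u (col g j) := by
  simp [sphereExtension]

theorem continuous_hessForm_rot {u : ℝ} (hc : Continuous fun v : Sph (m + 2) =>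
    sphericalHessian (polarDensity q) u v) (g : OG (m + 2)) :
    Continuous fun s => hessForm q u (col (g * rot m s) 0) (col (g * rot m s) 1) := by
  have h0 : Continuous fun s => g * rot m s := continuous_const.mul (continuous_rot m)
  have h1 : ∀ i, Continuous fun s => (col (g * rot m s) 1) i := fun i => by
    have : Continuous fun s => col (g * rot m s) 1 := (continuous_col 1).comp h0
    exact (EuclideanSpace.proj (𝕜 := ℝ) i).continuous.comp this
  have h2 : Continuous fun s => colS (g * rot m s) 0 :=
    ((continuous_col 0).comp h0).subtype_mk _
  have h4 : Continuous fun s => sphericalHessian (polarDensity q) u (colS (g * rot m s) 0) :=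
    hc.comp h2
  have h3 : ∀ i j, Continuous fun s =>
      sphericalHessian (polarDensity q) u (col (g * rot m s) 0) i j := fun i j =>
    h4.matrix_elem i j
  unfold hessForm
  exact continuous_finsetSum _ fun i _ => continuous_finsetSum _ fun j _ =>
    ((h1 i).mul (h1 j)).mul (h3 i j)

/-- Along the great circle the velocity is the second column and the acceleration is minus the
first. The second derivative is therefore D²(ξ, ξ) - D(x), and D(x) vanishes by Euler's relation. -/
theorem polarDensity_rot_secondDiff (h1 : DifferentiableOn ℝ q {0}ᶜ)
    (h2 : DifferentiableOn ℝ (fderiv ℝ q) {0}ᶜ) {u : ℝ} (hu : 0 < u)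
    (hc : Continuous fun v : Sph (m + 2) => sphericalHessian (polarDensity q) u v)
    (g : OG (m + 2)) {t : ℝ} (ht : 0 ≤ t) :
    polarDensity q u (col (g * rot m t) 0) + polarDensity q u (col (g * rot m (-t)) 0) -
      2 * polarDensity q u (col g 0) =
    ∫ r, tent t r * hessForm q u (col (g * rot m r) 0) (col (g * rot m r) 1) := by
  have hd := fun s => differentiable_sphereExtension h1 h2 hu (col_ne_zero (g * rot m s) 0)
  have e1 : ∀ s, HasDerivAt (fun s => sphereExtension q u (col (g * rot m s) 0))
      (fderiv ℝ (sphereExtension q u) (col (g * rot m s) 0) (col (g * rot m s) 1)) s := fun s =>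
    HasFDerivAt.comp_hasDerivAt (l := sphereExtension q u) (f := fun s => col (g * rot m s) 0) s
      (hd s).1.hasFDerivAt (hasDerivAt_col_mul_rot_zero g s)
  have e2 : ∀ s, HasDerivAt
      (fun s => fderiv ℝ (sphereExtension q u) (col (g * rot m s) 0) (col (g * rot m s) 1))
      (hessForm q u (col (g * rot m s) 0) (col (g * rot m s) 1)) s := fun s => by
    have := (HasFDerivAt.comp_hasDerivAt (l := fderiv ℝ (sphereExtension q u))
      (f := fun s => col (g * rot m s) 0) s (hd s).2.hasFDerivAt
      (hasDerivAt_col_mul_rot_zero g s)).clm_apply (hasDerivAt_col_mul_rot_one g s)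
    rw [map_neg, Function.comp_apply, fderiv_sphereExtension_self h1 h2 hu (col_ne_zero _ _), neg_zero, add_zero] at this
    rw [hessForm_eq]
    exact this
  have := tent_taylor e1 e2 (continuous_hessForm_rot hc g) ht
  rw [← this]
  simp only [sphereExtension_col, rot_zero, mul_one]

/-- Right multiplication of the frame by a rotation. -/
def spin (m : ℕ) (s : ℝ) (z : ℝ × OG (m + 2)) : ℝ × OG (m + 2) := (z.1, z.2 * rot m s)

theorem measurePreserving_orth_mul_right {p : ℕ} (A : OG p) :
    MeasurePreserving (fun z : ℝ × OG p => (z.1, z.2 * A)) (volume.prod (orthMeasure p))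
      (volume.prod (orthMeasure p)) :=
  (MeasurePreserving.id volume).prod (measurePreserving_mul_right (orthMeasure p) A)

theorem isFlow_spin (m : ℕ) : IsFlow ((volume : Measure ℝ).prod (orthMeasure (m + 2))) (spin m) where
  measurable := by
    have h : Measurable fun z : ℝ × ℝ × OG (m + 2) => z.2.2 * rot m z.1 :=
      (measurable_snd.comp measurable_snd).mul ((measurable_rot m).comp measurable_fst)
    exact (measurable_fst.comp measurable_snd).prodMk h
  measurePreserving s := measurePreserving_orth_mul_right (rot m s)
  neg_apply s x := by
    simp only [spin, mul_assoc, rot_mul, add_neg_cancel, rot_zero, mul_one]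

/-- The lift of a function on `ℝ⁺ × S^{p-1}` to `ℝ × O(p)`. -/
def lift (a : ℝ × Sph (m + 2) → ℝ) : ℝ × OG (m + 2) → ℝ :=
  (Set.Ioi (0 : ℝ) ×ˢ Set.univ).indicator fun z => a (z.1, colS z.2 0)

theorem lift_of_pos (a : ℝ × Sph (m + 2) → ℝ) {u : ℝ} (hu : 0 < u) (g : OG (m + 2)) :
    lift a (u, g) = a (u, colS g 0) :=
  Set.indicator_of_mem (by simpa using hu) _

theorem lift_of_nonpos (a : ℝ × Sph (m + 2) → ℝ) {u : ℝ} (hu : u ≤ 0) (g : OG (m + 2)) :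
    lift a (u, g) = 0 :=
  Set.indicator_of_notMem (by simpa using hu) _

theorem measurePreserving_colS : MeasurePreserving
    (fun z : ℝ × OG (m + 2) => (z.1, colS z.2 0))
    ((volume.prod (orthMeasure (m + 2))).restrict (Set.Ioi (0 : ℝ) ×ˢ Set.univ))
    ((ENNReal.ofReal (sphereArea (m + 2)))⁻¹ • polarMeasure (m + 2)) := by
  have h1 : MeasurePreserving (fun g : OG (m + 2) => colS g 0) (orthMeasure (m + 2))
    ((ENNReal.ofReal (sphereArea (m + 2)))⁻¹ • sphereMeasure (m + 2)) := ⟨measurable_colS 0, map_colS⟩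
  have hfin : IsFiniteMeasure ((ENNReal.ofReal (sphereArea (m + 2)))⁻¹ • sphereMeasure (m + 2)) := by
    rw [← map_colS]; infer_instance
  have h2 := (MeasurePreserving.id (volume.restrict (Set.Ioi (0 : ℝ)))).prod h1
  rw [Measure.prod_smul_right] at h2
  rw [← Measure.prod_restrict, Measure.restrict_univ]
  exact h2

theorem measurableSet_Ioi_prod_univ {Y : Type*} [MeasurableSpace Y] :
    MeasurableSet (Set.Ioi (0 : ℝ) ×ˢ (Set.univ : Set Y)) :=
  measurableSet_Ioi.prod MeasurableSet.univ

theorem memLp_lift {a : ℝ × Sph (m + 2) → ℝ} (ha : MemLp a 2 (polarMeasure (m + 2))) :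
    MemLp (lift a) 2 (volume.prod (orthMeasure (m + 2))) := by
  refine (memLp_indicator_iff_restrict measurableSet_Ioi_prod_univ).2 ?_
  refine (ha.smul_measure ?_).comp_measurePreserving measurePreserving_colS
  exact ENNReal.inv_ne_top.2 (ENNReal.ofReal_pos.2 (sphereArea_pos (by omega))).ne'

theorem integral_lift {a : ℝ × Sph (m + 2) → ℝ}
    (ha : AEStronglyMeasurable a (polarMeasure (m + 2))) :
    ∫ z, lift a z ∂(volume.prod (orthMeasure (m + 2))) =
      (sphereArea (m + 2))⁻¹ * ∫ z, a z ∂(polarMeasure (m + 2)) := by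
  have h := (measurePreserving_colS (m := m)).map_eq
  have hpos := sphereArea_pos (m := m + 2) (by omega)
  unfold lift
  rw [integral_indicator measurableSet_Ioi_prod_univ,
    ← integral_map (φ := fun z : ℝ × OG (m + 2) => (z.1, colS z.2 0)) (f := a)
      measurePreserving_colS.aemeasurable (by rw [h]; exact ha.smul_measure _), h,
    integral_smul_measure, ENNReal.toReal_inv, ENNReal.toReal_ofReal hpos.le, smul_eq_mul]

theorem ae_lift {P : ℝ × Sph (m + 2) → Prop} (h : ∀ᵐ z ∂(polarMeasure (m + 2)), P z) :
    ∀ᵐ z ∂((volume : Measure ℝ).prod (orthMeasure (m + 2))), 0 < z.1 → P (z.1, colS z.2 0) := by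
  have h1 : ∀ᵐ z ∂((ENNReal.ofReal (sphereArea (m + 2)))⁻¹ • polarMeasure (m + 2)), P z :=
    Measure.ae_smul_measure h _
  have h2 := measurePreserving_colS.quasiMeasurePreserving.ae h1
  rw [ae_restrict_iff' measurableSet_Ioi_prod_univ] at h2
  filter_upwards [h2] with z hz hz0
  exact hz (by simpa using hz0)

/-- The second derivative of the density along the geodesic flow, in the direction of the column
`j` of the frame. -/
def frameHessian (q : Euc (m + 2) → ℝ) (j : Fin (m + 2)) (z : ℝ × OG (m + 2)) : ℝ :=
  ∑ i, ∑ k, col z.2 j i * col z.2 j k *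
    lift (fun z => sphericalHessian (polarDensity q) z.1 z.2 i k) z

theorem frameHessian_of_pos (q : Euc (m + 2) → ℝ) (j : Fin (m + 2)) {u : ℝ} (hu : 0 < u)
    (g : OG (m + 2)) : frameHessian q j (u, g) = hessForm q u (col g 0) (col g j) := by
  simp only [frameHessian, hessForm, lift_of_pos _ hu, coe_colS]

theorem frameHessian_of_nonpos (q : Euc (m + 2) → ℝ) (j : Fin (m + 2)) {u : ℝ} (hu : u ≤ 0)
    (g : OG (m + 2)) : frameHessian q j (u, g) = 0 := by
  simp only [frameHessian, lift_of_nonpos _ hu, mul_zero, Finset.sum_const_zero]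

theorem abs_col_le_one {p : ℕ} (g : OG p) (j i : Fin p) : |col g j i| ≤ 1 :=
  entry_norm_bound_of_unitary g.2 i j

theorem memLp_frameHessian (hq : IsSmoothDensity q) (j : Fin (m + 2)) :
    MemLp (frameHessian q j) 2 (volume.prod (orthMeasure (m + 2))) := by
  unfold frameHessian
  refine memLp_finsetSum _ fun i _ => memLp_finsetSum _ fun k _ => ?_
  have h := memLp_lift (hq.memLp_hessian i k)
  have hm : ∀ l, Measurable fun z : ℝ × OG (m + 2) => col z.2 j l := fun l => by
    have h1 : Measurable fun g : OG (m + 2) => col g j l :=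
      (EuclideanSpace.proj (𝕜 := ℝ) l).continuous.measurable.comp (measurable_col j)
    exact h1.comp measurable_snd
  refine h.mono (((hm i).mul (hm k)).aestronglyMeasurable.mul h.1)
    (Filter.Eventually.of_forall fun z => ?_)
  rw [norm_mul, norm_mul]
  exact mul_le_of_le_one_left (norm_nonneg _)
    (mul_le_one₀ (abs_col_le_one _ _ _) (norm_nonneg _) (abs_col_le_one _ _ _))

/-- The lift of the polar density. -/
abbrev liftDensity (q : Euc (m + 2) → ℝ) : ℝ × OG (m + 2) → ℝ :=
  lift fun z => polarDensity q z.1 z.2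

/-- A great circle has no boundary, so there is no corner term and the rotation error will be of
fourth order. -/
theorem secondDiff_spin (hq : IsSmoothDensity q) {t : ℝ} (ht : 0 ≤ t) :
    secondDiff (spin m) t (liftDensity q) = tentAverage (spin m) t (frameHessian q 1) := by
  ext ⟨u, g⟩
  rcases le_or_gt u 0 with hu | hu
  · simp [secondDiff, spin, tentAverage, frameHessian_of_nonpos _ _ hu, lift_of_nonpos _ hu]
  · simp only [secondDiff, spin, tentAverage, frameHessian_of_pos _ _ hu, lift_of_pos _ hu, coe_colS]
    exact polarDensity_rot_secondDiff hq.differentiable hq.twice_differentiable hu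
      (hq.uniformContinuous_hessian u hu).continuous g ht

/-- The columns of an orthogonal matrix resolve the identity, so summing the quadratic form over
them gives the trace. -/
theorem sum_frameHessian (q : Euc (m + 2) → ℝ) (z : ℝ × OG (m + 2)) :
    ∑ j, frameHessian q j z =
      lift (fun z => (sphericalHessian (polarDensity q) z.1 z.2).trace) z := by
  have hg : ∀ i k, ∑ j, col z.2 j i * col z.2 j k = if i = k then 1 else 0 := by
    intro i k
    have h := congrFun (congrFun ((Matrix.mem_orthogonalGroup_iff _ _).1 z.2.2) i) k
    rw [Matrix.mul_apply, Matrix.one_apply] at h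
    rw [← h]
    rfl
  have h1 : ∑ j, frameHessian q j z = ∑ i, ∑ k, (∑ j, col z.2 j i * col z.2 j k) *
      lift (fun z => sphericalHessian (polarDensity q) z.1 z.2 i k) z := by
    simp only [frameHessian, Finset.sum_mul]
    rw [Finset.sum_comm]
    refine Finset.sum_congr rfl fun i _ => ?_
    rw [Finset.sum_comm]
  rw [h1]
  simp only [hg, ite_mul, one_mul, zero_mul, Finset.sum_ite_eq, Finset.mem_univ, if_true]
  obtain ⟨u, g⟩ := z
  rcases le_or_gt u 0 with hu | hu
  · simp only [lift_of_nonpos _ hu, Finset.sum_const_zero]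
  · simp only [lift_of_pos _ hu, Matrix.trace, Matrix.diag]

/-- Exchanging two columns other than the first preserves the measure and the density, so all m + 1
tangential directions contribute equally. The normal direction contributes nothing and the sum is
the trace, whence the factor 1/(m + 1) = 1/(p - 1). -/
theorem integral_frameHessian (hq : IsSmoothDensity q) :
    ∫ z, liftDensity q z * frameHessian q 1 z ∂(volume.prod (orthMeasure (m + 2))) =
      ((m : ℝ) + 1)⁻¹ * ((sphereArea (m + 2))⁻¹ * ∫ z, polarDensity q z.1 z.2 *
        (sphericalHessian (polarDensity q) z.1 z.2).trace ∂(polarMeasure (m + 2))) := by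
  have hΦ := memLp_lift hq.memLp
  have hi : ∀ j, Integrable (fun z => liftDensity q z * frameHessian q j z)
      (volume.prod (orthMeasure (m + 2))) := fun j => hΦ.integrable_mul (memLp_frameHessian hq j)
  have h0 : ∀ z, frameHessian q 0 z = 0 := by
    rintro ⟨u, g⟩
    rcases le_or_gt u 0 with hu | hu
    · exact frameHessian_of_nonpos _ _ hu _
    · rw [frameHessian_of_pos _ _ hu]
      exact hessForm_self hq.differentiable hq.twice_differentiable hu (col_ne_zero g 0)
  have h1 : ∀ j : Fin (m + 1), ∫ z, liftDensity q z * frameHessian q j.succ z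
      ∂(volume.prod (orthMeasure (m + 2))) =
      ∫ z, liftDensity q z * frameHessian q 1 z ∂(volume.prod (orthMeasure (m + 2))) := by
    intro j
    have hS := measurePreserving_orth_mul_right (swapMat (1 : Fin (m + 2)) j.succ)
    have e0 : ∀ g : OG (m + 2), col (g * swapMat 1 j.succ) 0 = col g 0 := fun g => by
      rw [col_mul_swapMat, Equiv.swap_apply_of_ne_of_ne (by simp) (Fin.succ_ne_zero j).symm]
    have e1 : ∀ g : OG (m + 2), col (g * swapMat 1 j.succ) 1 = col g j.succ := fun g => by
      rw [col_mul_swapMat, Equiv.swap_apply_left]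
    conv_rhs => rw [← hS.map_eq]
    rw [integral_map hS.aemeasurable (by rw [hS.map_eq]; exact (hi 1).1)]
    refine integral_congr_ae (Filter.Eventually.of_forall ?_)
    rintro ⟨u, g⟩
    rcases le_or_gt u 0 with hu | hu
    · simp only [lift_of_nonpos _ hu, zero_mul]
    · simp only [lift_of_pos _ hu, coe_colS, frameHessian_of_pos _ _ hu, e0, e1]
  have htr : AEStronglyMeasurable (fun z : ℝ × Sph (m + 2) => polarDensity q z.1 z.2 *
      (sphericalHessian (polarDensity q) z.1 z.2).trace) (polarMeasure (m + 2)) := by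
    refine hq.memLp.1.mul ?_
    have := memLp_finsetSum (Finset.univ : Finset (Fin (m + 2))) fun i _ => hq.memLp_hessian i i
    exact this.1
  have h2 : ∫ z, ∑ j, liftDensity q z * frameHessian q j z ∂(volume.prod (orthMeasure (m + 2))) =
      (sphereArea (m + 2))⁻¹ * ∫ z, polarDensity q z.1 z.2 *
        (sphericalHessian (polarDensity q) z.1 z.2).trace ∂(polarMeasure (m + 2)) := by
    rw [← integral_lift htr]
    refine integral_congr_ae (Filter.Eventually.of_forall ?_)
    rintro ⟨u, g⟩
    simp only []
    rw [← Finset.mul_sum, sum_frameHessian]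
    rcases le_or_gt u 0 with hu | hu
    · simp only [lift_of_nonpos _ hu, zero_mul]
    · simp only [lift_of_pos _ hu]
  rw [integral_finsetSum _ fun j _ => hi j, Fin.sum_univ_succ] at h2
  simp only [h0, mul_zero, integral_zero, zero_add, h1, Finset.sum_const, Finset.card_univ,
    Fintype.card_fin, nsmul_eq_mul] at h2
  rw [← h2]
  push_cast
  have : (m : ℝ) + 1 ≠ 0 := by positivity
  field_simp

end Rotation

end

/-! ### Moments of the angle under the Langevin kernel -/

noncomputable section

/-- The unnormalized density of the angle between two points under the Langevin kernel. -/
def angleWeight (m : ℕ) (κ θ : ℝ) : ℝ := Real.exp (κ * Real.cos θ) * Real.sin θ ^ m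

/-- Integrals against `angleWeight`. -/
def angleInt (m : ℕ) (κ : ℝ) (a : ℝ → ℝ) : ℝ := ∫ θ in (0 : ℝ)..Real.pi, a θ * angleWeight m κ θ

@[fun_prop] theorem continuous_angleWeight (m : ℕ) (κ : ℝ) : Continuous (angleWeight m κ) := by
  unfold angleWeight; fun_prop

theorem angleWeight_nonneg {m : ℕ} {κ θ : ℝ} (h : θ ∈ Set.Icc 0 Real.pi) : 0 ≤ angleWeight m κ θ :=
  mul_nonneg (Real.exp_pos _).le (pow_nonneg (Real.sin_nonneg_of_mem_Icc h) _)

theorem angleInt_mono {m : ℕ} {κ : ℝ} {a b : ℝ → ℝ} (ha : Continuous a) (hb : Continuous b)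
    (h : ∀ θ ∈ Set.Icc 0 Real.pi, a θ ≤ b θ) : angleInt m κ a ≤ angleInt m κ b :=
  intervalIntegral.integral_mono_on Real.pi_pos.le
    (Continuous.intervalIntegrable (by fun_prop) _ _)
    (Continuous.intervalIntegrable (by fun_prop) _ _)
    fun θ hθ => mul_le_mul_of_nonneg_right (h θ hθ) (angleWeight_nonneg hθ)

theorem angleInt_add {m : ℕ} {κ : ℝ} {a b : ℝ → ℝ} (ha : Continuous a) (hb : Continuous b) :
    angleInt m κ (fun θ => a θ + b θ) = angleInt m κ a + angleInt m κ b := by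
  unfold angleInt
  rw [← intervalIntegral.integral_add (Continuous.intervalIntegrable (by fun_prop) _ _)
    (Continuous.intervalIntegrable (by fun_prop) _ _)]
  simp only [add_mul]

theorem angleInt_const_mul {m : ℕ} {κ : ℝ} (c : ℝ) (a : ℝ → ℝ) :
    angleInt m κ (fun θ => c * a θ) = c * angleInt m κ a := by
  unfold angleInt
  rw [← intervalIntegral.integral_const_mul]
  simp only [mul_assoc]

/-- The normalizing constant of `angleWeight`. -/
def angleMass (m : ℕ) (κ : ℝ) : ℝ := angleInt m κ fun _ => 1

theorem angleMass_pos (m : ℕ) (κ : ℝ) : 0 < angleMass m κ := by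
  unfold angleMass angleInt
  refine intervalIntegral.intervalIntegral_pos_of_pos_on
    (Continuous.intervalIntegrable (by fun_prop) _ _) (fun θ hθ => ?_) Real.pi_pos
  rw [one_mul]
  exact mul_pos (Real.exp_pos _) (pow_pos (Real.sin_pos_of_mem_Ioo hθ) _)

/-- The derivative of exp(κ cos θ) sin^(m+k+1) θ integrates to zero over [0, π]. Each application
gains a factor 1/κ. -/
theorem angleInt_sin_pow (m k : ℕ) (κ : ℝ) :
    κ * angleInt m κ (fun θ => Real.sin θ ^ (k + 2)) =
      ((m : ℝ) + k + 1) * angleInt m κ (fun θ => Real.sin θ ^ k * Real.cos θ) := by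
  have hd : ∀ θ : ℝ, HasDerivAt (fun θ => Real.exp (κ * Real.cos θ) * Real.sin θ ^ (m + k + 1))
      (((m : ℝ) + k + 1) * (Real.sin θ ^ k * Real.cos θ * angleWeight m κ θ) -
        κ * (Real.sin θ ^ (k + 2) * angleWeight m κ θ)) θ := by
    intro θ
    have h1 := ((Real.hasDerivAt_cos θ).const_mul κ).exp.mul
      ((Real.hasDerivAt_sin θ).pow (m + k + 1))
    refine h1.congr_deriv ?_
    unfold angleWeight
    simp only [Nat.add_sub_cancel, Pi.pow_apply]
    push_cast
    ring
  have h2 := intervalIntegral.integral_eq_sub_of_hasDerivAt (a := 0) (b := Real.pi)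
    (fun θ _ => hd θ) (Continuous.intervalIntegrable (by fun_prop) _ _)
  rw [intervalIntegral.integral_sub (Continuous.intervalIntegrable (by fun_prop) _ _)
    (Continuous.intervalIntegrable (by fun_prop) _ _), intervalIntegral.integral_const_mul,
    intervalIntegral.integral_const_mul] at h2
  simp only [Real.sin_pi, Real.sin_zero, ne_eq, Nat.add_eq_zero_iff, one_ne_zero, and_false,
    not_false_eq_true, zero_pow, mul_zero, sub_zero] at h2
  unfold angleInt
  linarith

/-- The excess of θ² over sin² θ is of fourth order: by the cubic lower bound for the sine if θ ≤ 1,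
and trivially, from θ² ≤ θ⁴, if θ > 1. -/
theorem sq_sub_sin_sq_bounds {θ : ℝ} (h : 0 ≤ θ) :
    Real.sin θ ^ 2 ≤ θ ^ 2 ∧ θ ^ 2 ≤ Real.sin θ ^ 2 + θ ^ 4 := by
  constructor
  · rw [← sq_abs]
    exact pow_le_pow_left₀ (abs_nonneg _) (by simpa [abs_of_nonneg h] using Real.abs_sin_le_abs (x := θ)) 2
  rcases le_or_gt θ 1 with h1 | h1
  · rcases h.eq_or_lt with rfl | h0
    · simp
    have h2 := Real.sin_gt_sub_cube h0
    have h3 : 0 ≤ θ - θ ^ 3 / 6 := by nlinarith [pow_le_one₀ h h1 (n := 2)]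
    have h4 : (θ - θ ^ 3 / 6) ^ 2 ≤ Real.sin θ ^ 2 := pow_le_pow_left₀ h3 h2.le 2
    nlinarith [pow_nonneg h 6, pow_nonneg h 4]
  · have h2 : θ ^ 2 ≤ θ ^ 4 := pow_le_pow_right₀ h1.le (by norm_num)
    linarith [sq_nonneg (Real.sin θ)]

/-- On [0, π/3] the cosine is at least 1/2, so the mass grows at least like exp(κ/2). Order κ²
suffices: it only has to absorb the bounded contribution of angles beyond π/2. -/
theorem exists_angleMass_ge (m : ℕ) : ∃ c : ℝ, 0 < c ∧ ∀ κ : ℝ, 0 ≤ κ → c * κ ^ 2 ≤ angleMass m κ := by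
  have hpi := Real.pi_pos
  set c := ∫ θ in (0 : ℝ)..(Real.pi / 3), Real.sin θ ^ m with hc
  have hc0 : 0 < c := by
    refine intervalIntegral.intervalIntegral_pos_of_pos_on
      (Continuous.intervalIntegrable (by fun_prop) _ _) (fun θ hθ => ?_) (by positivity)
    exact pow_pos (Real.sin_pos_of_mem_Ioo ⟨hθ.1, by linarith [hθ.2]⟩) _
  refine ⟨c / 8, by positivity, fun κ hκ => ?_⟩
  have h1 : Real.exp (κ / 2) * c ≤ angleMass m κ := by
    rw [hc, ← intervalIntegral.integral_const_mul]
    have h2 : ∫ θ in (0 : ℝ)..(Real.pi / 3), Real.exp (κ / 2) * Real.sin θ ^ m ≤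
        ∫ θ in (0 : ℝ)..(Real.pi / 3), angleWeight m κ θ := by
      refine intervalIntegral.integral_mono_on (by positivity)
        (Continuous.intervalIntegrable (by fun_prop) _ _)
        (Continuous.intervalIntegrable (by fun_prop) _ _) fun θ hθ => ?_
      have hcos : 1 / 2 ≤ Real.cos θ := by
        rw [← Real.cos_pi_div_three]
        exact Real.cos_le_cos_of_nonneg_of_le_pi hθ.1 (by linarith) hθ.2
      refine mul_le_mul_of_nonneg_right (Real.exp_le_exp.2 ?_)
        (pow_nonneg (Real.sin_nonneg_of_nonneg_of_le_pi hθ.1 (by linarith [hθ.2])) _)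
      nlinarith
    have h3 : ∫ θ in (0 : ℝ)..(Real.pi / 3), angleWeight m κ θ ≤ angleMass m κ := by
      unfold angleMass angleInt
      simp only [one_mul]
      refine intervalIntegral.integral_mono_interval le_rfl (by positivity) (by linarith) ?_
        (Continuous.intervalIntegrable (by fun_prop) _ _)
      filter_upwards [ae_restrict_mem measurableSet_Ioc] with θ hθ
      exact angleWeight_nonneg ⟨hθ.1.le, hθ.2⟩
    exact h2.trans h3
  have h2 : κ ^ 2 / 8 ≤ Real.exp (κ / 2) := by
    have := Real.quadratic_le_exp_of_nonneg (x := κ / 2) (by positivity)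
    nlinarith
  nlinarith

/-- Below π/2, Jordan's inequality θ ≤ (π/2) sin θ reduces to the fourth moment of the sine, which
two integrations by parts bound by (m+3)(m+1)/κ² times the mass. Beyond π/2 the weight is at most 1,
and the constant π⁵ is absorbed by the lower bound on the mass. -/
theorem exists_angleInt_pow_four_le (m : ℕ) : ∃ C : ℝ, 0 ≤ C ∧ ∀ κ : ℝ, 0 < κ →
    angleInt m κ (fun θ => θ ^ 4) ≤ C * angleMass m κ / κ ^ 2 := by
  obtain ⟨c, hc0, hc⟩ := exists_angleMass_ge m
  have hpi := Real.pi_pos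
  refine ⟨(Real.pi / 2) ^ 4 * (((m : ℝ) + 3) * (m + 1)) + Real.pi ^ 5 / c, by positivity,
    fun κ hκ => ?_⟩
  have hsplit : angleInt m κ (fun θ => θ ^ 4) =
      (∫ θ in (0 : ℝ)..(Real.pi / 2), θ ^ 4 * angleWeight m κ θ) +
        ∫ θ in (Real.pi / 2)..Real.pi, θ ^ 4 * angleWeight m κ θ := by
    unfold angleInt
    rw [intervalIntegral.integral_add_adjacent_intervals] <;>
      exact Continuous.intervalIntegrable (by fun_prop) _ _
  have h1 : ∫ θ in (0 : ℝ)..(Real.pi / 2), θ ^ 4 * angleWeight m κ θ ≤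
      (Real.pi / 2) ^ 4 * angleInt m κ (fun θ => Real.sin θ ^ 4) := by
    rw [← angleInt_const_mul]
    calc _ ≤ ∫ θ in (0 : ℝ)..(Real.pi / 2), (Real.pi / 2) ^ 4 * Real.sin θ ^ 4 * angleWeight m κ θ := by
          refine intervalIntegral.integral_mono_on (by positivity)
            (Continuous.intervalIntegrable (by fun_prop) _ _)
            (Continuous.intervalIntegrable (by fun_prop) _ _) fun θ hθ => ?_
          refine mul_le_mul_of_nonneg_right ?_ (angleWeight_nonneg ⟨hθ.1, by linarith [hθ.2]⟩)
          rw [← mul_pow]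
          refine pow_le_pow_left₀ hθ.1 ?_ 4
          have := Real.mul_le_sin hθ.1 hθ.2
          calc θ = Real.pi / 2 * (2 / Real.pi * θ) := by field_simp
            _ ≤ _ := mul_le_mul_of_nonneg_left this (by positivity)
      _ ≤ _ := by
          refine intervalIntegral.integral_mono_interval le_rfl (by positivity) (by linarith) ?_
            (Continuous.intervalIntegrable (by fun_prop) _ _)
          filter_upwards [ae_restrict_mem measurableSet_Ioc] with θ hθ
          exact mul_nonneg (by positivity) (angleWeight_nonneg ⟨hθ.1.le, hθ.2⟩)
  have h2 : ∫ θ in (Real.pi / 2)..Real.pi, θ ^ 4 * angleWeight m κ θ ≤ Real.pi ^ 5 := by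
    have : ∀ θ ∈ Set.Icc (Real.pi / 2) Real.pi, θ ^ 4 * angleWeight m κ θ ≤ Real.pi ^ 4 := by
      intro θ hθ
      have hθ0 : 0 ≤ θ := by linarith [hθ.1]
      have hcos : Real.cos θ ≤ 0 :=
        Real.cos_nonpos_of_pi_div_two_le_of_le hθ.1 (by linarith [hθ.2])
      have hw : angleWeight m κ θ ≤ 1 := by
        refine mul_le_one₀ (Real.exp_le_one_iff.2 (by nlinarith)) ?_ ?_
        · exact pow_nonneg (Real.sin_nonneg_of_nonneg_of_le_pi hθ0 hθ.2) _
        · exact pow_le_one₀ (Real.sin_nonneg_of_nonneg_of_le_pi hθ0 hθ.2) (Real.sin_le_one _)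
      calc _ ≤ Real.pi ^ 4 * 1 := mul_le_mul (pow_le_pow_left₀ hθ0 hθ.2 4) hw
            (angleWeight_nonneg ⟨hθ0, hθ.2⟩) (by positivity)
        _ = _ := mul_one _
    have h3 := intervalIntegral.integral_mono_on (μ := volume) (by linarith : Real.pi / 2 ≤ Real.pi)
      (Continuous.intervalIntegrable (by fun_prop) _ _)
      (Continuous.intervalIntegrable (by fun_prop) _ _) this
    rw [intervalIntegral.integral_const, smul_eq_mul] at h3
    refine h3.trans ?_
    have : 0 < Real.pi ^ 5 := by positivity
    nlinarith
  have h3 := angleInt_sin_pow m 2 κ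
  have h4 := angleInt_sin_pow m 0 κ
  have h5 : angleInt m κ (fun θ => Real.sin θ ^ 2 * Real.cos θ) ≤
      angleInt m κ (fun θ => Real.sin θ ^ 2) :=
    angleInt_mono (by fun_prop) (by fun_prop) fun θ _ =>
      mul_le_of_le_one_right (sq_nonneg _) (Real.cos_le_one _)
  have h6 : angleInt m κ (fun θ => Real.sin θ ^ 0 * Real.cos θ) ≤ angleMass m κ :=
    angleInt_mono (by fun_prop) (by fun_prop) fun θ _ => by
      simpa using Real.cos_le_one θ
  have hm : (0 : ℝ) ≤ m := Nat.cast_nonneg m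
  have hZ := angleMass_pos m κ
  have h7 : κ ^ 2 * angleInt m κ (fun θ => Real.sin θ ^ 4) ≤ ((m : ℝ) + 3) * (m + 1) * angleMass m κ := by
    norm_num at h3 h4 h5 h6 ⊢
    calc _ = κ * (κ * angleInt m κ (fun θ => Real.sin θ ^ 4)) := by ring
      _ = ((m : ℝ) + 2 + 1) * (κ * angleInt m κ (fun θ => Real.sin θ ^ 2 * Real.cos θ)) := by
          rw [h3]; ring
      _ ≤ ((m : ℝ) + 2 + 1) * (κ * angleInt m κ (fun θ => Real.sin θ ^ 2)) := by gcongr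
      _ = ((m : ℝ) + 2 + 1) * (((m : ℝ) + 1) * angleInt m κ (fun θ => Real.cos θ)) := by rw [h4]
      _ ≤ ((m : ℝ) + 2 + 1) * (((m : ℝ) + 1) * angleMass m κ) := by gcongr
      _ = _ := by ring
  have h8 : κ ^ 2 ≤ angleMass m κ / c := by
    rw [le_div_iff₀ hc0]; linarith [hc κ hκ.le]
  rw [le_div_iff₀ (by positivity), hsplit]
  have h9 : Real.pi ^ 5 * κ ^ 2 ≤ Real.pi ^ 5 / c * angleMass m κ := by
    calc _ ≤ Real.pi ^ 5 * (angleMass m κ / c) := by gcongr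
      _ = _ := by ring
  have h10 := mul_le_mul_of_nonneg_right (add_le_add h1 h2) (sq_nonneg κ)
  have h11 := mul_le_mul_of_nonneg_left h7 (show 0 ≤ (Real.pi / 2) ^ 4 by positivity)
  linarith

/-- The second and fourth moments of the angle under the Langevin kernel. -/
theorem exists_angleInt_moments (m : ℕ) : ∃ C : ℝ, 0 ≤ C ∧ ∀ κ : ℝ, 1 ≤ κ →
    angleInt m κ (fun θ => θ ^ 4) ≤ C * angleMass m κ / κ ^ 2 ∧
    |angleInt m κ (fun θ => θ ^ 2) - (m + 1) * angleMass m κ / κ| ≤ C * angleMass m κ / κ ^ 2 := by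
  obtain ⟨C, hC0, hC⟩ := exists_angleInt_pow_four_le m
  refine ⟨C + (m + 1) * (m + 1 + C), by positivity, fun κ hκ => ?_⟩
  have hκ0 : 0 < κ := by linarith
  have hm : (0 : ℝ) ≤ m := Nat.cast_nonneg m
  have hZ := angleMass_pos m κ
  have h1 := hC κ hκ0
  set Z := angleMass m κ with hZdef
  have hX0 : 0 ≤ Z / κ ^ 2 := by positivity
  have h0 : C * Z / κ ^ 2 ≤ (C + (m + 1) * (m + 1 + C)) * Z / κ ^ 2 := by
    gcongr
    have : 0 ≤ ((m : ℝ) + 1) * (m + 1 + C) := by positivity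
    linarith
  refine ⟨h1.trans h0, ?_⟩
  have h4 := angleInt_sin_pow m 0 κ
  norm_num at h4
  have h6 : angleInt m κ (fun θ => Real.cos θ) ≤ Z :=
    angleInt_mono (by fun_prop) (by fun_prop) fun θ _ => Real.cos_le_one θ
  have h7 : angleInt m κ (fun θ => Real.sin θ ^ 2) ≤ angleInt m κ (fun θ => θ ^ 2) :=
    angleInt_mono (by fun_prop) (by fun_prop) fun θ hθ => (sq_sub_sin_sq_bounds hθ.1).1
  have h8 : angleInt m κ (fun θ => θ ^ 2) ≤
      angleInt m κ (fun θ => Real.sin θ ^ 2) + angleInt m κ (fun θ => θ ^ 4) := by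
    rw [← angleInt_add (by fun_prop) (by fun_prop)]
    exact angleInt_mono (by fun_prop) (by fun_prop) fun θ hθ => (sq_sub_sin_sq_bounds hθ.1).2
  have h9 : Z ≤ angleInt m κ (fun θ => Real.cos θ) + 1 / 2 * angleInt m κ (fun θ => θ ^ 2) := by
    rw [← angleInt_const_mul, ← angleInt_add (by fun_prop) (by fun_prop)]
    refine angleInt_mono (by fun_prop) (by fun_prop) fun θ hθ => ?_
    have := Real.one_sub_sq_div_two_le_cos (x := θ)
    linarith
  set A := angleInt m κ (fun θ => θ ^ 4)
  set B := angleInt m κ (fun θ => θ ^ 2)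
  set S := angleInt m κ (fun θ => Real.sin θ ^ 2)
  set D := angleInt m κ (fun θ => Real.cos θ)
  -- The sin² moment is exactly (m+1)/κ times the cosine moment D. By 1 - cos θ ≤ θ²/2, D differs
  -- from Z by O(Z/κ), and replacing sin² by θ² costs the fourth moment, so both errors are O(Z/κ²).
  have hS : S = (m + 1) * D / κ := by
    rw [eq_div_iff hκ0.ne']; linarith
  have hSle : S ≤ (m + 1) * Z / κ := by
    rw [hS]; gcongr
  have hAle : A ≤ C * Z / κ := by
    refine h1.trans ?_
    have : κ ≤ κ ^ 2 := by nlinarith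
    gcongr
  have hZD : Z - D ≤ (m + 1 + C) * Z / κ := by
    have : (m + 1 + C) * Z / κ = (m + 1) * Z / κ + C * Z / κ := by ring
    have hp : 0 ≤ (m + 1) * Z / κ + C * Z / κ := by positivity
    linarith
  have hlow : (m + 1) * Z / κ - S ≤ (m + 1) * (m + 1 + C) * Z / κ ^ 2 := by
    rw [hS]
    have e1 : (m + 1) * Z / κ - (m + 1) * D / κ = (m + 1) / κ * (Z - D) := by ring
    rw [e1]
    calc _ ≤ ((m : ℝ) + 1) / κ * ((m + 1 + C) * Z / κ) := by gcongr
      _ = _ := by ring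
  have e2 : (C + (m + 1) * (m + 1 + C)) * Z / κ ^ 2 =
      C * Z / κ ^ 2 + (m + 1) * (m + 1 + C) * Z / κ ^ 2 := by ring
  have hp1 : 0 ≤ C * Z / κ ^ 2 := by positivity
  have hp2 : 0 ≤ (m + 1) * (m + 1 + C) * Z / κ ^ 2 := by positivity
  rw [abs_le, e2]
  constructor <;> linarith

/-- Needed only to see that the normalizing constant of the Langevin kernel is nonzero. For ν = 0
(dimension two) the integrand is singular at ±1 with exponent -1/2, still integrable; the
factorization (1 - t)(1 + t) isolates one endpoint. -/
theorem besselI_pos {ν κ : ℝ} (hν : 0 ≤ ν) (hκ : 0 < κ) : 0 < besselI ν κ := by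
  unfold besselI
  have h1 := Real.Gamma_pos_of_pos (show 0 < ν + 1 / 2 by linarith)
  have h2 := Real.Gamma_pos_of_pos (show (0 : ℝ) < 1 / 2 by norm_num)
  have h3 : 0 < (κ / 2) ^ ν := Real.rpow_pos_of_pos (by positivity) _
  refine mul_pos (by positivity) ?_
  have hi0 : IntervalIntegrable (fun t : ℝ => (1 - t ^ 2) ^ (ν - 1 / 2)) volume (-1) 1 := by
    have hpow : IntervalIntegrable (fun t : ℝ => t ^ (ν - 1 / 2)) volume 0 1 :=
      intervalIntegral.intervalIntegrable_rpow' (by linarith)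
    have hr : IntervalIntegrable (fun t : ℝ => (1 - t) ^ (ν - 1 / 2)) volume 0 1 := by
      have := hpow.comp_sub_left 1
      simpa using this.symm
    have h01 : IntervalIntegrable (fun t : ℝ => (1 - t ^ 2) ^ (ν - 1 / 2)) volume 0 1 := by
      have hcont : ContinuousOn (fun t : ℝ => (1 + t) ^ (ν - 1 / 2)) (Set.uIcc 0 1) := by
        refine ContinuousOn.rpow_const (by fun_prop) fun t ht => Or.inl ?_
        rw [Set.uIcc_of_le zero_le_one] at ht
        linarith [ht.1]
      refine (hr.mul_continuousOn hcont).congr ?_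
      intro t ht
      rw [Set.uIoc_of_le zero_le_one] at ht
      simp only []
      rw [← Real.mul_rpow (by linarith [ht.2]) (by linarith [ht.1])]
      congr 1
      ring
    have h10 : IntervalIntegrable (fun t : ℝ => (1 - t ^ 2) ^ (ν - 1 / 2)) volume (-1) 0 := by
      have := (IntervalIntegrable.iff_comp_neg (by simp)).1 h01
      simpa using this.symm
    exact h10.trans h01
  refine intervalIntegral.intervalIntegral_pos_of_pos_on
    (hi0.continuousOn_mul (by fun_prop)) (fun t ht => ?_) (by norm_num)
  refine mul_pos (Real.exp_pos _) (Real.rpow_pos_of_pos ?_ _)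
  nlinarith [ht.1, ht.2]

/-- The Bessel constant appears in both L and c₁ and cancels. -/
theorem langevin_div_langevinMass {m : ℕ} {κ : ℝ} (hκ : 0 < κ) (t : ℝ) :
    langevin (m + 2) κ t / langevinMass (m + 2) κ =
      Real.exp (κ * t) / (sphereArea (m + 1) * angleMass m κ) := by
  set b := κ ^ (((m + 2 : ℕ) : ℝ) / 2 - 1) *
    ((2 * Real.pi) ^ (((m + 2 : ℕ) : ℝ) / 2) * besselI (((m + 2 : ℕ) : ℝ) / 2 - 1) κ)⁻¹ with hb
  have hb0 : 0 < b := by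
    have h1 := besselI_pos (ν := ((m + 2 : ℕ) : ℝ) / 2 - 1) (κ := κ) (by
      push_cast
      have : (0 : ℝ) ≤ m := Nat.cast_nonneg m
      linarith) hκ
    have h2 : 0 < κ ^ (((m + 2 : ℕ) : ℝ) / 2 - 1) := Real.rpow_pos_of_pos hκ _
    have h3 : 0 < (2 * Real.pi) ^ (((m + 2 : ℕ) : ℝ) / 2) :=
      Real.rpow_pos_of_pos (by positivity) _
    positivity
  have hL : ∀ s, langevin (m + 2) κ s = b * Real.exp (κ * s) := fun s => rfl
  have hM : langevinMass (m + 2) κ = b * (sphereArea (m + 1) * angleMass m κ) := by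
    unfold langevinMass angleMass angleInt
    simp only [hL, one_mul]
    rw [show m + 2 - 1 = m + 1 by omega, show m + 2 - 2 = m by omega, mul_left_comm,
      ← intervalIntegral.integral_const_mul b]
    simp only [angleWeight, mul_assoc]
  rw [hL, hM, mul_div_mul_left _ _ hb0.ne']

end

/-! ### Expansion of the correlation in translation and angle -/

noncomputable section

variable {m : ℕ} {q : Euc (m + 2) → ℝ}

instance (p : ℕ) : SFinite (orthMeasure p) :=
  have : SigmaFinite (orthMeasure p) := IsFiniteMeasure.toSigmaFinite _
  inferInstance

theorem IsSmoothDensity.measurable (hq : IsSmoothDensity q) : Measurable q :=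
  measurable_of_continuousOn_compl_singleton 0 hq.differentiable.continuousOn

theorem IsSmoothDensity.measurable_polarDensity (hq : IsSmoothDensity q) {α : Type*}
    [MeasurableSpace α] {a : α → ℝ} {b : α → Euc (m + 2)} (ha : Measurable a) (hb : Measurable b) :
    Measurable fun x => polarDensity q (a x) (b x) :=
  (ha.pow_const _).mul (hq.measurable.comp (ha.smul hb))

theorem IsSmoothDensity.measurable_liftDensity (hq : IsSmoothDensity q) :
    Measurable (liftDensity q) :=
  (hq.measurable_polarDensity (a := fun z : ℝ × OG (m + 2) => z.1)
    (b := fun z : ℝ × OG (m + 2) => col z.2 0) measurable_fst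
    ((measurable_col 0).comp measurable_snd)).indicator measurableSet_Ioi_prod_univ

theorem IsSmoothDensity.differentiableOn_radial (hq : IsSmoothDensity q) (v : Sph (m + 2)) :
    DifferentiableOn ℝ (fun u => polarDensity q u v) (Set.Ioi 0) ∧
    DifferentiableOn ℝ (deriv fun u => polarDensity q u v) (Set.Ioi 0) := by
  have hv : (v : Euc (m + 2)) ≠ 0 := by
    rw [← norm_ne_zero_iff]; simp
  have hne : ∀ u ∈ Set.Ioi (0 : ℝ), u • (v : Euc (m + 2)) ≠ 0 := fun u hu =>
    smul_ne_zero (ne_of_gt hu) hv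
  have hd1 : ∀ y : Euc (m + 2), y ≠ 0 → DifferentiableAt ℝ q y := fun y hy =>
    (hq.differentiable y hy).differentiableAt (isOpen_compl_singleton.mem_nhds hy)
  have hd2 : ∀ y : Euc (m + 2), y ≠ 0 → DifferentiableAt ℝ (fderiv ℝ q) y := fun y hy =>
    (hq.twice_differentiable y hy).differentiableAt (isOpen_compl_singleton.mem_nhds hy)
  have hs : ∀ u : ℝ, HasDerivAt (fun u : ℝ => u • (v : Euc (m + 2))) (v : Euc (m + 2)) u := fun u => by
    simpa using (hasDerivAt_id u).smul_const (v : Euc (m + 2))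
  have h1 : ∀ u ∈ Set.Ioi (0 : ℝ), HasDerivAt (fun u => polarDensity q u v)
      ((m + 1 : ℕ) * u ^ m * q (u • (v : Euc (m + 2))) +
        u ^ (m + 1) * fderiv ℝ q (u • (v : Euc (m + 2))) v) u := by
    intro u hu
    have e1 := HasFDerivAt.comp_hasDerivAt (l := q) (f := fun u : ℝ => u • (v : Euc (m + 2))) u
      (hd1 _ (hne u hu)).hasFDerivAt (hs u)
    have e2 := (hasDerivAt_pow (m + 1) u).mul e1
    exact e2
  refine ⟨fun u hu => (h1 u hu).differentiableAt.differentiableWithinAt, fun u hu => ?_⟩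
  refine DifferentiableAt.differentiableWithinAt ?_
  have heq : (deriv fun u => polarDensity q u v) =ᶠ[nhds u] fun u =>
      (m + 1 : ℕ) * u ^ m * q (u • (v : Euc (m + 2))) +
        u ^ (m + 1) * fderiv ℝ q (u • (v : Euc (m + 2))) v := by
    filter_upwards [Ioi_mem_nhds hu] with s hs
    exact (h1 s hs).deriv
  refine DifferentiableAt.congr_of_eventuallyEq ?_ heq
  have e1 : DifferentiableAt ℝ (fun u : ℝ => q (u • (v : Euc (m + 2)))) u :=
    (HasFDerivAt.comp_hasDerivAt (l := q) (f := fun u : ℝ => u • (v : Euc (m + 2))) u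
      (hd1 _ (hne u hu)).hasFDerivAt (hs u)).differentiableAt
  have e2 : DifferentiableAt ℝ (fun u : ℝ => fderiv ℝ q (u • (v : Euc (m + 2)))) u :=
    (HasFDerivAt.comp_hasDerivAt (l := fderiv ℝ q) (f := fun u : ℝ => u • (v : Euc (m + 2))) u
      (hd2 _ (hne u hu)).hasFDerivAt (hs u)).differentiableAt
  have e3 : DifferentiableAt ℝ (fun u : ℝ => fderiv ℝ q (u • (v : Euc (m + 2))) v) u :=
    e2.clm_apply (differentiableAt_const _)
  exact (((differentiableAt_id.pow m).const_mul _).mul e1).add ((differentiableAt_id.pow (m + 1)).mul e3)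

theorem memLp_polar_section {a : ℝ × Sph (m + 2) → ℝ} (ha : MemLp a 2 (polarMeasure (m + 2))) :
    ∀ᵐ v ∂(sphereMeasure (m + 2)), MemLp (fun u => a (u, v)) 2 (volume.restrict (Set.Ioi 0)) := by
  have h1 : AEStronglyMeasurable (fun z => a z) ((volume.restrict (Set.Ioi (0 : ℝ))).prod
    (sphereMeasure (m + 2))) := ha.1
  have h2 := h1.prod_swap.prodMk_left
  have h3 := (ha.integrable_sq).swap.prod_right_ae
  filter_upwards [h2, h3] with v hv1 hv2
  exact (memLp_two_iff_integrable_sq hv1).2 hv2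

/-- The derivative of the polar density at `u = 0+`. -/
def boundarySlope (q : Euc (m + 2) → ℝ) (v : Sph (m + 2)) : ℝ :=
  polarDensity q 1 v - ∫ s in (0 : ℝ)..1, (1 - s) * radialSecondDeriv (polarDensity q) s v

/-- The regularity in u holds for every v; square integrability of the sections, by Fubini, only for
almost every v. -/
theorem IsSmoothDensity.isHalfLine (hq : IsSmoothDensity q) :
    ∀ᵐ v : Sph (m + 2) ∂(sphereMeasure (m + 2)), IsHalfLine ((Set.Ioi 0).indicator fun u => polarDensity q u v)
      ((Set.Ioi 0).indicator fun u => radialSecondDeriv (polarDensity q) u v)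
      (boundarySlope q v) := by
  filter_upwards [memLp_polar_section hq.memLp, memLp_polar_section hq.memLp_radial] with v h1 h2
  obtain ⟨d1, d2⟩ := hq.differentiableOn_radial v
  exact isHalfLine_of_differentiable d1 d2 (hq.uniformContinuousOn_radial v).continuousOn
    (hq.tendsto_zero v) h1 h2

theorem integrableOn_polar_of_memLp {a : ℝ × Sph (m + 2) → ℝ}
    (ha : MemLp a 2 (polarMeasure (m + 2))) (u : ℝ) :
    Integrable a ((volume.restrict (Set.Ioc 0 u)).prod (sphereMeasure (m + 2))) := by
  have hle : (volume.restrict (Set.Ioc 0 u)).prod (sphereMeasure (m + 2)) ≤ polarMeasure (m + 2) :=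
    Measure.prod_mono (Measure.restrict_mono Set.Ioc_subset_Ioi_self le_rfl) le_rfl
  exact (ha.mono_measure hle).integrable one_le_two

theorem integrable_weight_mul {a : ℝ × Sph (m + 2) → ℝ}
    (ha : MemLp a 2 (polarMeasure (m + 2))) (u : ℝ) :
    Integrable (fun z : ℝ × Sph (m + 2) => (u - z.1) * a z)
      ((volume.restrict (Set.Ioc 0 u)).prod (sphereMeasure (m + 2))) := by
  have hi := integrableOn_polar_of_memLp ha u
  refine (hi.norm.const_mul |u|).mono
    ((by fun_prop : Measurable fun z : ℝ × Sph (m + 2) => u - z.1).aestronglyMeasurable.mul hi.1) ?_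
  have h : ∀ᵐ z ∂((volume.restrict (Set.Ioc 0 u)).prod (sphereMeasure (m + 2))), z.1 ∈ Set.Ioc 0 u :=
    Measure.quasiMeasurePreserving_fst.ae (ae_restrict_mem measurableSet_Ioc)
  filter_upwards [h] with z hz
  rw [norm_mul, norm_mul, norm_norm, Real.norm_eq_abs (u - z.1),
    Real.norm_eq_abs |u|, abs_abs]
  refine mul_le_mul_of_nonneg_right ?_ (norm_nonneg _)
  rw [abs_of_nonneg (by linarith [hz.2]), abs_of_nonneg (by linarith [hz.1, hz.2])]
  linarith [hz.1]

theorem IsSmoothDensity.aestronglyMeasurable_boundarySlope (hq : IsSmoothDensity q) :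
    AEStronglyMeasurable (boundarySlope q) (sphereMeasure (m + 2)) := by
  have h1 : Measurable fun v : Sph (m + 2) => polarDensity q 1 v :=
    hq.measurable_polarDensity measurable_const measurable_subtype_coe
  refine h1.aestronglyMeasurable.sub ?_
  have h2 := (integrable_weight_mul hq.memLp_radial 1).1.prod_swap.integral_prod_right'
  refine h2.congr (Filter.Eventually.of_forall fun v => ?_)
  simp only []
  rw [intervalIntegral.integral_of_le zero_le_one]
  rfl

theorem quasiMeasurePreserving_colS : Measure.QuasiMeasurePreserving (fun g : OG (m + 2) => colS g 0)
    (orthMeasure (m + 2)) (sphereMeasure (m + 2)) := by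
  refine ⟨measurable_colS 0, ?_⟩
  rw [map_colS]
  exact Measure.smul_absolutelyContinuous

theorem lift_section (a : ℝ × Sph (m + 2) → ℝ) (g : OG (m + 2)) :
    (fun u => lift a (u, g)) = (Set.Ioi 0).indicator fun u => a (u, colS g 0) := by
  ext u
  rcases le_or_gt u 0 with hu | hu
  · rw [lift_of_nonpos _ hu, Set.indicator_of_notMem (by simpa using hu)]
  · rw [lift_of_pos _ hu, Set.indicator_of_mem (by simpa using hu)]

/-- The lift of the second radial derivative of the polar density. -/
abbrev liftRadial (q : Euc (m + 2) → ℝ) : ℝ × OG (m + 2) → ℝ :=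
  lift fun z => radialSecondDeriv (polarDensity q) z.1 z.2

theorem IsSmoothDensity.radial_expansion (hq : IsSmoothDensity q) :
    ∃ C : ℝ, 0 ≤ C ∧ ∀ t, 0 ≤ t → t ≤ 1 →
      ∫ z, secondDiff shift t (liftDensity q) z ^ 2 ∂(volume.prod (orthMeasure (m + 2))) ≤ C * t ^ 3 ∧
      |∫ z, liftDensity q z * secondDiff shift t (liftDensity q) z
          ∂(volume.prod (orthMeasure (m + 2))) -
        t ^ 2 * ∫ z, liftDensity q z * liftRadial q z ∂(volume.prod (orthMeasure (m + 2)))| ≤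
        C * t ^ 3 := by
  refine halfLine_expansion (c := fun g => boundarySlope q (colS g 0)) (memLp_lift hq.memLp)
    (memLp_lift hq.memLp_radial)
    (hq.aestronglyMeasurable_boundarySlope.comp_quasiMeasurePreserving quasiMeasurePreserving_colS) ?_
  filter_upwards [quasiMeasurePreserving_colS.ae hq.isHalfLine] with g hg
  rw [lift_section, lift_section]
  exact hg

/-- The correlation of the density with its image under a translation and a rotation. -/
def correlation (q : Euc (m + 2) → ℝ) (x θ : ℝ) : ℝ :=
  ∫ z, liftDensity q z * liftDensity q (shift x (spin m θ z)) ∂(volume.prod (orthMeasure (m + 2)))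

theorem shift_zero {Y : Type*} (z : ℝ × Y) : shift 0 z = z := by simp [shift]

theorem spin_zero (z : ℝ × OG (m + 2)) : spin m 0 z = z := by simp [spin, rot_zero]

theorem IsSmoothDensity.memLp_comp (hq : IsSmoothDensity q) (x θ : ℝ) :
    MemLp (fun z => liftDensity q (shift x (spin m θ z))) 2 (volume.prod (orthMeasure (m + 2))) :=
  (isFlow_spin m).memLp_comp ((isFlow_shift _).memLp_comp (memLp_lift hq.memLp) x) θ

/-- Translations and rotations commute and preserve the measure, so only the differences of the
parameters matter. -/
theorem IsSmoothDensity.correlation_eq (hq : IsSmoothDensity q) (x y s t : ℝ) :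
    ∫ z, liftDensity q (shift x (spin m s z)) * liftDensity q (shift y (spin m t z))
      ∂(volume.prod (orthMeasure (m + 2))) = correlation q (y - x) (t - s) := by
  have hΦ := memLp_lift hq.memLp
  have h1 := (isFlow_shift (orthMeasure (m + 2))).integral_comp
    (H := fun z => liftDensity q z * liftDensity q (shift (y - x) (spin m (t - s) z)))
    (hΦ.1.mul (hq.memLp_comp _ _).1) x
  have h2 := (isFlow_spin m).integral_comp
    (H := fun z => liftDensity q (shift x z) *
      liftDensity q (shift (y - x) (spin m (t - s) (shift x z))))
    (((isFlow_shift _).memLp_comp hΦ x).1.mul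
      ((isFlow_shift _).memLp_comp (hq.memLp_comp _ _) x).1) s
  rw [correlation, ← h1, ← h2]
  refine integral_congr_ae (Filter.Eventually.of_forall fun z => ?_)
  simp only [shift, spin, mul_assoc, rot_mul]
  rw [show z.1 + x + (y - x) = z.1 + y by ring, show s + (t - s) = t by ring]

/-- Reversing the second column reverses the sense of rotation and leaves the first column alone.
This makes the correlation even in θ. -/
theorem liftDensity_reflect (u : ℝ) (g : OG (m + 2)) (θ : ℝ) :
    liftDensity q (u, g * reflMat m * rot m θ) = liftDensity q (u, g * rot m (-θ)) := by
  rcases le_or_gt u 0 with hu | hu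
  · simp only [liftDensity, lift_of_nonpos _ hu]
  · simp only [liftDensity, lift_of_pos _ hu]
    simp only [coe_colS, col_mul_rot_zero, col_mul_reflMat, Real.cos_neg, Real.sin_neg]
    simp

theorem IsSmoothDensity.correlation_neg_right (hq : IsSmoothDensity q) (x θ : ℝ) :
    correlation q x (-θ) = correlation q x θ := by
  have hS := measurePreserving_orth_mul_right (reflMat m)
  have hm : AEStronglyMeasurable (fun z => liftDensity q z * liftDensity q (shift x (spin m θ z)))
      (volume.prod (orthMeasure (m + 2))) := (memLp_lift hq.memLp).1.mul (hq.memLp_comp x θ).1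
  unfold correlation
  conv_rhs => rw [← hS.map_eq]
  rw [integral_map hS.aemeasurable (by rw [hS.map_eq]; exact hm)]
  refine integral_congr_ae (Filter.Eventually.of_forall ?_)
  rintro ⟨u, g⟩
  have h0 := liftDensity_reflect (q := q) u g 0
  simp only [neg_zero, rot_zero, mul_one] at h0
  simp only [shift, spin, liftDensity_reflect, h0]

/-- The inverse motion exchanges the two factors. With evenness in θ it gives evenness in x. -/
theorem IsSmoothDensity.correlation_neg (hq : IsSmoothDensity q) (x θ : ℝ) :
    correlation q (-x) (-θ) = correlation q x θ := by
  have h := hq.correlation_eq x 0 θ 0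
  rw [zero_sub, zero_sub] at h
  rw [← h, correlation]
  simp only [shift_zero, spin_zero]
  simp only [mul_comm]

theorem IsSmoothDensity.correlation_neg_left (hq : IsSmoothDensity q) (x θ : ℝ) :
    correlation q (-x) θ = correlation q x θ := by
  rw [← hq.correlation_neg_right (-x), hq.correlation_neg]

/-- By evenness in each variable, ⟨Φ, Δ_xΦ⟩ = 2c(x,0) - 2c(0,0), and likewise in θ, while ⟨Δ_xΦ,
Δ_θΦ⟩ = 4(c(x,θ) - c(x,0) - c(0,θ) + c(0,0)). The interaction of x and θ is thus a product of two
separate second differences, and needs no mixed regularity. -/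
theorem IsSmoothDensity.correlation_decomposition (hq : IsSmoothDensity q) (x θ : ℝ) :
    correlation q x θ = correlation q 0 0 +
      1 / 2 * ∫ z, liftDensity q z * secondDiff shift x (liftDensity q) z
          ∂(volume.prod (orthMeasure (m + 2))) +
      1 / 2 * ∫ z, liftDensity q z * secondDiff (spin m) θ (liftDensity q) z
          ∂(volume.prod (orthMeasure (m + 2))) +
      1 / 4 * ∫ z, secondDiff shift x (liftDensity q) z * secondDiff (spin m) θ (liftDensity q) z
          ∂(volume.prod (orthMeasure (m + 2))) := by
  set μ := (volume : Measure ℝ).prod (orthMeasure (m + 2))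
  set P : ℝ → ℝ → ℝ × OG (m + 2) → ℝ := fun x θ z => liftDensity q (shift x (spin m θ z)) with hP
  have hi : ∀ x y s t, Integrable (fun z => P x s z * P y t z) μ := fun x y s t =>
    (hq.memLp_comp x s).integrable_mul (hq.memLp_comp y t)
  have hc : ∀ x y s t, ∫ z, P x s z * P y t z ∂μ = correlation q (y - x) (t - s) :=
    hq.correlation_eq
  have e0 : ∀ z, liftDensity q z = P 0 0 z := fun z => by simp only [hP, shift_zero, spin_zero]
  have ex : ∀ z, secondDiff shift x (liftDensity q) z = P x 0 z + P (-x) 0 z - 2 * P 0 0 z := fun z => by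
    simp only [secondDiff, hP, shift_zero, spin_zero]
  have eθ : ∀ z, secondDiff (spin m) θ (liftDensity q) z = P 0 θ z + P 0 (-θ) z - 2 * P 0 0 z := fun z => by
    simp only [secondDiff, hP, shift_zero, spin_zero]
  have lin : ∀ (A B C D : ℝ × OG (m + 2) → ℝ), Integrable (fun z => A z * B z) μ →
      Integrable (fun z => A z * C z) μ → Integrable (fun z => A z * D z) μ →
      ∫ z, A z * (B z + C z - 2 * D z) ∂μ =
        ∫ z, A z * B z ∂μ + ∫ z, A z * C z ∂μ - 2 * ∫ z, A z * D z ∂μ := by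
    intro A B C D h1 h2 h3
    have h4 : Integrable (fun z => A z * B z + A z * C z) μ := h1.add h2
    rw [← integral_const_mul, ← integral_add h1 h2, ← integral_sub h4 (h3.const_mul 2)]
    refine integral_congr_ae (Filter.Eventually.of_forall fun z => ?_)
    simp only []
    ring
  have i1 : ∫ z, P 0 0 z * (P x 0 z + P (-x) 0 z - 2 * P 0 0 z) ∂μ =
      2 * correlation q x 0 - 2 * correlation q 0 0 := by
    rw [lin _ _ _ _ (hi _ _ _ _) (hi _ _ _ _) (hi _ _ _ _), hc, hc, hc]
    simp only [sub_zero, hq.correlation_neg_left]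
    ring
  have i2 : ∀ y, ∫ z, P y 0 z * (P 0 θ z + P 0 (-θ) z - 2 * P 0 0 z) ∂μ =
      2 * correlation q y θ - 2 * correlation q y 0 := by
    intro y
    rw [lin _ _ _ _ (hi _ _ _ _) (hi _ _ _ _) (hi _ _ _ _), hc, hc, hc]
    simp only [sub_zero, zero_sub, hq.correlation_neg_left, hq.correlation_neg_right]
    ring
  have hj : ∀ y, Integrable (fun z => (P 0 θ z + P 0 (-θ) z - 2 * P 0 0 z) * P y 0 z) μ := by
    intro y
    refine (((hi 0 y θ 0).add (hi 0 y (-θ) 0)).sub ((hi 0 y 0 0).const_mul 2)).congr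
      (Filter.Eventually.of_forall fun z => ?_)
    simp only [Pi.add_apply, Pi.sub_apply]
    ring
  have i3 : ∫ z, (P x 0 z + P (-x) 0 z - 2 * P 0 0 z) * (P 0 θ z + P 0 (-θ) z - 2 * P 0 0 z) ∂μ =
      4 * correlation q x θ - 4 * correlation q x 0 - 4 * correlation q 0 θ +
        4 * correlation q 0 0 := by
    have h1 : ∀ z, (P x 0 z + P (-x) 0 z - 2 * P 0 0 z) * (P 0 θ z + P 0 (-θ) z - 2 * P 0 0 z) =
      (P 0 θ z + P 0 (-θ) z - 2 * P 0 0 z) * (P x 0 z + P (-x) 0 z - 2 * P 0 0 z) := fun z =>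
      mul_comm _ _
    simp only [h1]
    rw [lin _ _ _ _ (hj _) (hj _) (hj _)]
    have h2 : ∀ y, ∫ z, (P 0 θ z + P 0 (-θ) z - 2 * P 0 0 z) * P y 0 z ∂μ =
        2 * correlation q y θ - 2 * correlation q y 0 := fun y => by
      rw [← i2 y]
      simp only [mul_comm]
    rw [h2, h2, h2, hq.correlation_neg_left, hq.correlation_neg_left]
    ring
  have i2' := i2 0
  simp only [e0, ex, eθ]
  rw [i1, i2', i3]
  ring

/-- The pure terms come from the two flow expansions. The mixed term is at most half the sum of
‖Δ_xΦ‖² = O(|x|³) and ‖Δ_θΦ‖² = O(θ⁴). -/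
theorem IsSmoothDensity.correlation_expansion (hq : IsSmoothDensity q) :
    ∃ C : ℝ, 0 ≤ C ∧ ∀ x θ : ℝ, |x| ≤ 1 → 0 ≤ θ →
      |correlation q x θ - (correlation q 0 0 +
        x ^ 2 / 2 * ∫ z, liftDensity q z * liftRadial q z ∂(volume.prod (orthMeasure (m + 2))) +
        θ ^ 2 / 2 * ∫ z, liftDensity q z * frameHessian q 1 z
          ∂(volume.prod (orthMeasure (m + 2))))| ≤ C * (|x| ^ 3 + θ ^ 4) := by
  obtain ⟨C₁, hC₁, h1⟩ := hq.radial_expansion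
  set C₂ := ∫ z, frameHessian q 1 z ^ 2 ∂(volume.prod (orthMeasure (m + 2))) with hC₂def
  have hC₂ : 0 ≤ C₂ := integral_nonneg fun z => sq_nonneg _
  have hΦ := memLp_lift hq.memLp
  refine ⟨C₁ + C₂, by positivity, fun x θ hx hθ => ?_⟩
  wlog hx0 : 0 ≤ x generalizing x
  · have := this (-x) (by rwa [abs_neg]) (by linarith)
    rwa [hq.correlation_neg_left, abs_neg, neg_sq] at this
  rw [abs_of_nonneg hx0] at hx ⊢
  obtain ⟨a1, a2⟩ := h1 x hx0 hx
  obtain ⟨b1, b2⟩ := (isFlow_spin m).expansion hΦ (memLp_frameHessian hq 1)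
    (fun t ht => Filter.EventuallyEq.of_eq (secondDiff_spin hq ht)) hθ
  have c1 := abs_integral_mul_le ((isFlow_shift _).memLp_secondDiff hΦ x)
    ((isFlow_spin m).memLp_secondDiff hΦ θ) one_pos
  rw [← hC₂def] at b1 b2
  rw [hq.correlation_decomposition x θ]
  rw [div_one, one_mul] at c1
  have hx3 : 0 ≤ C₁ * x ^ 3 := by positivity
  have hθ4 : 0 ≤ C₂ * θ ^ 4 := by positivity
  have hx3' : 0 ≤ C₂ * x ^ 3 := by positivity
  have hθ4' : 0 ≤ C₁ * θ ^ 4 := by positivity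
  rw [abs_le] at a2 b2 c1 ⊢
  constructor <;> nlinarith

end

/-! ### The marginal density of the norm -/

noncomputable section

theorem IsHalfLine.intervalIntegrable {F G : ℝ → ℝ} {c : ℝ} (h : IsHalfLine F G c) (a b : ℝ) :
    IntervalIntegrable G volume a b :=
  intervalIntegrable_iff.2 <| (h.memLp'.integrableOn_Icc (min a b) (max a b)).mono_set
    Set.Ioc_subset_Icc_self

/-- The first order remainder is ∫ (v - s) G(s) ds over [u, v], at most |v - u| times the integral
of |G|, hence o(v - u) at every u even though G is only square integrable. -/
theorem IsHalfLine.hasDerivAt {F G : ℝ → ℝ} {c : ℝ} (h : IsHalfLine F G c) {u : ℝ} (hu : 0 < u) :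
    HasDerivAt F (c + ∫ s in (0 : ℝ)..u, G s) u := by
  have hG := h.intervalIntegrable
  have hm : ∀ v a b, IntervalIntegrable (fun s => (v - s) * G s) volume a b := fun v a b =>
    (hG a b).continuousOn_mul (by fun_prop)
  rw [hasDerivAt_iff_isLittleO]
  have hkey : ∀ v, 0 < v → ‖F v - F u - (v - u) • (c + ∫ s in (0 : ℝ)..u, G s)‖ ≤
      |v - u| * |(∫ s in u..v, |G s|)| := by
    intro v hv
    have e : F v - F u - (v - u) • (c + ∫ s in (0 : ℝ)..u, G s) = ∫ s in u..v, (v - s) * G s := by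
      rw [h.eq_integral v hv, h.eq_integral u hu, smul_eq_mul,
        ← intervalIntegral.integral_add_adjacent_intervals (hm v 0 u) (hm v u v)]
      have e1 : ∫ s in (0 : ℝ)..u, (v - s) * G s =
          (v - u) * (∫ s in (0 : ℝ)..u, G s) + ∫ s in (0 : ℝ)..u, (u - s) * G s := by
        rw [← intervalIntegral.integral_const_mul,
          ← intervalIntegral.integral_add ((hG _ _).const_mul _) (hm _ _ _)]
        refine intervalIntegral.integral_congr fun s _ => ?_
        ring
      rw [e1]
      ring
    rw [e]
    refine (intervalIntegral.norm_integral_le_abs_of_norm_le (g := fun s => |v - u| * |G s|) ?_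
      ((hG _ _).abs.const_mul _)).trans ?_
    · refine (ae_restrict_mem measurableSet_uIoc).mono fun s hs => ?_
      rw [norm_mul, Real.norm_eq_abs, Real.norm_eq_abs]
      refine mul_le_mul_of_nonneg_right ?_ (abs_nonneg _)
      have hs' := Set.uIoc_subset_uIcc hs
      rw [Set.uIcc_comm] at hs'
      have := Set.abs_sub_left_of_mem_uIcc hs'
      rwa [abs_sub_comm, abs_sub_comm v u]
    · rw [intervalIntegral.integral_const_mul, abs_mul, abs_abs]
  have hP : Filter.Tendsto (fun v => ∫ s in u..v, |G s|) (nhds u) (nhds 0) := by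
    have h1 : Continuous fun v => ∫ s in u..v, |G s| :=
      intervalIntegral.continuous_primitive (fun a b => (hG a b).abs) u
    have := h1.tendsto u
    rwa [intervalIntegral.integral_same] at this
  rw [Asymptotics.isLittleO_iff]
  intro ε hε
  have h2 : ∀ᶠ v in nhds u, |(∫ s in u..v, |G s|)| < ε := by
    have := hP.abs
    rw [abs_zero] at this
    exact this.eventually_lt_const hε
  filter_upwards [h2, Ioi_mem_nhds hu] with v hv hv0
  refine (hkey v hv0).trans ?_
  rw [mul_comm, Real.norm_eq_abs]
  exact mul_le_mul_of_nonneg_right hv.le (abs_nonneg _)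

/-- The derivative is a primitive of G, so Lebesgue differentiation applies. This is where "almost
every" enters for f_U''. -/
theorem IsHalfLine.ae_hasDerivAt_deriv {F G : ℝ → ℝ} {c : ℝ} (h : IsHalfLine F G c) :
    ∀ᵐ u, 0 < u → HasDerivAt (deriv F) (G u) u := by
  have hl : LocallyIntegrable G volume := fun x =>
    ⟨Set.Icc (x - 1) (x + 1), Icc_mem_nhds (by linarith) (by linarith),
      h.memLp'.integrableOn_Icc _ _⟩
  filter_upwards [_root_.LocallyIntegrable.ae_hasDerivAt_integral hl] with u hu hu0
  refine ((hu 0).const_add c).congr_of_eventuallyEq ?_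
  filter_upwards [Ioi_mem_nhds hu0] with v hv
  exact (h.hasDerivAt hv).deriv

/-- The parametrized expansion over a one point space; evenness of the correlation reduces to x ≥ 0.
-/
theorem IsHalfLine.correlation_expansion {F G : ℝ → ℝ} {c : ℝ} (h : IsHalfLine F G c) :
    ∃ C : ℝ, 0 ≤ C ∧ ∀ x, |x| ≤ 1 →
      |(∫ u, F u * F (u + x)) - ((∫ u, F u ^ 2) + x ^ 2 / 2 * ∫ u, F u * G u)| ≤ C * |x| ^ 3 := by
  obtain ⟨C, hC, hexp⟩ := halfLine_expansion (ν := Measure.dirac ()) (F := fun z => F z.1)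
    (G := fun z => G z.1) (c := fun _ => c) (h.memLp.comp_fst _) (h.memLp'.comp_fst _)
    aestronglyMeasurable_const (Filter.Eventually.of_forall fun _ => h)
  have hs : ∀ x, MemLp (fun u => F (u + x)) 2 volume := fun x =>
    h.memLp.comp_measurePreserving (measurePreserving_add_right volume x)
  have hi : ∀ x, Integrable fun u => F u * F (u + x) := fun x => h.memLp.integrable_mul (hs x)
  have hneg : ∀ x, ∫ u, F u * F (u + -x) = ∫ u, F u * F (u + x) := by
    intro x
    rw [← integral_add_right_eq_self (fun u => F u * F (u + -x)) x]
    refine integral_congr_ae (Filter.Eventually.of_forall fun u => ?_)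
    simp only [add_neg_cancel_right]
    ring
  refine ⟨C, hC, fun x hx => ?_⟩
  wlog hx0 : 0 ≤ x generalizing x
  · have := this (-x) (by rwa [abs_neg]) (by linarith)
    rwa [hneg, abs_neg, neg_sq] at this
  rw [abs_of_nonneg hx0] at hx ⊢
  have h2 := (hexp x hx0 hx).2
  have e : ∀ H : ℝ → ℝ, ∫ z : ℝ × Unit, H z.1 ∂(volume.prod (Measure.dirac ())) = ∫ u, H u := fun H => by
    rw [integral_fun_fst]; simp
  have e1 := e fun u => F u * (F (u + x) + F (u + -x) - 2 * F u)
  have e2 := e fun u => F u * G u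
  simp only [secondDiff, shift] at h2
  rw [e1, e2] at h2
  have e3 : ∫ u, F u * (F (u + x) + F (u + -x) - 2 * F u) =
      2 * (∫ u, F u * F (u + x)) - 2 * ∫ u, F u ^ 2 := by
    have h3 : ∫ u, F u * (F (u + x) + F (u + -x) - 2 * F u) =
        ∫ u, ((F u * F (u + x) + F u * F (u + -x)) - 2 * F u ^ 2) :=
      integral_congr_ae (Filter.Eventually.of_forall fun u => by simp only []; ring)
    have h4 : Integrable fun u => F u * F (u + x) + F u * F (u + -x) := (hi x).add (hi (-x))
    rw [h3, integral_sub h4 (h.memLp.integrable_sq.const_mul 2), integral_add (hi _) (hi _), hneg,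
      integral_const_mul]
    ring
  rw [e3] at h2
  rw [abs_le] at h2 ⊢
  have hx3 : 0 ≤ C * x ^ 3 := by positivity
  constructor <;> linarith [h2.1, h2.2]

variable {m : ℕ} {q : Euc (m + 2) → ℝ}

/-- Cauchy-Schwarz on the sphere, which has finite measure. -/
theorem memLp_marginal {a : ℝ × Sph (m + 2) → ℝ} (ha : MemLp a 2 (polarMeasure (m + 2))) :
    MemLp (fun u => ∫ v, a (u, v) ∂(sphereMeasure (m + 2))) 2 (volume.restrict (Set.Ioi 0)) := by
  have hm : AEStronglyMeasurable (fun u => ∫ v, a (u, v) ∂(sphereMeasure (m + 2)))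
      (volume.restrict (Set.Ioi 0)) :=
    AEStronglyMeasurable.integral_prod_right' (ν := sphereMeasure (m + 2)) ha.1
  have h2 : Integrable (fun z => a z ^ 2)
    ((volume.restrict (Set.Ioi (0 : ℝ))).prod (sphereMeasure (m + 2))) := ha.integrable_sq
  rw [memLp_two_iff_integrable_sq hm]
  refine (h2.integral_prod_left.const_mul (∫ v : Sph (m + 2), (1 : ℝ) ∂(sphereMeasure (m + 2)))).mono
    (hm.pow 2) ?_
  have h3 : ∀ᵐ u ∂(volume.restrict (Set.Ioi (0 : ℝ))),
      AEStronglyMeasurable (fun v => a (u, v)) (sphereMeasure (m + 2)) :=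
    AEStronglyMeasurable.prodMk_left (ν := sphereMeasure (m + 2)) ha.1
  filter_upwards [h3, h2.prod_right_ae] with u hu1 hu2
  rw [Real.norm_of_nonneg (sq_nonneg _)]
  refine le_trans ?_ (le_abs_self _)
  have := sq_integral_mul_le (w := fun _ => 1) (h := fun v => a (u, v)) (μ := sphereMeasure (m + 2))
    (integrable_const 1) (fun _ => zero_le_one)
    (by simpa using ((memLp_two_iff_integrable_sq hu1).2 hu2).integrable one_le_two)
    (by simpa using hu2)
  simpa using this

/-- The bound of c² by the norms of F and G, integrated over v, makes the slope square integrable.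
-/
theorem IsSmoothDensity.integrable_boundarySlope (hq : IsSmoothDensity q) :
    Integrable (boundarySlope q) (sphereMeasure (m + 2)) := by
  have h1 : Integrable (fun z : ℝ × Sph (m + 2) => polarDensity q z.1 z.2 ^ 2)
    ((volume.restrict (Set.Ioi (0 : ℝ))).prod (sphereMeasure (m + 2))) := hq.memLp.integrable_sq
  have h2 : Integrable (fun z : ℝ × Sph (m + 2) => radialSecondDeriv (polarDensity q) z.1 z.2 ^ 2)
    ((volume.restrict (Set.Ioi (0 : ℝ))).prod (sphereMeasure (m + 2))) :=
    hq.memLp_radial.integrable_sq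
  have e : ∀ H : ℝ → ℝ, ∫ u, (Set.Ioi (0 : ℝ)).indicator H u ^ 2 = ∫ u in Set.Ioi 0, H u ^ 2 := by
    intro H
    rw [← integral_indicator measurableSet_Ioi]
    refine integral_congr_ae (Filter.Eventually.of_forall fun u => ?_)
    by_cases hu : u ∈ Set.Ioi (0 : ℝ) <;> simp [hu]
  refine MemLp.integrable one_le_two
    ((memLp_two_iff_integrable_sq hq.aestronglyMeasurable_boundarySlope).2 ?_)
  refine ((h1.integral_prod_right.const_mul 6).add (h2.integral_prod_right.const_mul 6)).mono
    (hq.aestronglyMeasurable_boundarySlope.pow 2) ?_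
  filter_upwards [hq.isHalfLine] with v hv
  rw [Real.norm_of_nonneg (sq_nonneg _)]
  refine le_trans ?_ (le_abs_self _)
  have := hv.sq_le
  rw [e, e] at this
  exact this

/-- The marginal density of the norm, extended by zero. -/
abbrev marginal (q : Euc (m + 2) → ℝ) : ℝ → ℝ :=
  (Set.Ioi 0).indicator (radialMarginal (polarDensity q))

/-- The integral representation is linear, so it survives integration over v by Fubini, although f_U
need not be twice differentiable everywhere. Its second derivative in this sense is the marginal of
∂²f/∂u². -/
theorem IsSmoothDensity.isHalfLine_marginal (hq : IsSmoothDensity q) :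
    IsHalfLine (marginal q)
      ((Set.Ioi 0).indicator (radialMarginal (radialSecondDeriv (polarDensity q))))
      (∫ v, boundarySlope q v ∂(sphereMeasure (m + 2))) where
  nonpos u hu := Set.indicator_of_notMem (by simpa using hu) _
  nonpos' u hu := Set.indicator_of_notMem (by simpa using hu) _
  memLp := (memLp_indicator_iff_restrict measurableSet_Ioi).2 (memLp_marginal hq.memLp)
  memLp' := (memLp_indicator_iff_restrict measurableSet_Ioi).2 (memLp_marginal hq.memLp_radial)
  eq_integral u hu := by
    have hi := integrable_weight_mul hq.memLp_radial u
    have e1 : radialMarginal (polarDensity q) u = ∫ v : Sph (m + 2), (boundarySlope q v * u +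
        ∫ s in Set.Ioc 0 u, (u - s) * radialSecondDeriv (polarDensity q) s v)
          ∂(sphereMeasure (m + 2)) := by
      refine integral_congr_ae ?_
      filter_upwards [hq.isHalfLine] with v hv
      have := hv.eq_integral u hu
      rw [Set.indicator_of_mem (Set.mem_Ioi.2 hu), intervalIntegral.integral_of_le hu.le] at this
      rw [this]
      congr 1
      refine setIntegral_congr_fun measurableSet_Ioc fun s hs => ?_
      rw [Set.indicator_of_mem (Set.mem_Ioi.2 hs.1)]
    rw [marginal, Set.indicator_of_mem (Set.mem_Ioi.2 hu), e1,
      integral_add (hq.integrable_boundarySlope.mul_const u) hi.integral_prod_right,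
      integral_mul_const, intervalIntegral.integral_of_le hu.le]
    congr 1
    rw [← integral_integral_swap (f := fun (s : ℝ) (v : Sph (m + 2)) => (u - s) *
      radialSecondDeriv (polarDensity q) s v) hi]
    refine setIntegral_congr_fun measurableSet_Ioc fun s hs => ?_
    rw [Set.indicator_of_mem (Set.mem_Ioi.2 hs.1), integral_const_mul]
    rfl

theorem IsSmoothDensity.ae_marginal (hq : IsSmoothDensity q) :
    ∀ᵐ u ∂(volume.restrict (Set.Ioi (0 : ℝ))),
      DifferentiableAt ℝ (radialMarginal (polarDensity q)) u ∧
      DifferentiableAt ℝ (deriv (radialMarginal (polarDensity q))) u ∧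
      iteratedDeriv 2 (radialMarginal (polarDensity q)) u =
        radialMarginal (radialSecondDeriv (polarDensity q)) u := by
  have h := hq.isHalfLine_marginal
  rw [ae_restrict_iff' measurableSet_Ioi]
  filter_upwards [h.ae_hasDerivAt_deriv] with u hu hu0
  have e0 : ∀ v ∈ Set.Ioi (0 : ℝ), marginal q =ᶠ[nhds v] radialMarginal (polarDensity q) := by
    intro v hv
    filter_upwards [Ioi_mem_nhds hv] with s hs
    exact Set.indicator_of_mem hs _
  have e1 : deriv (marginal q) =ᶠ[nhds u] deriv (radialMarginal (polarDensity q)) := by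
    filter_upwards [Ioi_mem_nhds hu0] with v hv
    exact (e0 v hv).deriv_eq
  have h1 := (hu hu0).congr_of_eventuallyEq e1.symm
  refine ⟨((h.hasDerivAt hu0).congr_of_eventuallyEq (e0 u hu0).symm).differentiableAt,
    h1.differentiableAt, ?_⟩
  rw [iteratedDeriv_succ, iteratedDeriv_one, h1.deriv, Set.indicator_of_mem hu0]

theorem IsSmoothDensity.integrableOn_marginal (hq : IsSmoothDensity q) :
    IntegrableOn (fun u => radialMarginal (polarDensity q) u *
      iteratedDeriv 2 (radialMarginal (polarDensity q)) u) (Set.Ioi 0) := by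
  refine ((memLp_marginal hq.memLp).integrable_mul (memLp_marginal hq.memLp_radial)).congr ?_
  filter_upwards [hq.ae_marginal] with u hu
  rw [hu.2.2]
  rfl

theorem IsSmoothDensity.marginal_expansion (hq : IsSmoothDensity q) :
    ∃ C : ℝ, 0 ≤ C ∧ ∀ x, |x| ≤ 1 →
      |(∫ u, marginal q u * marginal q (u + x)) -
        ((∫ u in Set.Ioi 0, radialMarginal (polarDensity q) u ^ 2) + x ^ 2 / 2 *
          ∫ u in Set.Ioi 0, radialMarginal (polarDensity q) u *
            iteratedDeriv 2 (radialMarginal (polarDensity q)) u)| ≤ C * |x| ^ 3 := by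
  obtain ⟨C, hC, h⟩ := hq.isHalfLine_marginal.correlation_expansion
  refine ⟨C, hC, fun x hx => ?_⟩
  have e1 : ∫ u, marginal q u ^ 2 = ∫ u in Set.Ioi 0, radialMarginal (polarDensity q) u ^ 2 := by
    rw [← integral_indicator measurableSet_Ioi]
    refine integral_congr_ae (Filter.Eventually.of_forall fun u => ?_)
    by_cases hu : u ∈ Set.Ioi (0 : ℝ) <;> simp [hu]
  have e2 : ∫ u, marginal q u *
      (Set.Ioi 0).indicator (radialMarginal (radialSecondDeriv (polarDensity q))) u =
      ∫ u in Set.Ioi 0, radialMarginal (polarDensity q) u *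
        iteratedDeriv 2 (radialMarginal (polarDensity q)) u := by
    have e3 : ∫ u in Set.Ioi 0, radialMarginal (polarDensity q) u *
        iteratedDeriv 2 (radialMarginal (polarDensity q)) u =
        ∫ u in Set.Ioi 0, radialMarginal (polarDensity q) u *
          radialMarginal (radialSecondDeriv (polarDensity q)) u := by
      refine integral_congr_ae ?_
      filter_upwards [hq.ae_marginal] with u hu
      rw [hu.2.2]
    rw [e3, ← integral_indicator measurableSet_Ioi]
    refine integral_congr_ae (Filter.Eventually.of_forall fun u => ?_)
    by_cases hu : u ∈ Set.Ioi (0 : ℝ) <;> simp [hu]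
  rw [← e1, ← e2]
  exact h x hx

end

/-! ### The deviation from sphericity -/

noncomputable section

variable {m : ℕ} {q : Euc (m + 2) → ℝ}

theorem ae_polar_pos {p : ℕ} : ∀ᵐ z ∂(polarMeasure p), 0 < z.1 :=
  Measure.quasiMeasurePreserving_fst.ae (ae_restrict_mem measurableSet_Ioi)

/-- The Jacobian u^(p-1) is positive for u > 0, so null sets correspond. -/
theorem ae_iff_ae_polar {p : ℕ} (hp : 1 ≤ p) {S : Set (Euc p)} (hS : MeasurableSet S) :
    (∀ᵐ y, y ∈ S) ↔ ∀ᵐ z ∂(polarMeasure p), z.1 • (z.2 : Euc p) ∈ S := by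
  have hm : Measurable fun z : ℝ × Sph p => z.1 • (z.2 : Euc p) :=
    measurable_fst.smul (measurable_subtype_coe.comp measurable_snd)
  have h := lintegral_polar (Sᶜ.indicator 1) (measurable_one.indicator hS.compl) hp
  rw [lintegral_indicator_one hS.compl] at h
  have h1 : (∀ᵐ y, y ∈ S) ↔ volume Sᶜ = 0 := Iff.rfl
  have h2 : Measurable fun z : ℝ × Sph p =>
      ENNReal.ofReal (z.1 ^ (p - 1)) * Sᶜ.indicator 1 (z.1 • (z.2 : Euc p)) :=
    ((measurable_fst.pow_const _).ennreal_ofReal).mul ((measurable_one.indicator hS.compl).comp hm)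
  rw [h1, h, lintegral_eq_zero_iff h2]
  refine ⟨fun h2 => ?_, fun h2 => ?_⟩
  · filter_upwards [h2, ae_polar_pos] with z hz hz0
    by_contra hc
    have hc' : z.1 • (z.2 : Euc p) ∈ Sᶜ := hc
    simp only [Set.indicator_of_mem hc', Pi.zero_apply, Pi.one_apply, mul_one,
      ENNReal.ofReal_eq_zero] at hz
    exact absurd (pow_pos hz0 (p - 1)) (not_lt.2 hz)
  · filter_upwards [h2] with z hz
    rw [Set.indicator_of_notMem (by simpa using hz)]
    simp

theorem lintegral_withDensity_polar {p : ℕ} (hp : 1 ≤ p) {q : Euc p → ℝ} (hq : Measurable q)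
    {φ : Euc p → ENNReal} (hφ : Measurable φ) :
    ∫⁻ y, φ y ∂(volume.withDensity fun y => ENNReal.ofReal (q y)) =
      ∫⁻ z, ENNReal.ofReal (polarDensity q z.1 z.2) * φ (z.1 • (z.2 : Euc p))
        ∂(polarMeasure p) := by
  rw [lintegral_withDensity_eq_lintegral_mul _ hq.ennreal_ofReal hφ,
    lintegral_polar _ (hq.ennreal_ofReal.mul hφ) hp]
  refine lintegral_congr_ae ?_
  filter_upwards [ae_polar_pos] with z hz
  rw [polarDensity, ENNReal.ofReal_mul (by positivity), Pi.mul_apply, mul_assoc]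

theorem IsSmoothDensity.measurable_radialMarginal (hq : IsSmoothDensity q) :
    Measurable (radialMarginal (polarDensity q)) := by
  have h : StronglyMeasurable fun z : ℝ × Sph (m + 2) => polarDensity q z.1 z.2 :=
    (hq.measurable_polarDensity measurable_fst
      (measurable_subtype_coe.comp measurable_snd)).stronglyMeasurable
  exact h.integral_prod_right'.measurable

theorem polarDensity_nonneg (hq0 : ∀ y, 0 ≤ q y) {u : ℝ} (hu : 0 ≤ u) (v : Euc (m + 2)) :
    0 ≤ polarDensity q u v := mul_nonneg (pow_nonneg hu _) (hq0 _)

theorem radialMarginal_nonneg (hq0 : ∀ y, 0 ≤ q y) {u : ℝ} (hu : 0 ≤ u) :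
    0 ≤ radialMarginal (polarDensity q) u :=
  integral_nonneg fun _ => polarDensity_nonneg hq0 hu _

theorem marginal_nonneg (hq0 : ∀ y, 0 ≤ q y) (u : ℝ) : 0 ≤ marginal q u :=
  Set.indicator_nonneg (fun _ hs => radialMarginal_nonneg hq0 (le_of_lt hs)) u

theorem IsSmoothDensity.ae_memLp_angular (hq : IsSmoothDensity q) :
    ∀ᵐ u ∂(volume.restrict (Set.Ioi (0 : ℝ))),
      MemLp (fun v : Sph (m + 2) => polarDensity q u v) 2 (sphereMeasure (m + 2)) := by
  have h2 : Integrable (fun z : ℝ × Sph (m + 2) => polarDensity q z.1 z.2 ^ 2)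
    ((volume.restrict (Set.Ioi (0 : ℝ))).prod (sphereMeasure (m + 2))) := hq.memLp.integrable_sq
  filter_upwards [h2.prod_right_ae] with u hu
  exact (memLp_two_iff_integrable_sq (hq.measurable_polarDensity measurable_const
    measurable_subtype_coe).aestronglyMeasurable).2 hu

/-- `radialMarginal` takes the default value 0 where f(u,·) is not integrable; for almost every u it
is square integrable, and the two integrals agree. -/
theorem IsSmoothDensity.ae_lintegral_angular (hq : IsSmoothDensity q) (hq0 : ∀ y, 0 ≤ q y) :
    ∀ᵐ u ∂(volume.restrict (Set.Ioi (0 : ℝ))),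
      ∫⁻ v : Sph (m + 2), ENNReal.ofReal (polarDensity q u v) ∂(sphereMeasure (m + 2)) =
        ENNReal.ofReal (radialMarginal (polarDensity q) u) := by
  filter_upwards [hq.ae_memLp_angular, ae_restrict_mem measurableSet_Ioi] with u hu hu0
  exact (ofReal_integral_eq_lintegral_ofReal (hu.integrable one_le_two)
    (Filter.Eventually.of_forall fun v => polarDensity_nonneg hq0 (le_of_lt hu0) _)).symm

theorem IsSmoothDensity.isRadialDensity_marginal (hq : IsSmoothDensity q) (hq0 : ∀ y, 0 ≤ q y)
    (hq1 : ∫⁻ y, ENNReal.ofReal (q y) = 1) : IsRadialDensity (marginal q) := by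
  refine ⟨hq.measurable_radialMarginal.indicator measurableSet_Ioi, marginal_nonneg hq0, ?_⟩
  have h := lintegral_withDensity_polar (p := m + 2) (by omega) hq.measurable
    (φ := fun _ => 1) measurable_const
  simp only [lintegral_one, mul_one, withDensity_apply _ MeasurableSet.univ,
    Measure.restrict_univ] at h
  have hm : Measurable fun z : ℝ × Sph (m + 2) => ENNReal.ofReal (polarDensity q z.1 z.2) :=
    (hq.measurable_polarDensity measurable_fst
      (measurable_subtype_coe.comp measurable_snd)).ennreal_ofReal
  rw [hq1, polarMeasure, lintegral_prod _ hm.aemeasurable] at h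
  rw [h]
  refine lintegral_congr_ae ?_
  filter_upwards [hq.ae_lintegral_angular hq0, ae_restrict_mem measurableSet_Ioi] with u hu hu0
  rw [hu, marginal, Set.indicator_of_mem hu0]

theorem integral_const_sphere (c : ℝ) :
    ∫ _ : Sph (m + 2), c ∂(sphereMeasure (m + 2)) = sphereArea (m + 2) * c := by
  rw [integral_const, smul_eq_mul, measureReal_def, sphereMeasure_univ (by omega),
    ENNReal.toReal_ofReal (sphereArea_pos (by omega)).le]

/-- The mean minimizes the quadratic deviation over the sphere. -/
theorem lintegral_sq_sub_mean_le {a : Sph (m + 2) → ℝ} (ha : MemLp a 2 (sphereMeasure (m + 2)))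
    (c : ℝ) :
    ∫⁻ v, ENNReal.ofReal ((a v - (∫ w, a w ∂(sphereMeasure (m + 2))) * (sphereArea (m + 2))⁻¹) ^ 2)
        ∂(sphereMeasure (m + 2)) ≤
      ∫⁻ v, ENNReal.ofReal ((a v - c) ^ 2) ∂(sphereMeasure (m + 2)) := by
  have hω : 0 < sphereArea (m + 2) := sphereArea_pos (by omega)
  set b := (∫ w, a w ∂(sphereMeasure (m + 2))) * (sphereArea (m + 2))⁻¹ with hb
  have hi : ∀ c, MemLp (fun v => a v - c) 2 (sphereMeasure (m + 2)) := fun c =>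
    ha.sub (memLp_const c)
  have h0 : ∫ v, (a v - b) ∂(sphereMeasure (m + 2)) = 0 := by
    rw [integral_sub (ha.integrable one_le_two) (integrable_const _), integral_const_sphere, hb]
    field_simp
    ring
  rw [← ofReal_integral_eq_lintegral_ofReal (hi b).integrable_sq
      (Filter.Eventually.of_forall fun v => sq_nonneg _),
    ← ofReal_integral_eq_lintegral_ofReal (hi c).integrable_sq
      (Filter.Eventually.of_forall fun v => sq_nonneg _)]
  refine ENNReal.ofReal_le_ofReal ?_
  have h1 : ∫ v, ((a v - b) ^ 2 + 2 * (b - c) * (a v - b)) ∂(sphereMeasure (m + 2)) ≤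
      ∫ v, (a v - c) ^ 2 ∂(sphereMeasure (m + 2)) := by
    refine integral_mono ((hi b).integrable_sq.add (((hi b).integrable one_le_two).const_mul _))
      (hi c).integrable_sq fun v => ?_
    nlinarith [sq_nonneg (b - c)]
  rwa [integral_add (hi b).integrable_sq (((hi b).integrable one_le_two).const_mul _),
    integral_const_mul, h0, mul_zero, add_zero] at h1

/-- The difference between the polar density and its best spherical approximation. -/
def asphericity (q : Euc (m + 2) → ℝ) (z : ℝ × Sph (m + 2)) : ℝ :=
  polarDensity q z.1 z.2 - radialMarginal (polarDensity q) z.1 * (sphereArea (m + 2))⁻¹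

theorem IsSmoothDensity.memLp_marginal_fst (hq : IsSmoothDensity q) :
    MemLp (fun z : ℝ × Sph (m + 2) => radialMarginal (polarDensity q) z.1) 2
      (polarMeasure (m + 2)) :=
  (memLp_marginal hq.memLp).comp_fst _

theorem IsSmoothDensity.memLp_asphericity (hq : IsSmoothDensity q) :
    MemLp (asphericity q) 2 (polarMeasure (m + 2)) := by
  have h := hq.memLp.sub (hq.memLp_marginal_fst.const_mul (sphereArea (m + 2))⁻¹)
  refine h.ae_eq (Filter.Eventually.of_forall fun z => ?_)
  simp only [asphericity, Pi.sub_apply]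
  ring

/-- Pythagoras: the cross term ∫∫ f_U f and the term ω⁻¹ ∫∫ f_U² both equal ∫ f_U² by Fubini. -/
theorem IsSmoothDensity.integral_sq_asphericity (hq : IsSmoothDensity q) :
    ∫ z, asphericity q z ^ 2 ∂(polarMeasure (m + 2)) =
      ∫ z, polarDensity q z.1 z.2 ^ 2 ∂(polarMeasure (m + 2)) -
        (sphereArea (m + 2))⁻¹ * ∫ u in Set.Ioi 0, radialMarginal (polarDensity q) u ^ 2 := by
  have hω : 0 < sphereArea (m + 2) := sphereArea_pos (by omega)
  set ω := sphereArea (m + 2)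
  have i1 := hq.memLp.integrable_sq
  have i2 : Integrable (fun z : ℝ × Sph (m + 2) => radialMarginal (polarDensity q) z.1 *
      polarDensity q z.1 z.2) (polarMeasure (m + 2)) :=
    hq.memLp_marginal_fst.integrable_mul hq.memLp
  have i3 := hq.memLp_marginal_fst.integrable_sq
  have e2 : ∫ z, radialMarginal (polarDensity q) z.1 * polarDensity q z.1 z.2
      ∂(polarMeasure (m + 2)) = ∫ u in Set.Ioi 0, radialMarginal (polarDensity q) u ^ 2 := by
    rw [polarMeasure, integral_prod _ i2]
    refine integral_congr_ae (Filter.Eventually.of_forall fun u => ?_)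
    simp only []
    rw [integral_const_mul, sq]
    rfl
  have e3 : ∫ z : ℝ × Sph (m + 2), radialMarginal (polarDensity q) z.1 ^ 2
      ∂(polarMeasure (m + 2)) = ω * ∫ u in Set.Ioi 0, radialMarginal (polarDensity q) u ^ 2 := by
    rw [polarMeasure, integral_prod _ i3, ← integral_const_mul]
    refine integral_congr_ae (Filter.Eventually.of_forall fun u => ?_)
    exact integral_const_sphere (m := m) (radialMarginal (polarDensity q) u ^ 2)
  have e : ∀ z, asphericity q z ^ 2 = polarDensity q z.1 z.2 ^ 2 -
      2 * ω⁻¹ * (radialMarginal (polarDensity q) z.1 * polarDensity q z.1 z.2) +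
      ω⁻¹ ^ 2 * radialMarginal (polarDensity q) z.1 ^ 2 := fun z => by
    simp only [asphericity]
    ring
  simp only [e]
  have i4 : Integrable (fun z : ℝ × Sph (m + 2) => polarDensity q z.1 z.2 ^ 2 -
      2 * ω⁻¹ * (radialMarginal (polarDensity q) z.1 * polarDensity q z.1 z.2))
      (polarMeasure (m + 2)) := i1.sub (i2.const_mul _)
  rw [integral_add i4 (i3.const_mul _), integral_sub i1 (i2.const_mul _), integral_const_mul,
    integral_const_mul, e2, e3]
  field_simp
  ring

/-- For almost every u the mean over the sphere is the best constant, whatever g is. The marginal is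
itself a probability density, so the infimum is attained there. -/
theorem IsSmoothDensity.deviation_eq (hq : IsSmoothDensity q) (hq0 : ∀ y, 0 ≤ q y)
    (hq1 : ∫⁻ y, ENNReal.ofReal (q y) = 1) :
    deviation (polarDensity q) = ∫ z, asphericity q z ^ 2 ∂(polarMeasure (m + 2)) := by
  have hf : Measurable fun z : ℝ × Sph (m + 2) => polarDensity q z.1 z.2 :=
    hq.measurable_polarDensity measurable_fst (measurable_subtype_coe.comp measurable_snd)
  have hmeas : ∀ g : ℝ → ℝ, Measurable g → Measurable fun z : ℝ × Sph (m + 2) =>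
      ENNReal.ofReal ((polarDensity q z.1 z.2 - g z.1 * (sphereArea (m + 2))⁻¹) ^ 2) := fun g hg =>
    ((hf.sub ((hg.comp measurable_fst).mul_const _)).pow_const 2).ennreal_ofReal
  have key : (⨅ (g : ℝ → ℝ) (_ : IsRadialDensity g),
      ∫⁻ z, ENNReal.ofReal ((polarDensity q z.1 z.2 - g z.1 * (sphereArea (m + 2))⁻¹) ^ 2)
        ∂(polarMeasure (m + 2))) =
      ∫⁻ z, ENNReal.ofReal (asphericity q z ^ 2) ∂(polarMeasure (m + 2)) := by
    refine le_antisymm ?_ (le_iInf₂ fun g hg => ?_)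
    · refine (iInf₂_le _ (hq.isRadialDensity_marginal hq0 hq1)).trans (le_of_eq ?_)
      refine lintegral_congr_ae ?_
      filter_upwards [ae_polar_pos] with z hz
      rw [marginal, Set.indicator_of_mem (Set.mem_Ioi.2 hz)]
      rfl
    · have h1 := hmeas _ hq.measurable_radialMarginal
      have h2 := hmeas g hg.1
      simp only [asphericity]
      rw [polarMeasure, lintegral_prod _ h1.aemeasurable, lintegral_prod _ h2.aemeasurable]
      refine lintegral_mono_ae ?_
      filter_upwards [hq.ae_memLp_angular] with u hu
      exact lintegral_sq_sub_mean_le hu _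
  rw [deviation, key, integral_eq_lintegral_of_nonneg_ae
    (Filter.Eventually.of_forall fun z => sq_nonneg _) hq.memLp_asphericity.integrable_sq.1]

theorem IsSmoothDensity.deviation_eq_zero_iff (hq : IsSmoothDensity q) (hq0 : ∀ y, 0 ≤ q y)
    (hq1 : ∫⁻ y, ENNReal.ofReal (q y) = 1) :
    deviation (polarDensity q) = 0 ↔ asphericity q =ᵐ[polarMeasure (m + 2)] 0 := by
  rw [hq.deviation_eq hq0 hq1, integral_eq_zero_iff_of_nonneg (fun z => sq_nonneg _)
    hq.memLp_asphericity.integrable_sq]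
  refine Filter.eventually_congr (Filter.Eventually.of_forall fun z => ?_)
  simp

/-- Lebesgue densities are unique almost everywhere. If q(y) = g(‖y‖), then f(u,v) = u^(m+1) g(u)
does not depend on v and equals its mean over the sphere; conversely f = f_U/ω determines q off a
null set. -/
theorem IsSmoothDensity.isSpherical_iff (hq : IsSmoothDensity q) (hq0 : ∀ y, 0 ≤ q y)
    (hq1 : ∫⁻ y, ENNReal.ofReal (q y) = 1) :
    IsSpherical (volume.withDensity fun y => ENNReal.ofReal (q y)) ↔
      asphericity q =ᵐ[polarMeasure (m + 2)] 0 := by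
  have hω : 0 < sphereArea (m + 2) := sphereArea_pos (by omega)
  constructor
  · rintro ⟨g, hg, h⟩
    have hg' : Measurable fun y : Euc (m + 2) => g ‖y‖ := hg.comp measurable_norm
    have h1 : ∀ᵐ y : Euc (m + 2), y ∈ {y | ENNReal.ofReal (q y) = g ‖y‖} :=
      (withDensity_eq_iff hq.measurable.ennreal_ofReal.aemeasurable hg'.aemeasurable
        (by rw [hq1]; exact ENNReal.one_ne_top)).1 h
    rw [ae_iff_ae_polar (by omega)
      (measurableSet_eq_fun hq.measurable.ennreal_ofReal hg')] at h1
    have h2 : ∀ᵐ z ∂(polarMeasure (m + 2)),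
        polarDensity q z.1 z.2 = z.1 ^ (m + 1) * (g z.1).toReal := by
      filter_upwards [h1, ae_polar_pos] with z hz hz0
      have hz' : ENNReal.ofReal (q (z.1 • (z.2 : Euc (m + 2)))) = g ‖z.1 • (z.2 : Euc (m + 2))‖ := hz
      have hn : ‖z.1 • (z.2 : Euc (m + 2))‖ = z.1 := by
        rw [norm_smul, Real.norm_of_nonneg hz0.le]
        simp
      rw [hn] at hz'
      rw [polarDensity, ← hz', ENNReal.toReal_ofReal (hq0 _)]
      rfl
    have h3 : ∀ᵐ u ∂(volume.restrict (Set.Ioi (0 : ℝ))), ∀ᵐ v : Sph (m + 2) ∂(sphereMeasure (m + 2)),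
        polarDensity q u v = u ^ (m + 1) * (g u).toReal := Measure.ae_ae_of_ae_prod h2
    have h4 : ∀ᵐ u ∂(volume.restrict (Set.Ioi (0 : ℝ))),
        radialMarginal (polarDensity q) u = sphereArea (m + 2) * (u ^ (m + 1) * (g u).toReal) := by
      filter_upwards [h3] with u hu
      rw [radialMarginal, integral_congr_ae hu, integral_const_sphere]
    have h5 : ∀ᵐ z ∂(polarMeasure (m + 2)), radialMarginal (polarDensity q) z.1 =
        sphereArea (m + 2) * (z.1 ^ (m + 1) * (g z.1).toReal) :=
      Measure.quasiMeasurePreserving_fst.ae h4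
    filter_upwards [h2, h5] with z hz1 hz2
    rw [asphericity, hz1, hz2, Pi.zero_apply]
    field_simp
    ring
  · intro h
    -- The radial profile is recovered by dividing f_U/ω by the Jacobian r^(m+1).
    set g : ℝ → ENNReal := fun r => ENNReal.ofReal
      (radialMarginal (polarDensity q) r * (sphereArea (m + 2))⁻¹ / r ^ (m + 1)) with hgdef
    have hg : Measurable g :=
      ((hq.measurable_radialMarginal.mul_const _).div (measurable_id.pow_const _)).ennreal_ofReal
    have hg' : Measurable fun y : Euc (m + 2) => g ‖y‖ := hg.comp measurable_norm
    refine ⟨g, hg, withDensity_congr_ae ?_⟩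
    have h1 : ∀ᵐ y : Euc (m + 2), y ∈ {y | ENNReal.ofReal (q y) = g ‖y‖} := by
      rw [ae_iff_ae_polar (by omega) (measurableSet_eq_fun hq.measurable.ennreal_ofReal hg')]
      filter_upwards [h, ae_polar_pos] with z hz hz0
      have hn : ‖z.1 • (z.2 : Euc (m + 2))‖ = z.1 := by
        rw [norm_smul, Real.norm_of_nonneg hz0.le]
        simp
      have hz' : polarDensity q z.1 z.2 =
          radialMarginal (polarDensity q) z.1 * (sphereArea (m + 2))⁻¹ := sub_eq_zero.1 hz
      have hp : (0 : ℝ) < z.1 ^ (m + 1) := pow_pos hz0 _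
      change ENNReal.ofReal (q (z.1 • (z.2 : Euc (m + 2)))) = g ‖z.1 • (z.2 : Euc (m + 2))‖
      rw [hn, hgdef]
      simp only []
      rw [← hz', polarDensity, show m + 2 - 1 = m + 1 from rfl, mul_div_cancel_left₀ _ hp.ne']
    exact h1

end

/-! ### Expectations of pair kernels as averages of correlations -/

noncomputable section

variable {m : ℕ} {q : Euc (m + 2) → ℝ}

theorem lintegral_polar_pair {p : ℕ} {H : ℝ → ℝ → Sph p → Sph p → ENNReal}
    (hH : Measurable fun w : (ℝ × ℝ) × (Sph p × Sph p) => H w.1.1 w.1.2 w.2.1 w.2.2) :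
    ∫⁻ z, ∫⁻ z', H z.1 z'.1 z.2 z'.2 ∂(polarMeasure p) ∂(polarMeasure p) =
      ∫⁻ u in Set.Ioi (0 : ℝ), ∫⁻ u' in Set.Ioi (0 : ℝ),
        ∫⁻ v, ∫⁻ v', H u u' v v' ∂(sphereMeasure p) ∂(sphereMeasure p) := by
  have h1 : Measurable fun w : (ℝ × Sph p) × (ℝ × Sph p) => H w.1.1 w.2.1 w.1.2 w.2.2 :=
    hH.comp (by fun_prop : Measurable fun w : (ℝ × Sph p) × (ℝ × Sph p) =>
      ((w.1.1, w.2.1), (w.1.2, w.2.2)))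
  have h2 : Measurable fun z : ℝ × Sph p => ∫⁻ z', H z.1 z'.1 z.2 z'.2 ∂(polarMeasure p) :=
    h1.lintegral_prod_right'
  rw [polarMeasure, lintegral_prod _ (by rw [← polarMeasure]; exact h2.aemeasurable)]
  refine lintegral_congr fun u => ?_
  have h3 : Measurable fun w : Sph p × ℝ => ∫⁻ v', H u w.2 w.1 v' ∂(sphereMeasure p) :=
    Measurable.lintegral_prod_right' (f := fun w : (Sph p × ℝ) × Sph p => H u w.1.2 w.1.1 w.2)
      (hH.comp (by fun_prop : Measurable fun w : (Sph p × ℝ) × Sph p =>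
        ((u, w.1.2), (w.1.1, w.2))))
  refine Eq.trans ?_ (lintegral_lintegral_swap h3.aemeasurable)
  refine lintegral_congr fun v => ?_
  rw [lintegral_prod _ ?_]
  exact (h1.comp (by fun_prop : Measurable fun z' : ℝ × Sph p => ((u, v), z'))).aemeasurable

theorem setLIntegral_Ioi_eq {φ : ℝ → ENNReal} (h : ∀ u ≤ 0, φ u = 0) :
    ∫⁻ u in Set.Ioi (0 : ℝ), φ u = ∫⁻ u, φ u := by
  rw [← lintegral_indicator measurableSet_Ioi]
  refine lintegral_congr fun u => ?_
  by_cases hu : u ∈ Set.Ioi (0 : ℝ)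
  · rw [Set.indicator_of_mem hu]
  · rw [Set.indicator_of_notMem hu, h u (not_lt.1 hu)]

/-- Tonelli and the substitution x = u - u'. -/
theorem lintegral_sub_mul {a : ℝ → ENNReal} (ha : Measurable a) {Z : ℝ → ℝ → ENNReal}
    (hZ : Measurable Z.uncurry) :
    ∫⁻ u, ∫⁻ u', a (u - u') * Z u u' = ∫⁻ x, a x * ∫⁻ u, Z (u + x) u := by
  have h1 : Measurable fun w : ℝ × ℝ => a (w.1 - w.2) * Z w.1 w.2 :=
    (ha.comp (measurable_fst.sub measurable_snd)).mul hZ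
  rw [lintegral_lintegral_swap h1.aemeasurable]
  have h2 : ∀ u', ∫⁻ u, a (u - u') * Z u u' = ∫⁻ x, a x * Z (u' + x) u' := fun u' => by
    rw [← lintegral_add_left_eq_self (fun u => a (u - u') * Z u u') u']
    simp only [add_sub_cancel_left]
  have h3 : Measurable fun w : ℝ × ℝ => Z (w.1 + w.2) w.1 :=
    hZ.comp ((measurable_fst.add measurable_snd).prodMk measurable_fst)
  have h4 : Measurable fun w : ℝ × ℝ => a w.2 * Z (w.1 + w.2) w.1 :=
    (ha.comp measurable_snd).mul h3
  simp only [h2]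
  rw [lintegral_lintegral_swap h4.aemeasurable]
  refine lintegral_congr fun x => ?_
  rw [lintegral_const_mul]
  exact h3.comp (measurable_id.prodMk measurable_const)

theorem inner_direction {y y' : Euc (m + 2)} {u u' : ℝ} (hu : 0 < u) (hu' : 0 < u')
    {v v' : Sph (m + 2)} (hy : y = u • (v : Euc (m + 2))) (hy' : y' = u' • (v' : Euc (m + 2))) :
    ‖y‖ - ‖y'‖ = u - u' ∧ inner ℝ (‖y‖⁻¹ • y) (‖y'‖⁻¹ • y') = inner ℝ (v : Euc (m + 2)) v' := by
  have h1 : ‖y‖ = u := by rw [hy, norm_smul, Real.norm_of_nonneg hu.le]; simp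
  have h2 : ‖y'‖ = u' := by rw [hy', norm_smul, Real.norm_of_nonneg hu'.le]; simp
  rw [h1, h2, hy, hy', smul_smul, smul_smul, inv_mul_cancel₀ hu.ne', inv_mul_cancel₀ hu'.ne',
    one_smul, one_smul]
  exact ⟨rfl, rfl⟩

theorem lintegral_withDensity_pair {p : ℕ} (hp : 1 ≤ p) {q : Euc p → ℝ} (hq : Measurable q)
    {φ : Euc p → Euc p → ENNReal} (hφ : Measurable φ.uncurry) :
    ∫⁻ y, ∫⁻ y', φ y y' ∂(volume.withDensity fun y => ENNReal.ofReal (q y))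
        ∂(volume.withDensity fun y => ENNReal.ofReal (q y)) =
      ∫⁻ z, ∫⁻ z', ENNReal.ofReal (polarDensity q z.1 z.2) *
        (ENNReal.ofReal (polarDensity q z'.1 z'.2) * φ (z.1 • (z.2 : Euc p)) (z'.1 • (z'.2 : Euc p)))
        ∂(polarMeasure p) ∂(polarMeasure p) := by
  have h1 : Measurable fun y => ∫⁻ y', φ y y' ∂(volume.withDensity fun y => ENNReal.ofReal (q y)) :=
    hφ.lintegral_prod_right'
  have h2 : ∀ y, Measurable (φ y) := fun y => hφ.comp measurable_prodMk_left
  rw [lintegral_withDensity_polar hp hq h1]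
  refine lintegral_congr fun z => ?_
  rw [lintegral_withDensity_polar hp hq (h2 _), lintegral_const_mul' _ _ ENNReal.ofReal_ne_top]

theorem measurable_inner_direction {p : ℕ} :
    Measurable fun w : Euc p × Euc p => inner ℝ (‖w.1‖⁻¹ • w.1) (‖w.2‖⁻¹ • w.2) := by
  have hd : Measurable fun y : Euc p => ‖y‖⁻¹ • y := (measurable_norm.inv).smul measurable_id
  exact (hd.comp measurable_fst).inner (hd.comp measurable_snd)

theorem lintegral_pair_polar (hq : IsSmoothDensity q)
    {a b : ℝ → ENNReal} (ha : Measurable a) (hb : Measurable b) :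
    ∫⁻ y, ∫⁻ y', a (‖y‖ - ‖y'‖) * b (inner ℝ (‖y‖⁻¹ • y) (‖y'‖⁻¹ • y'))
        ∂(volume.withDensity fun y => ENNReal.ofReal (q y))
        ∂(volume.withDensity fun y => ENNReal.ofReal (q y)) =
      ∫⁻ u in Set.Ioi (0 : ℝ), ∫⁻ u' in Set.Ioi (0 : ℝ),
        ∫⁻ v : Sph (m + 2), ∫⁻ v' : Sph (m + 2), ENNReal.ofReal (polarDensity q u v) *
          (ENNReal.ofReal (polarDensity q u' v') * (a (u - u') * b (inner ℝ (v : Euc (m + 2)) v')))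
        ∂(sphereMeasure (m + 2)) ∂(sphereMeasure (m + 2)) := by
  have hn : Measurable fun w : Euc (m + 2) × Euc (m + 2) => ‖w.1‖ - ‖w.2‖ := by fun_prop
  have hm : Measurable (fun y y' : Euc (m + 2) =>
      a (‖y‖ - ‖y'‖) * b (inner ℝ (‖y‖⁻¹ • y) (‖y'‖⁻¹ • y'))).uncurry :=
    (ha.comp hn).mul (hb.comp measurable_inner_direction)
  have hH : Measurable fun w : (ℝ × ℝ) × (Sph (m + 2) × Sph (m + 2)) =>
      ENNReal.ofReal (polarDensity q w.1.1 w.2.1) * (ENNReal.ofReal (polarDensity q w.1.2 w.2.2) *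
        (a (w.1.1 - w.1.2) * b (inner ℝ (w.2.1 : Euc (m + 2)) w.2.2))) := by
    have hv : Measurable fun w : (ℝ × ℝ) × (Sph (m + 2) × Sph (m + 2)) =>
        (w.2.1 : Euc (m + 2)) := measurable_subtype_coe.comp (by fun_prop)
    have hv' : Measurable fun w : (ℝ × ℝ) × (Sph (m + 2) × Sph (m + 2)) =>
        (w.2.2 : Euc (m + 2)) := measurable_subtype_coe.comp (by fun_prop)
    have h1 : Measurable fun w : (ℝ × ℝ) × (Sph (m + 2) × Sph (m + 2)) => w.1.1 := by fun_prop
    have h2 : Measurable fun w : (ℝ × ℝ) × (Sph (m + 2) × Sph (m + 2)) => w.1.2 := by fun_prop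
    have h3 : Measurable fun w : (ℝ × ℝ) × (Sph (m + 2) × Sph (m + 2)) =>
      inner ℝ (w.2.1 : Euc (m + 2)) (w.2.2 : Euc (m + 2)) := hv.inner hv'
    exact (hq.measurable_polarDensity h1 hv).ennreal_ofReal.mul
      ((hq.measurable_polarDensity h2 hv').ennreal_ofReal.mul
        ((ha.comp (h1.sub h2)).mul (hb.comp h3)))
  rw [lintegral_withDensity_pair (by omega) hq.measurable hm,
    ← lintegral_polar_pair (p := m + 2) (H := fun u u' v v' =>
    ENNReal.ofReal (polarDensity q u v) * (ENNReal.ofReal (polarDensity q u' v') *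
      (a (u - u') * b (inner ℝ (v : Euc (m + 2)) v')))) hH]
  refine lintegral_congr_ae ?_
  filter_upwards [ae_polar_pos] with z hz
  refine lintegral_congr_ae ?_
  filter_upwards [ae_polar_pos] with z' hz'
  obtain ⟨e1, e2⟩ := inner_direction hz hz' (v := z.2) (v' := z'.2) rfl rfl
  rw [e1, e2]

theorem liftDensity_nonneg (hq0 : ∀ y, 0 ≤ q y) (z : ℝ × OG (m + 2)) : 0 ≤ liftDensity q z := by
  obtain ⟨u, g⟩ := z
  rcases le_or_gt u 0 with hu | hu
  · rw [liftDensity, lift_of_nonpos _ hu]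
  · rw [liftDensity, lift_of_pos _ hu]
    exact polarDensity_nonneg hq0 hu.le _

/-- Evenness in x allows the translation to act on one factor and the rotation on the other, the
form in which the pair integral arrives. -/
theorem ofReal_correlation (hq : IsSmoothDensity q) (hq0 : ∀ y, 0 ≤ q y) (x θ : ℝ) :
    ENNReal.ofReal (correlation q x θ) = ∫⁻ u, ∫⁻ g, ENNReal.ofReal (liftDensity q (u + x, g)) *
      ENNReal.ofReal (liftDensity q (u, g * rot m θ)) ∂(orthMeasure (m + 2)) := by
  have h := hq.correlation_eq x 0 0 θ
  rw [zero_sub, sub_zero, hq.correlation_neg_left] at h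
  have hi : Integrable (fun z => liftDensity q (shift x (spin m 0 z)) *
      liftDensity q (shift 0 (spin m θ z))) (volume.prod (orthMeasure (m + 2))) :=
    (hq.memLp_comp x 0).integrable_mul (hq.memLp_comp 0 θ)
  rw [← h, ofReal_integral_eq_lintegral_ofReal hi
    (Filter.Eventually.of_forall fun z => mul_nonneg (liftDensity_nonneg hq0 _)
      (liftDensity_nonneg hq0 _)), lintegral_prod _ hi.1.aemeasurable.ennreal_ofReal]
  refine lintegral_congr fun u => lintegral_congr fun g => ?_
  rw [ENNReal.ofReal_mul (liftDensity_nonneg hq0 _)]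
  simp only [shift, spin, rot_zero, mul_one, add_zero]

/-- The average over frames of the product of the densities at two points at a given angle. -/
def frameCorrelation (q : Euc (m + 2) → ℝ) (u u' θ : ℝ) : ENNReal :=
  ∫⁻ g, ENNReal.ofReal (liftDensity q (u, g)) *
    ENNReal.ofReal (liftDensity q (u', g * rot m θ)) ∂(orthMeasure (m + 2))

theorem IsSmoothDensity.measurable_liftDensity_rot (hq : IsSmoothDensity q) (u u' θ : ℝ) :
    Measurable fun g : OG (m + 2) => ENNReal.ofReal (liftDensity q (u, g)) *
      ENNReal.ofReal (liftDensity q (u', g * rot m θ)) := by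
  have hΦ := hq.measurable_liftDensity.ennreal_ofReal
  have h1 : Measurable fun g : OG (m + 2) => (u, g) := measurable_prodMk_left
  have h2 : Measurable fun g : OG (m + 2) => (θ, (u', g)) :=
    measurable_const.prodMk (measurable_const.prodMk measurable_id)
  exact (hΦ.comp h1).mul (hΦ.comp ((isFlow_spin m).measurable.comp h2))

theorem IsSmoothDensity.measurable_frameCorrelation (hq : IsSmoothDensity q) :
    Measurable fun w : (ℝ × ℝ) × ℝ => frameCorrelation q w.1.1 w.1.2 w.2 := by
  have hΦ := hq.measurable_liftDensity.ennreal_ofReal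
  have h1 : Measurable fun w : ((ℝ × ℝ) × ℝ) × OG (m + 2) => (w.1.1.1, w.2) := by fun_prop
  have h2 : Measurable fun w : ((ℝ × ℝ) × ℝ) × OG (m + 2) => (w.1.2, (w.1.1.2, w.2)) := by fun_prop
  have h3 : Measurable fun w : ((ℝ × ℝ) × ℝ) × OG (m + 2) =>
      ENNReal.ofReal (liftDensity q (w.1.1.1, w.2)) *
        ENNReal.ofReal (liftDensity q ((spin m).uncurry (w.1.2, (w.1.1.2, w.2)))) :=
    (hΦ.comp h1).mul (hΦ.comp ((isFlow_spin m).measurable.comp h2))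
  exact h3.lintegral_prod_right'

theorem frameCorrelation_eq_zero {u u' : ℝ} (θ : ℝ) (h : u ≤ 0 ∨ u' ≤ 0) :
    frameCorrelation q u u' θ = 0 := by
  rw [frameCorrelation]
  rcases h with h | h <;> simp [liftDensity, lift_of_nonpos _ h]

/-- The average of `frameCorrelation` against a weight on the angle. -/
def weightedCorrelation (q : Euc (m + 2) → ℝ) (B : ℝ → ENNReal) (u u' : ℝ) : ENNReal :=
  ∫⁻ θ in Set.Ioo 0 Real.pi, B θ * frameCorrelation q u u' θ

theorem IsSmoothDensity.measurable_weightedCorrelation (hq : IsSmoothDensity q)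
    {B : ℝ → ENNReal} (hB : Measurable B) : Measurable (weightedCorrelation q B).uncurry := by
  have h : Measurable fun w : (ℝ × ℝ) × ℝ => B w.2 * frameCorrelation q w.1.1 w.1.2 w.2 :=
    (hB.comp measurable_snd).mul hq.measurable_frameCorrelation
  exact h.lintegral_prod_right'

theorem weightedCorrelation_eq_zero {B : ℝ → ENNReal} {u u' : ℝ} (h : u ≤ 0 ∨ u' ≤ 0) :
    weightedCorrelation q B u u' = 0 := by
  simp only [weightedCorrelation, frameCorrelation_eq_zero _ h, mul_zero, lintegral_zero]

theorem inner_col_mul_rot (g : OG (m + 2)) (θ : ℝ) :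
    inner ℝ (col g 0) (col (g * rot m θ) 0) = Real.cos θ := by
  rw [col_mul_rot_zero, inner_add_right, inner_smul_right, inner_smul_right, inner_col, inner_col]
  simp

theorem lintegral_sphere_polarDensity (hq : IsSmoothDensity q) {b : ℝ → ENNReal} (hb : Measurable b)
    (c : ENNReal) {u u' : ℝ} (hu : 0 < u) (hu' : 0 < u') :
    ∫⁻ v : Sph (m + 2), ∫⁻ v' : Sph (m + 2), ENNReal.ofReal (polarDensity q u v) *
          (ENNReal.ofReal (polarDensity q u' v') * (c * b (inner ℝ (v : Euc (m + 2)) v')))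
        ∂(sphereMeasure (m + 2)) ∂(sphereMeasure (m + 2)) =
      ENNReal.ofReal (sphereArea (m + 2)) * (ENNReal.ofReal (sphereArea (m + 1)) *
        (c * weightedCorrelation q
          (fun θ => b (Real.cos θ) * ENNReal.ofReal (Real.sin θ ^ m)) u u')) := by
  have hm1 : Measurable (fun v w : Euc (m + 2) => ENNReal.ofReal (polarDensity q u v) *
      (ENNReal.ofReal (polarDensity q u' w) * (c * b (inner ℝ v w)))).uncurry :=
    (hq.measurable_polarDensity measurable_const measurable_fst).ennreal_ofReal.mul
      ((hq.measurable_polarDensity measurable_const measurable_snd).ennreal_ofReal.mul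
        ((hb.comp (measurable_fst.inner measurable_snd)).const_mul _))
  have hm2 : Measurable fun θ : ℝ => b (Real.cos θ) * ENNReal.ofReal (Real.sin θ ^ m) *
      frameCorrelation q u u' θ := by
    refine ((hb.comp Real.measurable_cos).mul
      (Real.measurable_sin.pow_const m).ennreal_ofReal).mul ?_
    exact hq.measurable_frameCorrelation.comp
      (measurable_const.prodMk measurable_id : Measurable fun θ : ℝ => ((u, u'), θ))
  rw [lintegral_sphere_pair (fun v w => ENNReal.ofReal (polarDensity q u v) *
      (ENNReal.ofReal (polarDensity q u' w) * (c * b (inner ℝ v w)))) hm1, weightedCorrelation,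
    ← lintegral_const_mul _ hm2]
  congr 2
  refine lintegral_congr fun θ => ?_
  have h1 : ∀ g : OG (m + 2), ENNReal.ofReal (polarDensity q u (col g 0)) *
      (ENNReal.ofReal (polarDensity q u' (col (g * rot m θ) 0)) *
        (c * b (inner ℝ (col g 0) (col (g * rot m θ) 0)))) =
      (c * b (Real.cos θ)) * (ENNReal.ofReal (liftDensity q (u, g)) *
        ENNReal.ofReal (liftDensity q (u', g * rot m θ))) := by
    intro g
    rw [inner_col_mul_rot, liftDensity, lift_of_pos _ hu, lift_of_pos _ hu']
    simp only [coe_colS]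
    ring
  rw [lintegral_congr h1, lintegral_const_mul _ (hq.measurable_liftDensity_rot u u' θ),
    frameCorrelation]
  ring

theorem lintegral_frameCorrelation (hq : IsSmoothDensity q) (hq0 : ∀ y, 0 ≤ q y) (x θ : ℝ) :
    ∫⁻ u, frameCorrelation q (u + x) u θ = ENNReal.ofReal (correlation q x θ) :=
  (ofReal_correlation hq hq0 x θ).symm

attribute [local irreducible] frameCorrelation

theorem lintegral_weightedCorrelation (hq : IsSmoothDensity q) (hq0 : ∀ y, 0 ≤ q y)
    {B : ℝ → ENNReal} (hB : Measurable B) (x : ℝ) :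
    ∫⁻ u, weightedCorrelation q B (u + x) u =
      ∫⁻ θ in Set.Ioo 0 Real.pi, B θ * ENNReal.ofReal (correlation q x θ) := by
  have h1 : Measurable fun w : ℝ × ℝ => ((w.1 + x, w.1), w.2) := by fun_prop
  have h2 : Measurable fun w : ℝ × ℝ => frameCorrelation q (w.1 + x) w.1 w.2 := by
    exact hq.measurable_frameCorrelation.comp h1
  have h3 : Measurable (fun u θ : ℝ => B θ * frameCorrelation q (u + x) u θ).uncurry := by
    exact (hB.comp measurable_snd).mul h2
  have h4 : ∀ θ : ℝ, Measurable fun u : ℝ => frameCorrelation q (u + x) u θ := fun θ => by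
    exact h2.comp (measurable_prodMk_right : Measurable fun u : ℝ => (u, θ))
  have h5 := lintegral_lintegral_swap (μ := volume) (ν := volume.restrict (Set.Ioo 0 Real.pi))
    h3.aemeasurable
  have h6 : ∀ θ, ∫⁻ u, B θ * frameCorrelation q (u + x) u θ =
      B θ * ENNReal.ofReal (correlation q x θ) := fun θ => by
    rw [lintegral_const_mul _ (h4 θ)]
    rw [lintegral_frameCorrelation hq hq0]
  have h7 := lintegral_congr (μ := volume.restrict (Set.Ioo 0 Real.pi)) h6
  simp only [weightedCorrelation]
  exact h5.trans h7

attribute [local irreducible] weightedCorrelation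

/-- For fixed radii the pair of directions is integrated through frames at angle θ; then u - u' is
the new variable. Working with extended nonnegative integrals, Tonelli needs no integrability. -/
theorem lintegral_pair (hq : IsSmoothDensity q) (hq0 : ∀ y, 0 ≤ q y)
    {a b : ℝ → ENNReal} (ha : Measurable a) (hb : Measurable b) :
    ∫⁻ y, ∫⁻ y', a (‖y‖ - ‖y'‖) * b (inner ℝ (‖y‖⁻¹ • y) (‖y'‖⁻¹ • y'))
        ∂(volume.withDensity fun y => ENNReal.ofReal (q y))
        ∂(volume.withDensity fun y => ENNReal.ofReal (q y)) =
      ENNReal.ofReal (sphereArea (m + 2)) * (ENNReal.ofReal (sphereArea (m + 1)) *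
        ∫⁻ x, a x * ∫⁻ θ in Set.Ioo 0 Real.pi, b (Real.cos θ) * ENNReal.ofReal (Real.sin θ ^ m) *
          ENNReal.ofReal (correlation q x θ)) := by
  have hB : Measurable fun θ => b (Real.cos θ) * ENNReal.ofReal (Real.sin θ ^ m) :=
    (hb.comp Real.measurable_cos).mul (Real.measurable_sin.pow_const m).ennreal_ofReal
  rw [lintegral_pair_polar hq ha hb]
  have h1 : ∀ u ∈ Set.Ioi (0 : ℝ), ∫⁻ u' in Set.Ioi (0 : ℝ), ∫⁻ v : Sph (m + 2),
      ∫⁻ v' : Sph (m + 2), ENNReal.ofReal (polarDensity q u v) *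
          (ENNReal.ofReal (polarDensity q u' v') * (a (u - u') * b (inner ℝ (v : Euc (m + 2)) v')))
        ∂(sphereMeasure (m + 2)) ∂(sphereMeasure (m + 2)) =
      ENNReal.ofReal (sphereArea (m + 2)) * (ENNReal.ofReal (sphereArea (m + 1)) *
        ∫⁻ u', a (u - u') * weightedCorrelation q
          (fun θ => b (Real.cos θ) * ENNReal.ofReal (Real.sin θ ^ m)) u u') := by
    intro u hu
    rw [setLIntegral_congr_fun measurableSet_Ioi
        fun u' hu' => lintegral_sphere_polarDensity hq hb (a (u - u')) hu hu',
      lintegral_const_mul' _ _ ENNReal.ofReal_ne_top,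
      lintegral_const_mul' _ _ ENNReal.ofReal_ne_top, setLIntegral_Ioi_eq]
    intro u' hu'
    rw [weightedCorrelation_eq_zero (Or.inr hu'), mul_zero]
  rw [setLIntegral_congr_fun measurableSet_Ioi h1,
    lintegral_const_mul' _ _ ENNReal.ofReal_ne_top,
    lintegral_const_mul' _ _ ENNReal.ofReal_ne_top, setLIntegral_Ioi_eq,
    lintegral_sub_mul ha (hq.measurable_weightedCorrelation hB)]
  · simp only [lintegral_weightedCorrelation hq hq0 hB]
  · intro u hu
    simp only [weightedCorrelation_eq_zero (Or.inl hu), mul_zero, lintegral_zero]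

/-- The correlation of the marginal density with its translate. -/
def marginalCorrelation (q : Euc (m + 2) → ℝ) (x : ℝ) : ℝ := ∫ u, marginal q u * marginal q (u + x)

theorem IsSmoothDensity.memLp_marginal_shift (hq : IsSmoothDensity q) (x : ℝ) :
    MemLp (fun u => marginal q (u + x)) 2 volume :=
  hq.isHalfLine_marginal.memLp.comp_measurePreserving (measurePreserving_add_right volume x)

/-- Without an angular kernel the two directions integrate out separately and leave the marginals.
-/
theorem lintegral_pair_norm (hq : IsSmoothDensity q) (hq0 : ∀ y, 0 ≤ q y)
    {a : ℝ → ENNReal} (ha : Measurable a) :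
    ∫⁻ y, ∫⁻ y', a (‖y‖ - ‖y'‖)
        ∂(volume.withDensity fun y => ENNReal.ofReal (q y))
        ∂(volume.withDensity fun y => ENNReal.ofReal (q y)) =
      ∫⁻ x, a x * ENNReal.ofReal (marginalCorrelation q x) := by
  have h := lintegral_pair_polar hq ha (b := fun _ => 1) measurable_const
  simp only [mul_one] at h
  rw [h]
  have hF : Measurable (marginal q) := hq.measurable_radialMarginal.indicator measurableSet_Ioi
  have hp : ∀ u, Measurable fun v : Sph (m + 2) => ENNReal.ofReal (polarDensity q u v) := fun u =>
    (hq.measurable_polarDensity measurable_const measurable_subtype_coe).ennreal_ofReal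
  have h1 : ∀ᵐ u ∂(volume.restrict (Set.Ioi (0 : ℝ))), ∫⁻ u' in Set.Ioi (0 : ℝ),
      ∫⁻ v : Sph (m + 2), ∫⁻ v' : Sph (m + 2), ENNReal.ofReal (polarDensity q u v) *
          (ENNReal.ofReal (polarDensity q u' v') * a (u - u'))
        ∂(sphereMeasure (m + 2)) ∂(sphereMeasure (m + 2)) =
      ∫⁻ u', a (u - u') * (ENNReal.ofReal (marginal q u) * ENNReal.ofReal (marginal q u')) := by
    filter_upwards [hq.ae_lintegral_angular hq0, ae_restrict_mem measurableSet_Ioi] with u hu hu0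
    rw [← setLIntegral_Ioi_eq]
    · refine lintegral_congr_ae ?_
      filter_upwards [hq.ae_lintegral_angular hq0, ae_restrict_mem measurableSet_Ioi] with u' hu' hu0'
      have h2 : ∀ v : Sph (m + 2), ∫⁻ v' : Sph (m + 2), ENNReal.ofReal (polarDensity q u v) *
          (ENNReal.ofReal (polarDensity q u' v') * a (u - u')) ∂(sphereMeasure (m + 2)) =
          ENNReal.ofReal (polarDensity q u v) * (ENNReal.ofReal (marginal q u') * a (u - u')) := by
        intro v
        rw [lintegral_const_mul _ ((hp u').mul_const _), lintegral_mul_const _ (hp u'), hu', marginal,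
          Set.indicator_of_mem hu0']
      simp only [h2]
      rw [lintegral_mul_const _ (hp u), hu, marginal, Set.indicator_of_mem hu0]
      ring
    · intro u' hu'
      rw [marginal, Set.indicator_of_notMem (s := Set.Ioi 0) (a := u') (by simpa using hu')]
      simp
  rw [lintegral_congr_ae h1, setLIntegral_Ioi_eq, lintegral_sub_mul ha
    (Z := fun u u' => ENNReal.ofReal (marginal q u) * ENNReal.ofReal (marginal q u'))
    (((hF.comp measurable_fst).ennreal_ofReal).mul (hF.comp measurable_snd).ennreal_ofReal)]
  · refine lintegral_congr fun x => ?_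
    congr 1
    have hi : Integrable fun u => marginal q u * marginal q (u + x) :=
      hq.isHalfLine_marginal.memLp.integrable_mul (hq.memLp_marginal_shift x)
    rw [marginalCorrelation, ofReal_integral_eq_lintegral_ofReal hi
      (Filter.Eventually.of_forall fun u =>
        mul_nonneg (marginal_nonneg hq0 _) (marginal_nonneg hq0 _))]
    refine lintegral_congr fun u => ?_
    rw [ENNReal.ofReal_mul (marginal_nonneg hq0 _), mul_comm]
  · intro u hu
    rw [marginal, Set.indicator_of_notMem (s := Set.Ioi 0) (a := u) (by simpa using hu)]
    simp

end

/-! ### The expectation of the estimator -/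

noncomputable section

variable {m : ℕ} {q : Euc (m + 2) → ℝ} {K : ℝ → ℝ}

/-- The probability measure with density `K`. -/
def kernelMeasure (K : ℝ → ℝ) : Measure ℝ := volume.withDensity fun x => ENNReal.ofReal (K x)

/-- The law of the angle between the mean direction and a Langevin distributed vector. -/
def angleMeasure (m : ℕ) (κ : ℝ) : Measure ℝ :=
  (volume.restrict (Set.Ioo 0 Real.pi)).withDensity fun θ =>
    ENNReal.ofReal (angleWeight m κ θ / angleMass m κ)

theorem IsKernel.integrable (hK : IsKernel K) : Integrable K := by
  -- A function that is not integrable has integral 0 by convention, not 1.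
  by_contra h
  have := hK.integral_eq_one
  rw [integral_undef h] at this
  exact zero_ne_one this

theorem IsKernel.isProbabilityMeasure (hK : IsKernel K) :
    IsProbabilityMeasure (kernelMeasure K) := by
  refine ⟨?_⟩
  rw [kernelMeasure, withDensity_apply _ MeasurableSet.univ, Measure.restrict_univ,
    ← ofReal_integral_eq_lintegral_ofReal hK.integrable (Filter.Eventually.of_forall hK.nonneg),
    hK.integral_eq_one, ENNReal.ofReal_one]

theorem IsKernel.ae_abs_le (hK : IsKernel K) : ∀ᵐ s ∂(kernelMeasure K), |s| ≤ 1 := by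
  rw [kernelMeasure, ae_withDensity_iff hK.measurable.ennreal_ofReal]
  refine Filter.Eventually.of_forall fun s hs => ?_
  have h : s ∈ Function.support K := fun h0 => hs (by rw [h0, ENNReal.ofReal_zero])
  have := hK.support_subset h
  exact abs_le.2 ⟨this.1.le, this.2.le⟩

theorem IsKernel.integral_kernelMeasure (hK : IsKernel K) (a : ℝ → ℝ) :
    ∫ s, a s ∂(kernelMeasure K) = ∫ s, K s * a s := by
  rw [kernelMeasure, integral_withDensity_eq_integral_toReal_smul hK.measurable.ennreal_ofReal
    (Filter.Eventually.of_forall fun _ => ENNReal.ofReal_lt_top)]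
  refine integral_congr_ae (Filter.Eventually.of_forall fun s => ?_)
  simp only [ENNReal.toReal_ofReal (hK.nonneg s), smul_eq_mul]

theorem IsKernel.integral_sq (hK : IsKernel K) :
    ∫ s, s ^ 2 ∂(kernelMeasure K) = kernelMoment 2 K := by
  rw [hK.integral_kernelMeasure, kernelMoment, intervalIntegral.integral_of_le (by norm_num),
    ← integral_indicator measurableSet_Ioc]
  refine integral_congr_ae (Filter.Eventually.of_forall fun s => ?_)
  by_cases hs : s ∈ Set.Ioc (-1 : ℝ) 1
  · simp only [Set.indicator_of_mem hs]
    ring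
  · have h0 : K s = 0 := by
      by_contra h
      exact hs (Set.Ioo_subset_Ioc_self (hK.support_subset h))
    simp only [Set.indicator_of_notMem hs, h0, zero_mul]

theorem continuous_angleDensity (m : ℕ) (κ : ℝ) :
    Continuous fun θ => angleWeight m κ θ / angleMass m κ := (continuous_angleWeight m κ).div_const _

theorem ae_angleDensity_nonneg (m : ℕ) (κ : ℝ) :
    ∀ᵐ θ ∂(volume.restrict (Set.Ioo 0 Real.pi)), 0 ≤ angleWeight m κ θ / angleMass m κ := by
  filter_upwards [ae_restrict_mem measurableSet_Ioo] with θ hθ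
  exact div_nonneg (angleWeight_nonneg (Set.Ioo_subset_Icc_self hθ)) (angleMass_pos m κ).le

theorem integral_angleMeasure (m : ℕ) (κ : ℝ) (a : ℝ → ℝ) :
    ∫ θ, a θ ∂(angleMeasure m κ) = angleInt m κ a / angleMass m κ := by
  rw [angleMeasure, integral_withDensity_eq_integral_toReal_smul
    (continuous_angleDensity m κ).measurable.ennreal_ofReal
    (Filter.Eventually.of_forall fun _ => ENNReal.ofReal_lt_top), angleInt,
    intervalIntegral.integral_of_le Real.pi_pos.le, integral_Ioc_eq_integral_Ioo, ← integral_div]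
  refine integral_congr_ae ?_
  filter_upwards [ae_angleDensity_nonneg m κ] with θ hθ
  rw [ENNReal.toReal_ofReal hθ, smul_eq_mul]
  ring

instance (m : ℕ) (κ : ℝ) : IsProbabilityMeasure (angleMeasure m κ) := by
  have hi : Integrable (fun θ => angleWeight m κ θ / angleMass m κ)
      (volume.restrict (Set.Ioo 0 Real.pi)) :=
    ((continuous_angleDensity m κ).integrableOn_Icc (a := 0) (b := Real.pi)).mono_set
      Set.Ioo_subset_Icc_self
  refine ⟨?_⟩
  rw [angleMeasure, withDensity_apply _ MeasurableSet.univ, Measure.restrict_univ,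
    ← ofReal_integral_eq_lintegral_ofReal hi (ae_angleDensity_nonneg m κ)]
  have h : ∫ θ in Set.Ioo 0 Real.pi, angleWeight m κ θ / angleMass m κ = 1 := by
    rw [integral_div, ← integral_Ioc_eq_integral_Ioo,
      ← intervalIntegral.integral_of_le Real.pi_pos.le]
    have : angleMass m κ = ∫ θ in (0 : ℝ)..Real.pi, angleWeight m κ θ := by
      simp [angleMass, angleInt]
    rw [← this, div_self (angleMass_pos m κ).ne']
  rw [h, ENNReal.ofReal_one]

theorem ae_angleMeasure_mem (m : ℕ) (κ : ℝ) :
    ∀ᵐ θ ∂(angleMeasure m κ), θ ∈ Set.Ioo 0 Real.pi :=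
  (withDensity_absolutelyContinuous _ _).ae_le (ae_restrict_mem measurableSet_Ioo)

/-- The substitution x = hs, so that the bandwidth moves into the argument of the correlation. -/
theorem lintegral_kernel_scale (hK : IsKernel K) {h : ℝ} (hh : 0 < h) {J : ℝ → ENNReal}
    (hJ : Measurable J) :
    ∫⁻ x, ENNReal.ofReal (K (x / h) / h) * J x = ∫⁻ s, J (h * s) ∂(kernelMeasure K) := by
  have hm : Measurable fun x => ENNReal.ofReal (K (x / h) / h) * J x :=
    ((hK.measurable.comp (measurable_id.div_const h)).div_const h).ennreal_ofReal.mul hJ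
  have hs : Measurable fun s : ℝ => J (h * s) := hJ.comp (measurable_const_mul h)
  rw [kernelMeasure, lintegral_withDensity_eq_lintegral_mul _ hK.measurable.ennreal_ofReal hs]
  conv_lhs => rw [← Real.smul_map_volume_mul_left hh.ne']
  rw [lintegral_smul_measure, lintegral_map hm (measurable_const_mul h), smul_eq_mul,
    ← lintegral_const_mul' _ _ ENNReal.ofReal_ne_top]
  refine lintegral_congr fun s => ?_
  rw [Pi.mul_apply, ← mul_assoc, ← ENNReal.ofReal_mul (abs_nonneg h), abs_of_pos hh,
    mul_div_cancel_left₀ _ hh.ne', mul_div_cancel₀ _ hh.ne']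

theorem IsSmoothDensity.measurable_correlation (hq : IsSmoothDensity q) :
    Measurable fun w : ℝ × ℝ => correlation q w.1 w.2 := by
  have hΦ := hq.measurable_liftDensity
  have h1 : Measurable fun w : (ℝ × ℝ) × (ℝ × OG (m + 2)) => (w.1.2, w.2) := by fun_prop
  have h2 : Measurable fun w : (ℝ × ℝ) × (ℝ × OG (m + 2)) => (spin m).uncurry (w.1.2, w.2) :=
    (isFlow_spin m).measurable.comp h1
  have h3 : Measurable fun w : (ℝ × ℝ) × (ℝ × OG (m + 2)) =>
      shift w.1.1 ((spin m).uncurry (w.1.2, w.2)) :=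
    (h2.fst.add measurable_fst.fst).prodMk h2.snd
  have h4 : Measurable fun w : (ℝ × ℝ) × (ℝ × OG (m + 2)) =>
      liftDensity q w.2 * liftDensity q (shift w.1.1 ((spin m).uncurry (w.1.2, w.2))) :=
    (hΦ.comp measurable_snd).mul (hΦ.comp h3)
  exact h4.stronglyMeasurable.integral_prod_right'.measurable

/-- Both factors have squared norm c(0, 0). The uniform bound makes every average over the kernels
finite, hence the statistic integrable for all h and κ. -/
theorem IsSmoothDensity.abs_correlation_le (hq : IsSmoothDensity q) (x θ : ℝ) :
    |correlation q x θ| ≤ correlation q 0 0 := by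
  have h1 := abs_integral_mul_le (hq.memLp_comp 0 0) (hq.memLp_comp x θ) one_pos
  have e0 : ∫ z, liftDensity q (shift 0 (spin m 0 z)) ^ 2 ∂(volume.prod (orthMeasure (m + 2))) =
      correlation q 0 0 := by
    have := hq.correlation_eq 0 0 0 0
    simp only [sub_zero] at this
    rw [← this]
    simp only [sq]
  have e1 : ∫ z, liftDensity q (shift x (spin m θ z)) ^ 2 ∂(volume.prod (orthMeasure (m + 2))) =
      correlation q 0 0 := by
    have := hq.correlation_eq x x θ θ
    simp only [sub_self] at this
    rw [← this]
    simp only [sq]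
  have e2 := hq.correlation_eq 0 x 0 θ
  rw [sub_zero, sub_zero] at e2
  rw [e0, e1, e2] at h1
  linarith

theorem correlation_nonneg (hq0 : ∀ y, 0 ≤ q y) (x θ : ℝ) : 0 ≤ correlation q x θ :=
  integral_nonneg fun _ => mul_nonneg (liftDensity_nonneg hq0 _) (liftDensity_nonneg hq0 _)

theorem IsSmoothDensity.measurable_marginalCorrelation (hq : IsSmoothDensity q) :
    Measurable (marginalCorrelation q) := by
  have hF : Measurable (marginal q) := hq.measurable_radialMarginal.indicator measurableSet_Ioi
  have h : Measurable fun w : ℝ × ℝ => marginal q w.2 * marginal q (w.2 + w.1) :=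
    (hF.comp measurable_snd).mul (hF.comp (measurable_snd.add measurable_fst))
  exact h.stronglyMeasurable.integral_prod_right'.measurable

theorem marginalCorrelation_nonneg (hq0 : ∀ y, 0 ≤ q y) (x : ℝ) : 0 ≤ marginalCorrelation q x :=
  integral_nonneg fun _ => mul_nonneg (marginal_nonneg hq0 _) (marginal_nonneg hq0 _)

theorem IsSmoothDensity.abs_marginalCorrelation_le (hq : IsSmoothDensity q) (x : ℝ) :
    |marginalCorrelation q x| ≤ ∫ u, marginal q u ^ 2 := by
  have h1 := abs_integral_mul_le hq.isHalfLine_marginal.memLp (hq.memLp_marginal_shift x) one_pos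
  have e1 : ∫ u, marginal q (u + x) ^ 2 = ∫ u, marginal q u ^ 2 :=
    integral_add_right_eq_self (fun u => marginal q u ^ 2) x
  rw [e1] at h1
  rw [marginalCorrelation]
  linarith

attribute [local irreducible] correlation marginalCorrelation

/-- For nonnegative functions a single identity of extended integrals transfers both integrability
and the value. -/
theorem integrable_and_integral_eq {α β : Type*} [MeasurableSpace α] [MeasurableSpace β]
    {μ : Measure α} {ρ : Measure β} {a : α → ℝ} {b : β → ℝ} (ha : Measurable a) (ha0 : ∀ x, 0 ≤ a x)
    (hb : Integrable b ρ) (hb0 : ∀ x, 0 ≤ b x)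
    (h : ∫⁻ x, ENNReal.ofReal (a x) ∂μ = ∫⁻ x, ENNReal.ofReal (b x) ∂ρ) :
    Integrable a μ ∧ ∫ x, a x ∂μ = ∫ x, b x ∂ρ := by
  refine ⟨⟨ha.aestronglyMeasurable, ?_⟩, ?_⟩
  · rw [hasFiniteIntegral_iff_ofReal (Filter.Eventually.of_forall ha0), h]
    exact (hasFiniteIntegral_iff_ofReal (Filter.Eventually.of_forall hb0)).1 hb.2
  · rw [integral_eq_lintegral_of_nonneg_ae (Filter.Eventually.of_forall ha0)
        ha.aestronglyMeasurable,
      integral_eq_lintegral_of_nonneg_ae (Filter.Eventually.of_forall hb0) hb.1, h]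

/-- The kernel of the estimator of `∫∫ f²`. -/
def polarKernel (m : ℕ) (K : ℝ → ℝ) (h κ : ℝ) (w : Euc (m + 2) × Euc (m + 2)) : ℝ :=
  K ((‖w.1‖ - ‖w.2‖) / h) / h *
    (Real.exp (κ * inner ℝ (‖w.1‖⁻¹ • w.1) (‖w.2‖⁻¹ • w.2)) /
      (sphereArea (m + 1) * angleMass m κ))

/-- The kernel of the estimator of `∫ f_U²`. -/
def radialKernel (m : ℕ) (K : ℝ → ℝ) (h : ℝ) (w : Euc (m + 2) × Euc (m + 2)) : ℝ :=
  K ((‖w.1‖ - ‖w.2‖) / h) / h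

theorem measurable_radialKernel (hK : IsKernel K) (h : ℝ) : Measurable (radialKernel m K h) := by
  have h1 : Measurable fun w : Euc (m + 2) × Euc (m + 2) => (‖w.1‖ - ‖w.2‖) / h := by fun_prop
  exact (hK.measurable.comp h1).div_const h

theorem measurable_polarKernel (hK : IsKernel K) (h κ : ℝ) : Measurable (polarKernel m K h κ) :=
  (measurable_radialKernel hK h).mul
    ((Real.measurable_exp.comp (measurable_inner_direction.const_mul κ)).div_const _)

theorem radialKernel_nonneg (hK : IsKernel K) {h : ℝ} (hh : 0 < h) (w : Euc (m + 2) × Euc (m + 2)) :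
    0 ≤ radialKernel m K h w := div_nonneg (hK.nonneg _) hh.le

theorem polarKernel_nonneg (hK : IsKernel K) {h : ℝ} (hh : 0 < h) (κ : ℝ)
    (w : Euc (m + 2) × Euc (m + 2)) : 0 ≤ polarKernel m K h κ w := by
  have h1 : 0 < sphereArea (m + 1) := sphereArea_pos (by omega)
  have h2 := angleMass_pos m κ
  exact mul_nonneg (div_nonneg (hK.nonneg _) hh.le) (by positivity)

/-- The factor sphereArea (m+1) of the angular integration cancels the one in the kernel. What
remains is the normalized angle law, and a factor sphereArea (m+2) is left over. -/
theorem lintegral_polarKernel (hq : IsSmoothDensity q) (hq0 : ∀ y, 0 ≤ q y) (hK : IsKernel K)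
    {h : ℝ} (hh : 0 < h) (κ : ℝ) :
    ∫⁻ w, ENNReal.ofReal (polarKernel m K h κ w)
        ∂((volume.withDensity fun y => ENNReal.ofReal (q y)).prod
          (volume.withDensity fun y => ENNReal.ofReal (q y))) =
      ∫⁻ w, ENNReal.ofReal (sphereArea (m + 2) * correlation q (h * w.1) w.2)
        ∂((kernelMeasure K).prod (angleMeasure m κ)) := by
  have hω : 0 < sphereArea (m + 2) := sphereArea_pos (by omega)
  have hω' : 0 < sphereArea (m + 1) := sphereArea_pos (by omega)
  have hZ := angleMass_pos m κ
  have := hK.isProbabilityMeasure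
  have ha : Measurable fun x => ENNReal.ofReal (K (x / h) / h) :=
    ((hK.measurable.comp (measurable_id.div_const h)).div_const h).ennreal_ofReal
  have hb : Measurable fun t => ENNReal.ofReal
      (Real.exp (κ * t) / (sphereArea (m + 1) * angleMass m κ)) := by fun_prop
  have hcm : Measurable fun w : ℝ × ℝ => ENNReal.ofReal (correlation q w.1 w.2) :=
    hq.measurable_correlation.ennreal_ofReal
  have hcs : Measurable fun w : ℝ × ℝ =>
      ENNReal.ofReal (sphereArea (m + 2) * correlation q (h * w.1) w.2) := by
    have h1 : Measurable fun w : ℝ × ℝ => (h * w.1, w.2) := by fun_prop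
    exact ((hq.measurable_correlation.comp h1).const_mul _).ennreal_ofReal
  rw [lintegral_prod _ (measurable_polarKernel hK h κ).ennreal_ofReal.aemeasurable,
    lintegral_prod _ hcs.aemeasurable]
  have e1 : ∀ y y' : Euc (m + 2), ENNReal.ofReal (polarKernel m K h κ (y, y')) =
      ENNReal.ofReal (K ((‖y‖ - ‖y'‖) / h) / h) * ENNReal.ofReal
        (Real.exp (κ * inner ℝ (‖y‖⁻¹ • y) (‖y'‖⁻¹ • y')) /
          (sphereArea (m + 1) * angleMass m κ)) := fun y y' =>
    ENNReal.ofReal_mul (div_nonneg (hK.nonneg _) hh.le)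
  simp only [e1]
  rw [lintegral_pair hq hq0 ha hb]
  set J : ℝ → ENNReal := fun x => ∫⁻ θ, ENNReal.ofReal (correlation q x θ) ∂(angleMeasure m κ) with hJ
  have hJm : Measurable J := hcm.lintegral_prod_right'
  have e2 : ∀ x, ENNReal.ofReal (sphereArea (m + 1)) * ∫⁻ θ in Set.Ioo 0 Real.pi,
      ENNReal.ofReal (Real.exp (κ * Real.cos θ) / (sphereArea (m + 1) * angleMass m κ)) *
        ENNReal.ofReal (Real.sin θ ^ m) * ENNReal.ofReal (correlation q x θ) = J x := by
    intro x
    have hx : Measurable fun θ => ENNReal.ofReal (correlation q x θ) :=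
      hcm.comp measurable_prodMk_left
    rw [← lintegral_const_mul' _ _ ENNReal.ofReal_ne_top, hJ]
    simp only []
    rw [angleMeasure, lintegral_withDensity_eq_lintegral_mul _
      (continuous_angleDensity m κ).measurable.ennreal_ofReal hx]
    refine lintegral_congr fun θ => ?_
    rw [Pi.mul_apply, ← mul_assoc, ← mul_assoc, ← ENNReal.ofReal_mul hω'.le,
      ← ENNReal.ofReal_mul (by positivity)]
    congr 2
    rw [angleWeight]
    field_simp
  rw [← lintegral_const_mul' _ _ ENNReal.ofReal_ne_top]
  have e3 : ∀ x, ENNReal.ofReal (sphereArea (m + 1)) * (ENNReal.ofReal (K (x / h) / h) *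
      ∫⁻ θ in Set.Ioo 0 Real.pi,
        ENNReal.ofReal (Real.exp (κ * Real.cos θ) / (sphereArea (m + 1) * angleMass m κ)) *
        ENNReal.ofReal (Real.sin θ ^ m) * ENNReal.ofReal (correlation q x θ)) =
      ENNReal.ofReal (K (x / h) / h) * J x := fun x => by
    rw [← e2 x]
    ring
  rw [lintegral_congr e3, lintegral_kernel_scale hK hh hJm,
    ← lintegral_const_mul' _ _ ENNReal.ofReal_ne_top]
  refine lintegral_congr fun s => ?_
  rw [hJ, ← lintegral_const_mul' _ _ ENNReal.ofReal_ne_top]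
  refine lintegral_congr fun θ => ?_
  rw [ENNReal.ofReal_mul hω.le]

theorem lintegral_radialKernel (hq : IsSmoothDensity q) (hq0 : ∀ y, 0 ≤ q y) (hK : IsKernel K)
    {h : ℝ} (hh : 0 < h) :
    ∫⁻ w, ENNReal.ofReal (radialKernel m K h w)
        ∂((volume.withDensity fun y => ENNReal.ofReal (q y)).prod
          (volume.withDensity fun y => ENNReal.ofReal (q y))) =
      ∫⁻ s, ENNReal.ofReal (marginalCorrelation q (h * s)) ∂(kernelMeasure K) := by
  have ha : Measurable fun x => ENNReal.ofReal (K (x / h) / h) :=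
    ((hK.measurable.comp (measurable_id.div_const h)).div_const h).ennreal_ofReal
  rw [lintegral_prod _ (measurable_radialKernel hK h).ennreal_ofReal.aemeasurable,
    ← lintegral_kernel_scale hK hh hq.measurable_marginalCorrelation.ennreal_ofReal,
    ← lintegral_pair_norm hq hq0 ha]
  rfl

theorem IsSmoothDensity.integrable_correlation (hq : IsSmoothDensity q) (hK : IsKernel K)
    (h κ : ℝ) : Integrable (fun w : ℝ × ℝ => sphereArea (m + 2) * correlation q (h * w.1) w.2)
      ((kernelMeasure K).prod (angleMeasure m κ)) := by
  have := hK.isProbabilityMeasure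
  have h1 : Measurable fun w : ℝ × ℝ => (h * w.1, w.2) := by fun_prop
  exact (Integrable.of_bound (hq.measurable_correlation.comp h1).aestronglyMeasurable
    (correlation q 0 0) (Filter.Eventually.of_forall fun w =>
      hq.abs_correlation_le _ _)).const_mul _

theorem IsSmoothDensity.integrable_marginalCorrelation (hq : IsSmoothDensity q) (hK : IsKernel K)
    (h : ℝ) : Integrable (fun s => marginalCorrelation q (h * s)) (kernelMeasure K) := by
  have := hK.isProbabilityMeasure
  exact Integrable.of_bound
    (hq.measurable_marginalCorrelation.comp (measurable_const_mul h)).aestronglyMeasurable _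
    (Filter.Eventually.of_forall fun s => hq.abs_marginalCorrelation_le _)

/-- The expectation of the estimator of the deviation from sphericity. -/
def estimatorMean (q : Euc (m + 2) → ℝ) (K : ℝ → ℝ) (h κ : ℝ) : ℝ :=
  (∫ w, sphereArea (m + 2) * correlation q (h * w.1) w.2
    ∂((kernelMeasure K).prod (angleMeasure m κ))) -
  (sphereArea (m + 2))⁻¹ * ∫ s, marginalCorrelation q (h * s) ∂(kernelMeasure K)

theorem integral_kernel (hq : IsSmoothDensity q) (hq0 : ∀ y, 0 ≤ q y) (hK : IsKernel K)
    {h : ℝ} (hh : 0 < h) (κ : ℝ) :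
    Integrable (fun w => polarKernel m K h κ w - (sphereArea (m + 2))⁻¹ * radialKernel m K h w)
      ((volume.withDensity fun y => ENNReal.ofReal (q y)).prod
        (volume.withDensity fun y => ENNReal.ofReal (q y))) ∧
    ∫ w, (polarKernel m K h κ w - (sphereArea (m + 2))⁻¹ * radialKernel m K h w)
      ∂((volume.withDensity fun y => ENNReal.ofReal (q y)).prod
        (volume.withDensity fun y => ENNReal.ofReal (q y))) = estimatorMean q K h κ := by
  have hω : 0 < sphereArea (m + 2) := sphereArea_pos (by omega)
  obtain ⟨i1, e1⟩ := integrable_and_integral_eq (measurable_polarKernel hK h κ)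
    (polarKernel_nonneg hK hh κ) (hq.integrable_correlation hK h κ)
    (fun w => mul_nonneg hω.le (correlation_nonneg hq0 _ _)) (lintegral_polarKernel hq hq0 hK hh κ)
  obtain ⟨i2, e2⟩ := integrable_and_integral_eq (measurable_radialKernel hK h)
    (radialKernel_nonneg hK hh) (hq.integrable_marginalCorrelation hK h)
    (fun w => marginalCorrelation_nonneg hq0 _) (lintegral_radialKernel hq hq0 hK hh)
  refine ⟨i1.sub (i2.const_mul _), ?_⟩
  rw [integral_sub i1 (i2.const_mul _), integral_const_mul, e1, e2, estimatorMean]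

theorem deviationEstimator_eq {n : ℕ} {h κ : ℝ} (hκ : 0 < κ) (y : Fin n → Euc (m + 2)) :
    deviationEstimator K h κ y = ((n : ℝ) * ((n : ℝ) - 1))⁻¹ *
      ∑ ij ∈ (Finset.univ : Finset (Fin n)).offDiag,
        (polarKernel m K h κ (y ij.1, y ij.2) -
          (sphereArea (m + 2))⁻¹ * radialKernel m K h (y ij.1, y ij.2)) := by
  have h1 : ∀ ij : Fin n × Fin n, polarKernel m K h κ (y ij.1, y ij.2) =
      K ((‖y ij.1‖ - ‖y ij.2‖) / h) * langevin (m + 2) κ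
        (inner ℝ (‖y ij.1‖⁻¹ • y ij.1) (‖y ij.2‖⁻¹ • y ij.2)) / (langevinMass (m + 2) κ * h) :=
    fun ij => by
      rw [polarKernel, ← langevin_div_langevinMass hκ]
      ring
  have h2 : ∀ ij : Fin n × Fin n, radialKernel m K h (y ij.1, y ij.2) =
      K ((‖y ij.1‖ - ‖y ij.2‖) / h) / h := fun _ => rfl
  simp only [h1, h2]
  rw [deviationEstimator, polarEstimator, radialEstimator, Finset.sum_sub_distrib, ← Finset.mul_sum,
    ← Finset.sum_div, ← Finset.sum_div]
  simp only [div_eq_mul_inv, mul_inv]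
  ring

/-- By independence each of the n(n-1) ordered pairs has the product law, so all summands share one
mean and the average does not depend on n. This is the uniformity in n. -/
theorem integral_deviationEstimator {Ω : Type*} [MeasurableSpace Ω] {P : Measure Ω}
    [IsProbabilityMeasure P] {Y : ℕ → Ω → Euc (m + 2)} (hYmeas : ∀ i, Measurable (Y i))
    (hYindep : iIndepFun Y P) (hq0 : ∀ y, 0 ≤ q y)
    (hYlaw : ∀ i, P.map (Y i) = volume.withDensity (fun y => ENNReal.ofReal (q y)))
    (hK : IsKernel K) (hq : IsSmoothDensity q) {n : ℕ} (hn : 2 ≤ n) {h κ : ℝ} (hh : 0 < h)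
    (hκ : 0 < κ) :
    Integrable (fun ω => deviationEstimator K h κ (fun i : Fin n => Y i ω)) P ∧
    ∫ ω, deviationEstimator K h κ (fun i : Fin n => Y i ω) ∂P = estimatorMean q K h κ := by
  obtain ⟨i1, e1⟩ := integral_kernel hq hq0 hK hh κ
  set T : Euc (m + 2) × Euc (m + 2) → ℝ := fun w =>
    polarKernel m K h κ w - (sphereArea (m + 2))⁻¹ * radialKernel m K h w
  have hmap : ∀ i j, i ≠ j → P.map (fun ω => (Y i ω, Y j ω)) =
      (volume.withDensity fun y => ENNReal.ofReal (q y)).prod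
        (volume.withDensity fun y => ENNReal.ofReal (q y)) := by
    intro i j hij
    rw [(indepFun_iff_map_prod_eq_prod_map_map (hYmeas i).aemeasurable
      (hYmeas j).aemeasurable).1 (hYindep.indepFun hij), hYlaw, hYlaw]
  have hpm : ∀ i j, Measurable fun ω => (Y i ω, Y j ω) := fun i j => (hYmeas i).prodMk (hYmeas j)
  have hi : ∀ i j, i ≠ j → Integrable (fun ω => T (Y i ω, Y j ω)) P := by
    intro i j hij
    rw [← hmap i j hij] at i1
    exact i1.comp_measurable (hpm i j)
  have he : ∀ i j, i ≠ j → ∫ ω, T (Y i ω, Y j ω) ∂P = estimatorMean q K h κ := by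
    intro i j hij
    rw [← e1, ← hmap i j hij]
    rw [← hmap i j hij] at i1
    exact (integral_map (hpm i j).aemeasurable i1.1).symm
  have hne : ∀ ij ∈ (Finset.univ : Finset (Fin n)).offDiag, (ij.1 : ℕ) ≠ ij.2 := fun ij hij h0 =>
    (Finset.mem_offDiag.1 hij).2.2 (Fin.ext h0)
  simp only [deviationEstimator_eq hκ]
  refine ⟨(integrable_finsetSum _ fun ij hij => hi _ _ (hne ij hij)).const_mul _, ?_⟩
  rw [integral_const_mul, integral_finsetSum _ fun ij hij => hi _ _ (hne ij hij),
    Finset.sum_congr rfl fun ij hij => he _ _ (hne ij hij), Finset.sum_const, Finset.offDiag_card,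
    Finset.card_univ, Fintype.card_fin, nsmul_eq_mul, Nat.cast_sub (Nat.le_mul_self n)]
  have hn' : (2 : ℝ) ≤ n := by exact_mod_cast hn
  have h1 : (n : ℝ) * ((n : ℝ) - 1) ≠ 0 := by
    refine mul_ne_zero (by linarith) (by linarith)
  push_cast
  rw [← mul_assoc, show (n : ℝ) * n - n = n * ((n : ℝ) - 1) by ring, inv_mul_cancel₀ h1, one_mul]

end

/-! ### The spherical case and the bias expansion -/

noncomputable section

variable {m : ℕ} {q : Euc (m + 2) → ℝ} {K : ℝ → ℝ}

theorem lift_mul (a b : ℝ × Sph (m + 2) → ℝ) (z : ℝ × OG (m + 2)) :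
    lift a z * lift b z = lift (fun z => a z * b z) z := by
  obtain ⟨u, g⟩ := z
  rcases le_or_gt u 0 with hu | hu
  · simp only [lift_of_nonpos _ hu, mul_zero]
  · simp only [lift_of_pos _ hu]

theorem integral_lift_mul {a b : ℝ × Sph (m + 2) → ℝ} (ha : MemLp a 2 (polarMeasure (m + 2)))
    (hb : MemLp b 2 (polarMeasure (m + 2))) :
    ∫ z, lift a z * lift b z ∂(volume.prod (orthMeasure (m + 2))) =
      (sphereArea (m + 2))⁻¹ * ∫ z, a z * b z ∂(polarMeasure (m + 2)) := by
  simp only [lift_mul]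
  exact integral_lift (ha.1.mul hb.1)

theorem IsSmoothDensity.correlation_zero (hq : IsSmoothDensity q) :
    correlation q 0 0 =
      (sphereArea (m + 2))⁻¹ * ∫ z, polarDensity q z.1 z.2 ^ 2 ∂(polarMeasure (m + 2)) := by
  simp only [correlation, shift_zero, spin_zero]
  rw [integral_lift_mul hq.memLp hq.memLp]
  simp only [sq]

theorem lift_eq_marginal_of_asphericity (h : asphericity q =ᵐ[polarMeasure (m + 2)] 0) :
    ∀ᵐ z ∂((volume : Measure ℝ).prod (orthMeasure (m + 2))),
      liftDensity q z = (sphereArea (m + 2))⁻¹ * marginal q z.1 := by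
  filter_upwards [ae_lift h] with z hz
  obtain ⟨u, g⟩ := z
  rcases le_or_gt u 0 with hu | hu
  · rw [liftDensity, lift_of_nonpos _ hu, marginal, Set.indicator_of_notMem (by simpa using hu),
      mul_zero]
  · rw [liftDensity, lift_of_pos _ hu, marginal, Set.indicator_of_mem (Set.mem_Ioi.2 hu), mul_comm]
    exact sub_eq_zero.1 (hz hu)

/-- In the spherical case Φ depends on u only, up to a null set, and the flows preserve null sets;
the rotation has no effect. -/
theorem correlation_of_asphericity (h : asphericity q =ᵐ[polarMeasure (m + 2)] 0) (x θ : ℝ) :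
    correlation q x θ = (sphereArea (m + 2))⁻¹ ^ 2 * marginalCorrelation q x := by
  have h1 := lift_eq_marginal_of_asphericity h
  have h2 := (((isFlow_shift (orthMeasure (m + 2))).measurePreserving x).comp
    ((isFlow_spin m).measurePreserving θ)).quasiMeasurePreserving.ae h1
  have h3 : correlation q x θ = ∫ z : ℝ × OG (m + 2), (sphereArea (m + 2))⁻¹ ^ 2 *
      (marginal q z.1 * marginal q (z.1 + x)) ∂((volume : Measure ℝ).prod (orthMeasure (m + 2))) := by
    refine integral_congr_ae ?_
    filter_upwards [h1, h2] with z hz1 hz2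
    have hz3 : liftDensity q (shift x (spin m θ z)) =
      (sphereArea (m + 2))⁻¹ * marginal q (z.1 + x) := hz2
    rw [hz1, hz3]
    ring
  rw [h3, integral_fun_fst (fun u => (sphereArea (m + 2))⁻¹ ^ 2 * (marginal q u * marginal q (u + x))),
    probReal_univ, one_smul, integral_const_mul]
  rfl

theorem estimatorMean_eq_zero (hK : IsKernel K) (h0 : asphericity q =ᵐ[polarMeasure (m + 2)] 0)
    (h κ : ℝ) : estimatorMean q K h κ = 0 := by
  have hω : 0 < sphereArea (m + 2) := sphereArea_pos (by omega)
  have := hK.isProbabilityMeasure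
  rw [estimatorMean]
  simp only [correlation_of_asphericity h0]
  rw [integral_fun_fst (fun s => sphereArea (m + 2) * ((sphereArea (m + 2))⁻¹ ^ 2 *
    marginalCorrelation q (h * s))), probReal_univ, one_smul, integral_const_mul, integral_const_mul]
  field_simp
  ring

theorem IsKernel.integrable_sq (hK : IsKernel K) :
    Integrable (fun s => s ^ 2) (kernelMeasure K) := by
  have := hK.isProbabilityMeasure
  refine Integrable.of_bound (by fun_prop) 1 ?_
  filter_upwards [hK.ae_abs_le] with s hs
  rw [Real.norm_of_nonneg (sq_nonneg _), ← sq_abs]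
  exact pow_le_one₀ (abs_nonneg _) hs

theorem integrable_angle_pow (m k : ℕ) (κ : ℝ) :
    Integrable (fun θ => θ ^ k) (angleMeasure m κ) := by
  refine Integrable.of_bound (by fun_prop) (Real.pi ^ k) ?_
  filter_upwards [ae_angleMeasure_mem m κ] with θ hθ
  rw [Real.norm_of_nonneg (pow_nonneg hθ.1.le _)]
  exact pow_le_pow_left₀ hθ.1.le hθ.2.le k

/-- A function with an expansion in `x` and `θ` is averaged term by term. -/
theorem abs_integral_prod_sub_le (hK : IsKernel K) {κ h a b c C : ℝ} {Q : ℝ → ℝ → ℝ} (hh : 0 < h)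
    (hh1 : h ≤ 1) (hC : 0 ≤ C)
    (hQi : Integrable (fun w : ℝ × ℝ => Q (h * w.1) w.2) ((kernelMeasure K).prod (angleMeasure m κ)))
    (hQ : ∀ x θ, |x| ≤ 1 → 0 ≤ θ →
      |Q x θ - (a + x ^ 2 / 2 * b + θ ^ 2 / 2 * c)| ≤ C * (|x| ^ 3 + θ ^ 4)) :
    |(∫ w, Q (h * w.1) w.2 ∂((kernelMeasure K).prod (angleMeasure m κ))) -
      (a + h ^ 2 * kernelMoment 2 K / 2 * b +
        angleInt m κ (fun θ => θ ^ 2) / angleMass m κ / 2 * c)| ≤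
      C * (h ^ 3 + angleInt m κ (fun θ => θ ^ 4) / angleMass m κ) := by
  have := hK.isProbabilityMeasure
  set ρ := (kernelMeasure K).prod (angleMeasure m κ)
  have i1 : Integrable (fun w : ℝ × ℝ => h ^ 2 / 2 * b * w.1 ^ 2) ρ :=
    (hK.integrable_sq.comp_fst _).const_mul _
  have i2 : Integrable (fun w : ℝ × ℝ => c / 2 * w.2 ^ 2) ρ :=
    ((integrable_angle_pow m 2 κ).comp_snd _).const_mul _
  have i3 : Integrable (fun w : ℝ × ℝ => C * w.2 ^ 4) ρ :=
    ((integrable_angle_pow m 4 κ).comp_snd _).const_mul _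
  have e1 : ∫ w : ℝ × ℝ, h ^ 2 / 2 * b * w.1 ^ 2 ∂ρ = h ^ 2 / 2 * b * kernelMoment 2 K := by
    rw [integral_const_mul, integral_fun_fst (fun s : ℝ => s ^ 2), probReal_univ, one_smul,
      hK.integral_sq]
  have e2 : ∀ k (r : ℝ), ∫ w : ℝ × ℝ, r * w.2 ^ k ∂ρ =
      r * (angleInt m κ (fun θ => θ ^ k) / angleMass m κ) := fun k r => by
    rw [integral_const_mul, integral_fun_snd (fun θ : ℝ => θ ^ k), probReal_univ, one_smul,
      integral_angleMeasure]
  have i4 : Integrable (fun w : ℝ × ℝ => a + h ^ 2 / 2 * b * w.1 ^ 2) ρ := (integrable_const a).add i1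
  have i5 : Integrable (fun w : ℝ × ℝ => a + h ^ 2 / 2 * b * w.1 ^ 2 + c / 2 * w.2 ^ 2) ρ := i4.add i2
  have e3 : ∫ w : ℝ × ℝ, (a + h ^ 2 / 2 * b * w.1 ^ 2 + c / 2 * w.2 ^ 2) ∂ρ =
      a + h ^ 2 * kernelMoment 2 K / 2 * b +
        angleInt m κ (fun θ => θ ^ 2) / angleMass m κ / 2 * c := by
    rw [integral_add i4 i2, integral_add (integrable_const a) i1, e1, e2, integral_const,
      probReal_univ, one_smul]
    ring
  have e4 : ∫ w : ℝ × ℝ, (C * h ^ 3 + C * w.2 ^ 4) ∂ρ =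
      C * (h ^ 3 + angleInt m κ (fun θ => θ ^ 4) / angleMass m κ) := by
    rw [integral_add (integrable_const _) i3, e2, integral_const, probReal_univ, one_smul]
    ring
  rw [← e3, ← e4, ← integral_sub hQi i5, ← Real.norm_eq_abs]
  refine norm_integral_le_of_norm_le ((integrable_const _).add i3) ?_
  have h1 : ∀ᵐ w ∂ρ, |w.1| ≤ 1 := Measure.quasiMeasurePreserving_fst.ae hK.ae_abs_le
  have h2 : ∀ᵐ w ∂ρ, w.2 ∈ Set.Ioo 0 Real.pi :=
    Measure.quasiMeasurePreserving_snd.ae (ae_angleMeasure_mem m κ)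
  filter_upwards [h1, h2] with w hw1 hw2
  have h3 : |h * w.1| ≤ h := by
    rw [abs_mul, abs_of_pos hh]
    exact mul_le_of_le_one_right hh.le hw1
  have h4 := hQ (h * w.1) w.2 (h3.trans hh1) hw2.1.le
  rw [Real.norm_eq_abs]
  have h5 : |h * w.1| ^ 3 ≤ h ^ 3 := pow_le_pow_left₀ (abs_nonneg _) h3 3
  calc _ = |Q (h * w.1) w.2 - (a + (h * w.1) ^ 2 / 2 * b + w.2 ^ 2 / 2 * c)| := by
        congr 1
        ring
    _ ≤ C * (|h * w.1| ^ 3 + w.2 ^ 4) := h4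
    _ ≤ C * (h ^ 3 + w.2 ^ 4) := by gcongr
    _ = _ := by ring

theorem abs_integral_kernel_sub_le (hK : IsKernel K) {h a b C : ℝ} {S : ℝ → ℝ} (hh : 0 < h)
    (hh1 : h ≤ 1) (hC : 0 ≤ C) (hSi : Integrable (fun s => S (h * s)) (kernelMeasure K))
    (hS : ∀ x, |x| ≤ 1 → |S x - (a + x ^ 2 / 2 * b)| ≤ C * |x| ^ 3) :
    |(∫ s, S (h * s) ∂(kernelMeasure K)) - (a + h ^ 2 * kernelMoment 2 K / 2 * b)| ≤ C * h ^ 3 := by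
  have := hK.isProbabilityMeasure
  have i1 : Integrable (fun s : ℝ => h ^ 2 / 2 * b * s ^ 2) (kernelMeasure K) :=
    hK.integrable_sq.const_mul _
  have i2 : Integrable (fun s : ℝ => a + h ^ 2 / 2 * b * s ^ 2) (kernelMeasure K) :=
    (integrable_const a).add i1
  have e1 : ∫ s, (a + h ^ 2 / 2 * b * s ^ 2) ∂(kernelMeasure K) =
      a + h ^ 2 * kernelMoment 2 K / 2 * b := by
    rw [integral_add (integrable_const a) i1, integral_const_mul, hK.integral_sq, integral_const,
      probReal_univ, one_smul]
    ring
  have e2 : ∫ _ : ℝ, C * h ^ 3 ∂(kernelMeasure K) = C * h ^ 3 := by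
    rw [integral_const, probReal_univ, one_smul]
  rw [← e1, ← e2, ← integral_sub hSi i2, ← Real.norm_eq_abs]
  refine norm_integral_le_of_norm_le (integrable_const _) ?_
  filter_upwards [hK.ae_abs_le] with s hs
  have h3 : |h * s| ≤ h := by
    rw [abs_mul, abs_of_pos hh]
    exact mul_le_of_le_one_right hh.le hs
  rw [Real.norm_eq_abs]
  calc _ = |S (h * s) - (a + (h * s) ^ 2 / 2 * b)| := by
        congr 1
        ring
    _ ≤ C * |h * s| ^ 3 := hS _ (h3.trans hh1)
    _ ≤ C * h ^ 3 := by gcongr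

/-- The expansions of the two correlations are averaged term by term. The constant and h² terms
combine directly; the angular term uses the second moment (m+1)/κ + O(κ⁻²). -/
theorem estimatorMean_expansion (hK : IsKernel K) (hq : IsSmoothDensity q) :
    ∃ C : ℝ, 0 ≤ C ∧ ∀ h κ : ℝ, 0 < h → h ≤ 1 → 1 ≤ κ →
      |estimatorMean q K h κ - ((∫ z, asphericity q z ^ 2 ∂(polarMeasure (m + 2))) +
        h ^ 2 * kernelMoment 2 K / 2 *
          ((∫ z, polarDensity q z.1 z.2 * radialSecondDeriv (polarDensity q) z.1 z.2
              ∂(polarMeasure (m + 2))) -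
            (sphereArea (m + 2))⁻¹ * ∫ u in Set.Ioi (0 : ℝ), radialMarginal (polarDensity q) u *
              iteratedDeriv 2 (radialMarginal (polarDensity q)) u) +
        1 / (2 * κ) * ∫ z, polarDensity q z.1 z.2 *
          (sphericalHessian (polarDensity q) z.1 z.2).trace ∂(polarMeasure (m + 2)))| ≤
      C * (h ^ 3 + 1 / κ ^ 2) := by
  have hω : 0 < sphereArea (m + 2) := sphereArea_pos (by omega)
  obtain ⟨C₁, hC₁, h1⟩ := hq.correlation_expansion
  obtain ⟨C₂, hC₂, h2⟩ := hq.marginal_expansion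
  obtain ⟨C₃, hC₃, h3⟩ := exists_angleInt_moments m
  rw [integral_frameHessian hq, integral_lift_mul hq.memLp hq.memLp_radial,
    hq.correlation_zero] at h1
  rw [hq.integral_sq_asphericity]
  set ω := sphereArea (m + 2)
  set D₁ := ∫ z, polarDensity q z.1 z.2 ^ 2 ∂(polarMeasure (m + 2))
  set D₂ := ∫ u in Set.Ioi (0 : ℝ), radialMarginal (polarDensity q) u ^ 2
  set R₁ := ∫ z, polarDensity q z.1 z.2 * radialSecondDeriv (polarDensity q) z.1 z.2
    ∂(polarMeasure (m + 2))
  set R₂ := ∫ u in Set.Ioi (0 : ℝ), radialMarginal (polarDensity q) u *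
    iteratedDeriv 2 (radialMarginal (polarDensity q)) u
  set A := ∫ z, polarDensity q z.1 z.2 * (sphericalHessian (polarDensity q) z.1 z.2).trace
    ∂(polarMeasure (m + 2))
  have hm : (0 : ℝ) < (m : ℝ) + 1 := by positivity
  have h1' : ∀ x θ, |x| ≤ 1 → 0 ≤ θ → |ω * correlation q x θ -
      (D₁ + x ^ 2 / 2 * R₁ + θ ^ 2 / 2 * (((m : ℝ) + 1)⁻¹ * A))| ≤ ω * C₁ * (|x| ^ 3 + θ ^ 4) := by
    intro x θ hx hθ
    have h4 := mul_le_mul_of_nonneg_left (h1 x θ hx hθ) hω.le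
    rw [← abs_of_pos hω, ← abs_mul, abs_of_pos hω] at h4
    rw [mul_assoc]
    refine le_trans (le_of_eq ?_) h4
    congr 1
    field_simp
  refine ⟨ω * C₁ + ω⁻¹ * C₂ + ω * C₁ * C₃ + C₃ * ((m : ℝ) + 1)⁻¹ * |A|, by positivity,
    fun h κ hh hh1 hκ => ?_⟩
  have hκ0 : 0 < κ := by linarith
  obtain ⟨h31, h32⟩ := h3 κ hκ
  have hZ := angleMass_pos m κ
  have b1 := abs_integral_prod_sub_le (m := m) (κ := κ) hK (Q := fun x θ => ω * correlation q x θ)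
    hh hh1 (by positivity) (hq.integrable_correlation hK h κ) h1'
  have b2 := abs_integral_kernel_sub_le hK (S := marginalCorrelation q) hh hh1 hC₂
    (hq.integrable_marginalCorrelation hK h) h2
  have b3 : angleInt m κ (fun θ => θ ^ 4) / angleMass m κ ≤ C₃ * (1 / κ ^ 2) := by
    rw [div_le_iff₀ hZ]
    calc _ ≤ _ := h31
      _ = _ := by ring
  have b4 : |angleInt m κ (fun θ => θ ^ 2) / angleMass m κ - (m + 1) / κ| ≤ C₃ * (1 / κ ^ 2) := by
    have e : angleInt m κ (fun θ => θ ^ 2) / angleMass m κ - (m + 1) / κ =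
        (angleInt m κ (fun θ => θ ^ 2) - (m + 1) * angleMass m κ / κ) / angleMass m κ := by
      field_simp
    rw [e, abs_div, abs_of_pos hZ, div_le_iff₀ hZ]
    calc _ ≤ _ := h32
      _ = _ := by ring
  set t₂ := angleInt m κ (fun θ => θ ^ 2) / angleMass m κ
  set t₄ := angleInt m κ (fun θ => θ ^ 4) / angleMass m κ
  set E₁ := ∫ w, ω * correlation q (h * w.1) w.2 ∂((kernelMeasure K).prod (angleMeasure m κ))
  set E₂ := ∫ s, marginalCorrelation q (h * s) ∂(kernelMeasure K)
  have b5 : ω * C₁ * (h ^ 3 + t₄) ≤ ω * C₁ * (h ^ 3 + C₃ * (1 / κ ^ 2)) := by gcongr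
  have b6 : |(t₂ - (m + 1) / κ) / 2 * (((m : ℝ) + 1)⁻¹ * A)| ≤
      C₃ * ((m : ℝ) + 1)⁻¹ * |A| * (1 / κ ^ 2) := by
    rw [abs_mul, abs_mul, abs_div, abs_of_pos (inv_pos.2 hm), abs_two]
    calc |t₂ - (m + 1) / κ| / 2 * (((m : ℝ) + 1)⁻¹ * |A|)
        ≤ (C₃ * (1 / κ ^ 2)) * (((m : ℝ) + 1)⁻¹ * |A|) := by
          refine mul_le_mul_of_nonneg_right ?_ (by positivity)
          linarith [abs_nonneg (t₂ - (m + 1) / κ)]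
      _ = _ := by ring
  have b7 : |ω⁻¹ * (E₂ - (D₂ + h ^ 2 * kernelMoment 2 K / 2 * R₂))| ≤ ω⁻¹ * (C₂ * h ^ 3) := by
    rw [abs_mul, abs_of_pos (inv_pos.2 hω)]
    exact mul_le_mul_of_nonneg_left b2 (inv_pos.2 hω).le
  have e : estimatorMean q K h κ - (D₁ - ω⁻¹ * D₂ + h ^ 2 * kernelMoment 2 K / 2 * (R₁ - ω⁻¹ * R₂) +
      1 / (2 * κ) * A) =
      (E₁ - (D₁ + h ^ 2 * kernelMoment 2 K / 2 * R₁ + t₂ / 2 * (((m : ℝ) + 1)⁻¹ * A))) -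
      ω⁻¹ * (E₂ - (D₂ + h ^ 2 * kernelMoment 2 K / 2 * R₂)) +
      (t₂ - (m + 1) / κ) / 2 * (((m : ℝ) + 1)⁻¹ * A) := by
    -- The m + 1 of the second moment cancels the 1/(m + 1) of the average over tangent directions.
    have e1 : (m + 1 : ℝ) / κ / 2 * (((m : ℝ) + 1)⁻¹ * A) = 1 / (2 * κ) * A := by field_simp
    have e2 : estimatorMean q K h κ = E₁ - ω⁻¹ * E₂ := rfl
    rw [e2, ← e1]
    ring
  rw [e]
  have hκ2 : 0 ≤ 1 / κ ^ 2 := by positivity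
  have hh3 : 0 ≤ h ^ 3 := by positivity
  have n1 : 0 ≤ ω * C₁ * (1 / κ ^ 2) := by positivity
  have n2 : 0 ≤ ω⁻¹ * C₂ * (1 / κ ^ 2) := by positivity
  have n3 : 0 ≤ ω * C₁ * C₃ * h ^ 3 := by positivity
  have n4 : 0 ≤ C₃ * ((m : ℝ) + 1)⁻¹ * |A| * h ^ 3 := by positivity
  refine (abs_add_le _ _).trans ((add_le_add ((abs_sub _ _).trans (add_le_add b1 b7)) b6).trans ?_)
  nlinarith [b5]

/-- Positivity and the form of the remainder follow from the expansion. -/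
theorem exists_remainder_bound {E : ℝ → ℝ → ℝ} {D R A C : ℝ} (hD : 0 < D) (hC : 0 ≤ C)
    (hE : ∀ h κ : ℝ, 0 < h → h ≤ 1 → 1 ≤ κ →
      |E h κ - (D + h ^ 2 * R + 1 / (2 * κ) * A)| ≤ C * (h ^ 3 + 1 / κ ^ 2)) :
    ∃ κ₀ h₀ : ℝ, 0 < κ₀ ∧ 0 < h₀ ∧ ∀ h κ : ℝ, 0 < h → h ≤ h₀ → κ₀ ≤ κ →
      0 < E h κ ∧ |E h κ - (D + h ^ 2 * R + 1 / (2 * κ) * A)| ≤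
        C * (κ ^ (-(3 / 2) : ℝ) + h ^ 3 + h ^ 2 * κ⁻¹) := by
  set M := |R| + |A| + C + 1 with hM
  have hM0 : 0 < M := by positivity
  -- These thresholds make hM and M/κ at most D/4 each. For h ≤ 1 ≤ κ all corrections together are
  -- at most hM + M/κ ≤ D/2 < D.
  refine ⟨max 1 (4 * M / D), min 1 (D / (4 * M)), by positivity, by positivity,
    fun h κ hh hh0 hκ0 => ?_⟩
  have hh1 : h ≤ 1 := hh0.trans (min_le_left _ _)
  have hκ1 : 1 ≤ κ := (le_max_left _ _).trans hκ0
  have hκ : 0 < κ := by linarith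
  have h1 := hE h κ hh hh1 hκ1
  have hh2 : h * (4 * M) ≤ D := (le_div_iff₀ (by positivity)).1 (hh0.trans (min_le_right _ _))
  have hκ2 : κ⁻¹ * (4 * M) ≤ D := by
    have := (div_le_iff₀ hD).1 ((le_max_right _ _).trans hκ0)
    rw [inv_mul_le_iff₀ hκ]
    linarith
  have hκi : κ⁻¹ ≤ 1 := inv_le_one_of_one_le₀ hκ1
  have hκi0 : 0 < κ⁻¹ := inv_pos.2 hκ
  have e1 : 1 / κ ^ 2 = κ⁻¹ ^ 2 := by rw [one_div, inv_pow]
  have e2 : 1 / (2 * κ) * A = κ⁻¹ / 2 * A := by field_simp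
  refine ⟨?_, h1.trans (mul_le_mul_of_nonneg_left ?_ hC)⟩
  · rw [e1, e2] at h1
    have a1 : h ^ 3 ≤ h := by nlinarith [sq_nonneg h, mul_pos hh hh]
    have a2 : h ^ 2 ≤ h := by nlinarith
    have a3 : κ⁻¹ ^ 2 ≤ κ⁻¹ := by nlinarith
    have a4 : |h ^ 2 * R| ≤ h * |R| := by
      rw [abs_mul, abs_of_nonneg (sq_nonneg h)]
      exact mul_le_mul_of_nonneg_right a2 (abs_nonneg _)
    have a5 : |κ⁻¹ / 2 * A| ≤ κ⁻¹ * |A| := by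
      rw [abs_mul, abs_of_pos (by positivity)]
      exact mul_le_mul_of_nonneg_right (by linarith) (abs_nonneg _)
    have a6 : C * (h ^ 3 + κ⁻¹ ^ 2) ≤ C * (h + κ⁻¹) := by gcongr
    have a7 := (abs_le.1 h1).1
    have a8 := (abs_le.1 a4).1
    have a9 := (abs_le.1 a5).1
    have n1 : 0 ≤ h * |A| := by positivity
    have n2 : 0 ≤ κ⁻¹ * |R| := by positivity
    have b1 : h * (4 * M) = 4 * (h * |R| + h * |A| + h * C + h) := by rw [hM]; ring
    have b2 : κ⁻¹ * (4 * M) = 4 * (κ⁻¹ * |R| + κ⁻¹ * |A| + κ⁻¹ * C + κ⁻¹) := by rw [hM]; ring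
    have b3 : C * (h + κ⁻¹) = h * C + κ⁻¹ * C := by ring
    have n3 : 0 ≤ h * |R| := by positivity
    have n4 : 0 ≤ κ⁻¹ * |A| := by positivity
    have n5 : 0 ≤ h * C := by positivity
    have n6 : 0 ≤ κ⁻¹ * C := by positivity
    linarith
  -- For κ ≥ 1 one has κ⁻² ≤ κ^(-3/2), and the h²/κ term of the claimed bound is only added.
  · have a1 : 1 / κ ^ 2 ≤ κ ^ (-(3 / 2) : ℝ) := by
      have : 1 / κ ^ 2 = κ ^ (-2 : ℝ) := by
        rw [Real.rpow_neg hκ.le, one_div]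
        norm_num
      rw [this]
      exact Real.rpow_le_rpow_of_exponent_le hκ1 (by norm_num)
    have a2 : 0 ≤ h ^ 2 * κ⁻¹ := by positivity
    linarith

end

/-! ### Assembly -/

theorem mainTheorem5 {p : ℕ} (hp : 2 ≤ p)
    {Ω : Type*} [MeasurableSpace Ω] (P : Measure Ω) [IsProbabilityMeasure P]
    (Y : ℕ → Ω → EuclideanSpace ℝ (Fin p)) (hYmeas : ∀ i, Measurable (Y i))
    (hYindep : iIndepFun Y P)
    (q : EuclideanSpace ℝ (Fin p) → ℝ) (hqnonneg : ∀ y, 0 ≤ q y)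
    (hYlaw : ∀ i, P.map (Y i) = volume.withDensity (fun y => ENNReal.ofReal (q y)))
    (K : ℝ → ℝ) (hK : IsKernel K) (hq : IsSmoothDensity q) :
    -- the statistic has an expectation
    (∀ n : ℕ, 2 ≤ n → ∀ h κ : ℝ, 0 < h → 0 < κ →
      Integrable (fun ω => deviationEstimator K h κ (fun i : Fin n => Y i ω)) P) ∧
    -- sphericity means that the deviation vanishes
    (IsSpherical (P.map (Y 0)) ↔ deviation (polarDensity q) = 0) ∧
    -- the spherical case
    (IsSpherical (P.map (Y 0)) → ∀ n : ℕ, 2 ≤ n → ∀ h κ : ℝ, 0 < h → 0 < κ →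
      ∫ ω, deviationEstimator K h κ (fun i : Fin n => Y i ω) ∂P = 0) ∧
    -- the non-spherical case
    (¬ IsSpherical (P.map (Y 0)) →
      0 < deviation (polarDensity q) ∧
      (∀ᵐ u ∂(volume.restrict (Set.Ioi (0 : ℝ))),
        DifferentiableAt ℝ (radialMarginal (polarDensity q)) u ∧
        DifferentiableAt ℝ (deriv (radialMarginal (polarDensity q))) u) ∧
      IntegrableOn (fun u => radialMarginal (polarDensity q) u *
        iteratedDeriv 2 (radialMarginal (polarDensity q)) u) (Set.Ioi 0) ∧
      ∃ C κ₀ h₀ : ℝ, 0 < κ₀ ∧ 0 < h₀ ∧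
        ∀ n : ℕ, 2 ≤ n → ∀ h κ : ℝ, 0 < h → h ≤ h₀ → κ₀ ≤ κ →
          0 < ∫ ω, deviationEstimator K h κ (fun i : Fin n => Y i ω) ∂P ∧
          |(∫ ω, deviationEstimator K h κ (fun i : Fin n => Y i ω) ∂P) -
            (deviation (polarDensity q) +
              h ^ 2 * kernelMoment 2 K / 2 *
                ((∫ z, polarDensity q z.1 z.2 *
                    radialSecondDeriv (polarDensity q) z.1 z.2 ∂(polarMeasure p)) -
                  (sphereArea p)⁻¹ * ∫ u in Set.Ioi (0 : ℝ),
                    radialMarginal (polarDensity q) u *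
                      iteratedDeriv 2 (radialMarginal (polarDensity q)) u) +
              1 / (2 * κ) *
                ∫ z, polarDensity q z.1 z.2 *
                  (sphericalHessian (polarDensity q) z.1 z.2).trace ∂(polarMeasure p))|
            ≤ C * (κ ^ (-(3 / 2) : ℝ) + h ^ 3 + h ^ 2 * κ⁻¹)) := by
  obtain ⟨m, rfl⟩ : ∃ m, p = m + 2 := ⟨p - 2, by omega⟩
  have hmain := fun (n : ℕ) (hn : 2 ≤ n) (h κ : ℝ) (hh : 0 < h) (hκ : 0 < κ) =>
    integral_deviationEstimator hYmeas hYindep hqnonneg hYlaw hK hq hn hh hκ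
  -- That q has total mass one is not assumed; it follows because the law of Y is a probability.
  have hq1 : ∫⁻ y, ENNReal.ofReal (q y) = 1 := by
    have h1 : P.map (Y 0) Set.univ = 1 := by
      rw [Measure.map_apply (hYmeas 0) MeasurableSet.univ, Set.preimage_univ, measure_univ]
    rwa [hYlaw, withDensity_apply _ MeasurableSet.univ, Measure.restrict_univ] at h1
  have hsph : IsSpherical (P.map (Y 0)) ↔ asphericity q =ᵐ[polarMeasure (m + 2)] 0 := by
    rw [hYlaw]
    exact hq.isSpherical_iff hqnonneg hq1
  refine ⟨fun n hn h κ hh hκ => (hmain n hn h κ hh hκ).1,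
    hsph.trans (hq.deviation_eq_zero_iff hqnonneg hq1).symm, fun hs n hn h κ hh hκ => ?_,
    fun hs => ?_⟩
  · rw [(hmain n hn h κ hh hκ).2]
    exact estimatorMean_eq_zero hK (hsph.1 hs) h κ
  · have hD : 0 < deviation (polarDensity q) := by
      refine lt_of_le_of_ne ENNReal.toReal_nonneg fun h0 => hs ?_
      exact (hsph.trans (hq.deviation_eq_zero_iff hqnonneg hq1).symm).2 h0.symm
    refine ⟨hD, hq.ae_marginal.mono fun u hu => ⟨hu.1, hu.2.1⟩, hq.integrableOn_marginal, ?_⟩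
    obtain ⟨C, hC, hexp⟩ := estimatorMean_expansion hK hq
    rw [← hq.deviation_eq hqnonneg hq1] at hexp
    -- Reassociates the h² term, so that the kernel moment and the bracket form one coefficient R
    -- independent of h.
    simp only [mul_div_assoc, mul_assoc] at hexp ⊢
    obtain ⟨κ₀, h₀, hκ₀, hh₀, hb⟩ := exists_remainder_bound hD hC hexp
    refine ⟨C, κ₀, h₀, hκ₀, hh₀, fun n hn h κ hh hh1 hκ => ?_⟩
    rw [(hmain n hn h κ hh (hκ₀.trans_le hκ)).2]
    exact hb h κ hh hh1 hκ
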